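/- **Setting.** Let $\mathfrak g$ be a finite-dimensional real Lie algebra with a non-degenerate symmetric ad-invariant bilinear form $\langle\cdot,\cdot\rangle$ (not necessarily definite). Let $s^\sharp:\mathfrak g^*\to\mathfrak g$ be the inverse of $\xi\mapsto\langle\xi,\cdot\rangle$, let $(e_i)$, $(e^i)$ be bases of $\mathfrak g$ with $\langle e_i,e^j\rangle=\delta_i^j$, and let $\phi\in\wedge^3\mathfrak g$ be the element $\phi(\alpha,\beta,\gamma)=\tfrac12\,\alpha([s^\sharp\beta,s^\sharp\gamma])$. A quasi-Poisson $\mathfrak g$-manifold $(M,\rho,\pi)$ is a smooth manifold $M$ (finite-dimensional, without boundary, Hausdorff, second countable) with a Lie algebra homomorphism $\rho:\mathfrak g\to\Gamma(TM)$ and a $\mathfrak g$-invariant bivector field $\pi\in\Gamma(\wedge^2TM)$ such that $$[\pi,\pi]=\rho(\phi)\quad\text{and}\quad[\pi,\rho(\xi)]=0\ \text{ for all }\xi\in\mathfrak g .$$ Here $\rho$ is extended to $\wedge\mathfrak g\to\Gamma(\wedge TM)$, exterior products of vectors are evaluated on covectors by determinants, and $[\cdot,\cdot]$ is the Schouten bracket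 on multivector fields, normalized by $[X,f]=Xf$, $[X,Y]$ the Lie bracket of vector fields, $[P,Q]=-(-1)^{(p-1)(q-1)}[Q,P]$ and $[P,Q\wedge R]=[P,Q]\wedge R+(-1)^{(p-1)q}Q\wedge[P,R]$ for $P$, $Q$ of degrees $p$, $q$. A Lie algebroid structure on a vector bundle $A\to M$ consists of a smooth bundle map $a:A\to TM$ and a Lie bracket on $\Gamma(A)$ with $[s,ft]=f[s,t]+(a(s)f)\,t$ and $a([s,t])=[a(s),a(t)]$. Its differential $d_A:\Gamma(\wedge^kA^*)\to\Gamma(\wedge^{k+1}A^*)$ is $$d_A\omega(s_0,\dots,s_k)=\sum_i(-1)^i a(s_i)\,\omega(\dots,\widehat{s_i},\dots)+\sum_{i<j}(-1)^{i+j}\omega([s_i,s_j],\dots,\widehat{s_i},\dots,\widehat{s_j},\dots).$$ **Theorem.** Let $(M,\rho,\pi)$ be a quasi-Poisson $\mathfrak g$-manifold. Then there is a unique Lie algebroid structure on $T^*M$ whose differential on $\Gamma(\wedge^kTM)$, for every $k\ge 0$, is $$d_{T^*M}=[\pi,\cdot]+\tfrac12\sum_i\rho(e^i)\wedge[\rho(e_i),\cdot].$$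 The induced action of $\mathfrak g$ on $T^*M$ preserves this structure: for all $\xi\in\mathfrak g$ and $\alpha,\beta\in\Omega^1(M)$, $$\mathcal L_{\rho(\xi)}[\alpha,\beta]=[\mathcal L_{\rho(\xi)}\alpha,\beta]+[\alpha,\mathcal L_{\rho(\xi)}\beta]\quad\text{and}\quad a(\mathcal L_{\rho(\xi)}\alpha)=[\rho(\xi),a(\alpha)].$$ Finally, let $\mu_\rho:T^*M\to\mathfrak g$ be the map with $\langle\mu_\rho(\alpha),\xi\rangle=\alpha(\rho(\xi))$ for $\alpha\in T^*M$ and $\xi\in\mathfrak g$ (the transpose of $\rho$ followed by $\mathfrak g^*\cong\mathfrak g$). Then $\mu_\rho$ is a morphism of Lie algebroids, $\mathfrak g$ being a Lie algebroid over a point: it is smooth, linear on fibres, and the pull-back $\mu_\rho^*:\wedge\mathfrak g^*\to\Gamma(\wedge TM)$ satisfies $d_{T^*M}\circ\mu_\rho^*=\mu_\rho^*\circ d_{\mathfrak g}$, where $d_{\mathfrak g}$ is the Chevalley–Eilenberg differential. -/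

import Mathlib

open scoped Manifold ContDiff Topology

noncomputable section

/-! ### Cotangent bundle, functions, vector fields, 1-forms -/

/-- The cotangent space `T*_x M`; as `x` varies these are the fibres of the cotangent bundle, which
carries Mathlib's smooth vector bundle structure on bundles of continuous linear maps. -/
abbrev CotangentSpace (E : Type*) [NormedAddCommGroup E] [NormedSpace ℝ E]
    {M : Type*} [TopologicalSpace M] [ChartedSpace E M] (x : M) : Type _ :=
  TangentSpace 𝓘(ℝ, E) x →L[ℝ] Bundle.Trivial M ℝ x

/-- Smooth real functions on `M`. -/
abbrev SmoothFun (E : Type*) [NormedAddCommGroup E] [NormedSpace ℝ E]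
    (M : Type*) [TopologicalSpace M] [ChartedSpace E M] : Type _ :=
  C^∞⟮𝓘(ℝ, E), M; ℝ⟯

/-- Smooth sections of a vector bundle `A` over `M` with model fibre `F`. -/
abbrev Sections (E : Type*) [NormedAddCommGroup E] [NormedSpace ℝ E]
    {M : Type*} [TopologicalSpace M] [ChartedSpace E M]
    (F : Type*) [NormedAddCommGroup F] [NormedSpace ℝ F]
    (A : M → Type*) [TopologicalSpace (Bundle.TotalSpace F A)] [∀ x, TopologicalSpace (A x)]
    [FiberBundle F A] : Type _ :=
  ContMDiffSection 𝓘(ℝ, E) F ∞ A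

/-- Smooth vector fields on `M`. -/
abbrev SmoothVectorField (E : Type*) [NormedAddCommGroup E] [NormedSpace ℝ E]
    (M : Type*) [TopologicalSpace M] [ChartedSpace E M] [IsManifold 𝓘(ℝ, E) ∞ M] : Type _ :=
  Sections E E (TangentSpace 𝓘(ℝ, E) : M → Type _)

/-- Smooth 1-forms on `M`. -/
abbrev OneForm (E : Type*) [NormedAddCommGroup E] [NormedSpace ℝ E]
    (M : Type*) [TopologicalSpace M] [ChartedSpace E M] [IsManifold 𝓘(ℝ, E) ∞ M] : Type _ :=
  Sections E (E →L[ℝ] ℝ) (CotangentSpace E : M → Type _)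

section Basic

variable {E : Type*} [NormedAddCommGroup E] [NormedSpace ℝ E]
  {M : Type*} [TopologicalSpace M] [ChartedSpace E M]

/-- The pairing of a covector with a tangent vector. -/
def pairing {x : M} (α : CotangentSpace E x) (v : TangentSpace 𝓘(ℝ, E) x) : ℝ := α v

/-- The covector `d_x h`. -/
def covectorOf (E : Type*) [NormedAddCommGroup E] [NormedSpace ℝ E]
    {M : Type*} [TopologicalSpace M] [ChartedSpace E M] (h : M → ℝ) (x : M) :
    CotangentSpace E x :=
  mfderiv 𝓘(ℝ, E) 𝓘(ℝ, ℝ) h x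

/-- The derivative `v h = (d_x h)(v)` of a function along a tangent vector. -/
def dirDeriv {x : M} (v : TangentSpace 𝓘(ℝ, E) x) (h : M → ℝ) : ℝ :=
  pairing (covectorOf E h x) v

end Basic

/-! ### Forms on a vector bundle, Lie algebroids -/

section Algebroid

variable (E : Type*) [NormedAddCommGroup E] [NormedSpace ℝ E]
  {M : Type*} [TopologicalSpace M] [ChartedSpace E M]
  (F : Type*) [NormedAddCommGroup F] [NormedSpace ℝ F]
  (A : M → Type*) [TopologicalSpace (Bundle.TotalSpace F A)] [∀ x, TopologicalSpace (A x)]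
  [∀ x, AddCommGroup (A x)] [∀ x, Module ℝ (A x)] [FiberBundle F A] [VectorBundle ℝ F A]

/-- Elements of `Γ(⋀ᵏ A*)`: a family of alternating `k`-linear forms on the fibres `A_x` which is
smooth, i.e. gives a smooth function when evaluated on smooth sections of `A`. (Products of
1-forms are understood by the determinant convention, see `wedgeVector`.) -/
structure BundleForm (k : ℕ) where
  toFun : ∀ x : M, A x [⋀^Fin k]→ₗ[ℝ] ℝ
  smooth' : ∀ s : Fin k → Sections E F A,
    ContMDiff 𝓘(ℝ, E) 𝓘(ℝ, ℝ) ∞ (fun x => toFun x (fun i => s i x))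

/-- A Lie algebroid structure on the vector bundle `A → M`: an anchor `A → TM` (a smooth bundle
map) and a Lie bracket on `Γ(A)` satisfying the Leibniz rule, the anchor being compatible with
brackets. -/
structure LieAlgebroid [IsManifold 𝓘(ℝ, E) ∞ M] where
  anchor : ∀ x : M, A x →ₗ[ℝ] TangentSpace 𝓘(ℝ, E) x
  bracket : Sections E F A →ₗ[ℝ] Sections E F A →ₗ[ℝ] Sections E F A
  anchor_smooth : ∀ s : Sections E F A, ContMDiff 𝓘(ℝ, E) (𝓘(ℝ, E).prod 𝓘(ℝ, E)) ∞
    (fun x => Bundle.TotalSpace.mk' E (E := (TangentSpace 𝓘(ℝ, E) : M → Type _))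
      x (anchor x (s x)))
  bracket_self : ∀ s, bracket s s = 0
  jacobi : ∀ r s t,
    bracket r (bracket s t) = bracket (bracket r s) t + bracket s (bracket r t)
  leibniz : ∀ (s t ft : Sections E F A) (f : SmoothFun E M), (∀ x, ft x = f x • t x) →
    ∀ x, bracket s ft x = f x • bracket s t x + dirDeriv (anchor x (s x)) f • t x
  anchor_bracket : ∀ s t x, anchor x (bracket s t x) =
    VectorField.mlieBracket 𝓘(ℝ, E) (fun y => anchor y (s y)) (fun y => anchor y (t y)) x

namespace LieAlgebroid

variable {E F A} [IsManifold 𝓘(ℝ, E) ∞ M]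

/-- The Lie algebroid differential of a family `θ` of alternating `k`-forms, evaluated on sections
`s₀, …, s_k`:
`∑ᵢ (-1)ⁱ a(sᵢ) θ(s₀, …, ŝᵢ, …, s_k) + ∑_{i<j} (-1)^{i+j} θ([sᵢ,sⱼ], s₀, …, ŝᵢ, …, ŝⱼ, …, s_k)`.
In the second sum the bracket `[sᵢ,sⱼ]` is kept in the place of `sᵢ`, which turns the sign
`(-1)^{i+j}` into `(-1)ʲ`. -/
def differential (L : LieAlgebroid E F A) {k : ℕ} (θ : ∀ x : M, A x [⋀^Fin k]→ₗ[ℝ] ℝ)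
    (s : Fin (k + 1) → Sections E F A) (x : M) : ℝ :=
  (∑ i : Fin (k + 1), (-1 : ℝ) ^ (i : ℕ) *
      dirDeriv (L.anchor x (s i x)) (fun y => θ y (fun l => i.removeNth s l y)))
  + ∑ j : Fin (k + 1), ∑ i ∈ Finset.Iio j, (-1 : ℝ) ^ (j : ℕ) *
      θ x (fun l => j.removeNth (Function.update s i (L.bracket (s i) (s j))) l x)

/-- `η = d_A θ` in `Γ(⋀^{k+1} A*)`. -/
def IsDifferential (L : LieAlgebroid E F A) {k : ℕ}
    (θ : BundleForm E F A k) (η : BundleForm E F A (k + 1)) : Prop :=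
  ∀ (s : Fin (k + 1) → Sections E F A) (x : M),
    η.toFun x (fun i => s i x) = L.differential θ.toFun s x

end LieAlgebroid

/-- The Chevalley–Eilenberg differential of a Lie algebra `𝔥`, that is the Lie algebroid
differential of `𝔥` viewed as a Lie algebroid over a point:
`∑_{i<j} (-1)^{i+j} θ([vᵢ,vⱼ], v₀, …, v̂ᵢ, …, v̂ⱼ, …, v_k)`, with `[vᵢ,vⱼ]` kept in the place
of `vᵢ`. -/
def chevalleyEilenberg {𝔥 : Type*} [LieRing 𝔥] [LieAlgebra ℝ 𝔥] {k : ℕ}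
    (θ : 𝔥 [⋀^Fin k]→ₗ[ℝ] ℝ) (v : Fin (k + 1) → 𝔥) : ℝ :=
  ∑ j : Fin (k + 1), ∑ i ∈ Finset.Iio j, (-1 : ℝ) ^ (j : ℕ) *
    θ (j.removeNth (Function.update v i ⁅v i, v j⁆))

variable {E F A} in
/-- A fibrewise linear map `μ : A → 𝔥` to a finite-dimensional Lie algebra (a Lie algebroid over
a point) is a Lie algebroid morphism: it is smooth, and the pull-back of forms
`μ* : ⋀ 𝔥* → Γ(⋀ A*)` intertwines the Lie algebroid differentials. -/
structure LieAlgebroid.IsMorphismToLieAlgebra [IsManifold 𝓘(ℝ, E) ∞ M]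
    (L : LieAlgebroid E F A) {𝔥 : Type*} [LieRing 𝔥] [LieAlgebra ℝ 𝔥]
    (μ : ∀ x : M, A x →ₗ[ℝ] 𝔥) : Prop where
  smooth : ∀ (ℓ : Module.Dual ℝ 𝔥) (s : Sections E F A),
    ContMDiff 𝓘(ℝ, E) 𝓘(ℝ, ℝ) ∞ (fun x => ℓ (μ x (s x)))
  pullback_differential : ∀ (k : ℕ) (θ : 𝔥 [⋀^Fin k]→ₗ[ℝ] ℝ)
    (s : Fin (k + 1) → Sections E F A) (x : M),
    L.differential (fun y => θ.compLinearMap (μ y)) s x =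
      chevalleyEilenberg θ (fun i => μ x (s i x))

end Algebroid

/-! ### Multivector fields and the Schouten bracket -/

/-- `k`-vector fields: smooth sections of `⋀ᵏ TM`, i.e. `Γ(⋀ᵏ A*)` for `A = T*M`. -/
abbrev MultivectorField (E : Type*) [NormedAddCommGroup E] [NormedSpace ℝ E]
    (M : Type*) [TopologicalSpace M] [ChartedSpace E M] [IsManifold 𝓘(ℝ, E) ∞ M] (k : ℕ) :=
  BundleForm E (E →L[ℝ] ℝ) (CotangentSpace E : M → Type _) k

section Multivector

variable {E : Type*} [NormedAddCommGroup E] [NormedSpace ℝ E]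
  {M : Type*} [TopologicalSpace M] [ChartedSpace E M] [IsManifold 𝓘(ℝ, E) ∞ M]

/-- The function `P(df₁, …, df_k)`. A multivector field is determined by these values, since the
differentials of smooth functions span every cotangent space. -/
def MultivectorField.onFun {k : ℕ} (P : MultivectorField E M k)
    (f : Fin k → M → ℝ) (x : M) : ℝ :=
  P.toFun x (fun i => covectorOf E (f i) x)

/-- A vector field as a multivector field of degree one, `α ↦ α(X)`. -/
def SmoothVectorField.toMultivector (X : SmoothVectorField E M) : MultivectorField E M 1 where
  toFun x := AlternatingMap.ofSubsingleton ℝ (CotangentSpace E x) ℝ (0 : Fin 1)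
    { toFun := fun α => pairing α (X x)
      map_add' := fun _ _ => rfl
      map_smul' := fun _ _ => rfl }
  smooth' s := by
    have h := ContMDiff.clm_bundle_apply (n := ∞) (IM := 𝓘(ℝ, E)) (IB := 𝓘(ℝ, E))
      (F₁ := E) (F₂ := ℝ) (E₁ := (TangentSpace 𝓘(ℝ, E) : M → Type _)) (E₂ := Bundle.Trivial M ℝ)
      (b := fun x => x) (s 0).contMDiff X.contMDiff
    intro x
    exact ((Bundle.contMDiffAt_section (E := Bundle.Trivial M ℝ) _).1 (h x))

/-- The Schouten bracket `[X, P]` of a vector field `X` and a `k`-vector field `P`, evaluated on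
`(df₁, …, df_k)`: `X(P(f₁, …, f_k)) - ∑ᵢ P(f₁, …, X fᵢ, …, f_k)`. -/
def schoutenVector (X : SmoothVectorField E M) {k : ℕ} (P : MultivectorField E M k)
    (f : Fin k → M → ℝ) (x : M) : ℝ :=
  dirDeriv (X x) (P.onFun f)
    - ∑ i, P.onFun (Function.update f i (fun y => dirDeriv (X y) (f i))) x

/-- The Schouten bracket `[π, P]` of a bivector field `π` and a `k`-vector field `P`, evaluated on
`(df₀, …, df_k)`. With `{f,g} = π(df,dg)` it is
`∑ᵢ (-1)ⁱ {fᵢ, P(f₀, …, f̂ᵢ, …, f_k)}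
  + ∑_{i<j} (-1)^{i+j} P({fᵢ,fⱼ}, f₀, …, f̂ᵢ, …, f̂ⱼ, …, f_k)`,
where in the second sum `{fᵢ,fⱼ}` is kept in the place of `fᵢ` (sign `(-1)ʲ`).

Both this formula and `schoutenVector` are the cases `p = 2` and `p = 1` of
`[P,Q] = P∘Q - (-1)^{(p-1)(q-1)} Q∘P`, where `(P∘Q)(f₁, …, f_{p+q-1})` is the signed sum of
`P(f_{σ1}, …, f_{σ(p-1)}, Q(f_{σp}, …, f_{σ(p+q-1)}))` over `(p-1,q)`-shuffles `σ`. This is the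
Schouten bracket with `[X, f] = X f`, `[X, Y]` the Lie bracket,
`[P, Q] = -(-1)^{(p-1)(q-1)} [Q, P]` and
`[P, Q ∧ R] = [P, Q] ∧ R + (-1)^{(p-1)q} Q ∧ [P, R]`. -/
def schoutenBivector (π : MultivectorField E M 2) {k : ℕ} (P : MultivectorField E M k)
    (f : Fin (k + 1) → M → ℝ) (x : M) : ℝ :=
  (∑ i : Fin (k + 1), (-1 : ℝ) ^ (i : ℕ) * π.onFun ![f i, P.onFun (i.removeNth f)] x)
  + ∑ j : Fin (k + 1), ∑ i ∈ Finset.Iio j, (-1 : ℝ) ^ (j : ℕ) *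
      P.onFun (j.removeNth (Function.update f i (π.onFun ![f i, f j]))) x

/-- The exterior product `V ∧ D` of a vector field with a multivector field `D` (given by its
values on differentials of functions), evaluated on `(df₀, …, df_k)`:
`∑ⱼ (-1)ʲ V(fⱼ) D(f₀, …, f̂ⱼ, …, f_k)`, so that `(V ∧ W)(α, β) = α(V)β(W) - α(W)β(V)`. -/
def wedgeVector (V : SmoothVectorField E M) {k : ℕ} (D : (Fin k → M → ℝ) → M → ℝ)
    (f : Fin (k + 1) → M → ℝ) (x : M) : ℝ :=
  ∑ j : Fin (k + 1), (-1 : ℝ) ^ (j : ℕ) * dirDeriv (V x) (f j) * D (j.removeNth f) x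

/-- `γ` is the Lie derivative `L_X α` of the 1-form `α`: `γ(Y) = X(α(Y)) - α([X,Y])` for all
vector fields `Y`. -/
def IsLieDerivative (X : SmoothVectorField E M) (α γ : OneForm E M) : Prop :=
  ∀ (Y : SmoothVectorField E M) (x : M),
    pairing (γ x) (Y x) = dirDeriv (X x) (fun y => pairing (α y) (Y y))
      - pairing (α x) (VectorField.mlieBracket 𝓘(ℝ, E) X Y x)

end Multivector

/-! ### Quadratic Lie algebras and quasi-Poisson manifolds -/

section Quadratic

variable {𝔤 : Type*} [LieRing 𝔤] [LieAlgebra ℝ 𝔤]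

/-- `⟨·,·⟩` is a non-degenerate ad-invariant symmetric bilinear form: `𝔤` is a quadratic Lie
algebra. -/
structure IsQuadratic (B : LinearMap.BilinForm ℝ 𝔤) : Prop where
  symm : ∀ x y, B x y = B y x
  nondegenerate : B.Nondegenerate
  invariant : ∀ x y z, B ⁅x, y⁆ z = B x ⁅y, z⁆

/-- `s♯ : 𝔤* → 𝔤`, the inverse of `ξ ↦ ⟨ξ,·⟩`. -/
def sharp [FiniteDimensional ℝ 𝔤] (B : LinearMap.BilinForm ℝ 𝔤)
    (hB : IsQuadratic B) : Module.Dual ℝ 𝔤 →ₗ[ℝ] 𝔤 :=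
  (B.toDual hB.nondegenerate).symm.toLinearMap

/-- The trivector `φ(α,β,γ) = ½ α([s♯β, s♯γ])` of `𝔤`. -/
def cartanTrivector [FiniteDimensional ℝ 𝔤] (B : LinearMap.BilinForm ℝ 𝔤)
    (hB : IsQuadratic B) (α β γ : Module.Dual ℝ 𝔤) : ℝ :=
  (1 / 2 : ℝ) * α ⁅sharp B hB β, sharp B hB γ⁆

variable {E : Type*} [NormedAddCommGroup E] [NormedSpace ℝ E]
  {M : Type*} [TopologicalSpace M] [ChartedSpace E M] [IsManifold 𝓘(ℝ, E) ∞ M]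

/-- The transpose `T*_x M → 𝔤*` of `ρ_x : 𝔤 → T_x M`. -/
def transposeAt (ρ : 𝔤 →ₗ[ℝ] SmoothVectorField E M) (x : M) :
    CotangentSpace E x →ₗ[ℝ] Module.Dual ℝ 𝔤 where
  toFun α :=
    { toFun := fun ξ => pairing α (ρ ξ x)
      map_add' := fun ξ η => by simp [pairing]
      map_smul' := fun c ξ => by simp [pairing] }
  map_add' _ _ := rfl
  map_smul' _ _ := rfl

/-- `μ_ρ : T*M → 𝔤`, the transpose of `ρ` followed by the identification `𝔤* ≅ 𝔤`. -/
def momentMap [FiniteDimensional ℝ 𝔤] (B : LinearMap.BilinForm ℝ 𝔤)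
    (hB : IsQuadratic B) (ρ : 𝔤 →ₗ[ℝ] SmoothVectorField E M) (x : M) :
    CotangentSpace E x →ₗ[ℝ] 𝔤 :=
  sharp B hB ∘ₗ transposeAt ρ x

/-- `(M, ρ, π)` is a quasi-Poisson `𝔤`-manifold: `ρ` is an action of `𝔤` on `M` by vector fields,
`π` is a `𝔤`-invariant bivector field, `[π,π] = ρ(φ)` and `[π,ρ(ξ)] = 0`. The equations between
multivector fields are evaluated on differentials of smooth functions; `ρ(φ)` is the trivector
field `(α,β,γ) ↦ φ(ρ*α, ρ*β, ρ*γ)`. -/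
structure IsQuasiPoisson [FiniteDimensional ℝ 𝔤] (B : LinearMap.BilinForm ℝ 𝔤)
    (hB : IsQuadratic B) (ρ : 𝔤 →ₗ[ℝ] SmoothVectorField E M) (π : MultivectorField E M 2) :
    Prop where
  action : ∀ (ξ η : 𝔤) (x : M),
    ρ ⁅ξ, η⁆ x = VectorField.mlieBracket 𝓘(ℝ, E) (ρ ξ) (ρ η) x
  invariant : ∀ (ξ : 𝔤) (f : Fin 2 → SmoothFun E M) (x : M),
    schoutenVector (ρ ξ) π (fun i => f i) x = 0
  bracket_self : ∀ (f : Fin 3 → SmoothFun E M) (x : M),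
    schoutenBivector π π (fun i => f i) x =
      cartanTrivector B hB (transposeAt ρ x (covectorOf E (f 0) x))
        (transposeAt ρ x (covectorOf E (f 1) x)) (transposeAt ρ x (covectorOf E (f 2) x))
  bracket_action : ∀ (ξ : 𝔤) (f : Fin 2 → SmoothFun E M) (x : M),
    schoutenBivector π (SmoothVectorField.toMultivector (ρ ξ)) (fun i => f i) x = 0

/-- `R = [π, P] + ½ ∑ᵢ ρ(eⁱ) ∧ [ρ(eᵢ), P]` as `(k+1)`-vector fields; `e` and `e'` stand for the
families `eᵢ` and `eⁱ`. -/
def IsQuasiPoissonDifferential {ι : Type*} [Fintype ι] (e e' : ι → 𝔤)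
    (ρ : 𝔤 →ₗ[ℝ] SmoothVectorField E M) (π : MultivectorField E M 2) {k : ℕ}
    (P : MultivectorField E M k) (R : MultivectorField E M (k + 1)) : Prop :=
  ∀ (f : Fin (k + 1) → SmoothFun E M) (x : M),
    R.onFun (fun i => f i) x = schoutenBivector π P (fun i => f i) x
      + (1 / 2 : ℝ) * ∑ i, wedgeVector (ρ (e' i)) (schoutenVector (ρ (e i)) P) (fun l => f l) x

/-- `T*M` with the Lie algebroid structure `L` has the differential
`d = [π, ·] + ½ ∑ᵢ ρ(eⁱ) ∧ [ρ(eᵢ), ·]` on multivector fields of all degrees. -/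
def HasQuasiPoissonDifferential {ι : Type*} [Fintype ι] (e e' : ι → 𝔤)
    (ρ : 𝔤 →ₗ[ℝ] SmoothVectorField E M) (π : MultivectorField E M 2)
    (L : LieAlgebroid E (E →L[ℝ] ℝ) (CotangentSpace E : M → Type _)) : Prop :=
  ∀ (k : ℕ) (P : MultivectorField E M k), ∃ R : MultivectorField E M (k + 1),
    IsQuasiPoissonDifferential e e' ρ π P R ∧ L.IsDifferential P R

/-- The induced action of `𝔤` on `T*M` (by Lie derivatives `L_{ρ(ξ)}` of 1-forms) preserves the
Lie algebroid structure `L`: it acts by derivations of the bracket and the anchor is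
equivariant. -/
def ActionPreserves (ρ : 𝔤 →ₗ[ℝ] SmoothVectorField E M)
    (L : LieAlgebroid E (E →L[ℝ] ℝ) (CotangentSpace E : M → Type _)) : Prop :=
  ∀ ξ : 𝔤, ∃ Λ : OneForm E M →ₗ[ℝ] OneForm E M,
    (∀ α, IsLieDerivative (ρ ξ) α (Λ α)) ∧
    (∀ α β, Λ (L.bracket α β) = L.bracket (Λ α) β + L.bracket α (Λ β)) ∧
    (∀ α x, L.anchor x (Λ α x) =
      VectorField.mlieBracket 𝓘(ℝ, E) (ρ ξ) (fun y => L.anchor y (α y)) x)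

end Quadratic

end

noncomputable section

set_option linter.unusedSectionVars false

/-! ### Invariant symmetric tensors of a Lie algebra -/

section InvariantTensor

open scoped TensorProduct

/-! In degree zero the prescribed differential forces the anchor `a(α) = π♯α + ½ ∑ α(ρ(eⁱ)) ρ(eᵢ)`.
In degree one, evaluated on exact forms, it forces the bracket, which for general forms reads `[α,
β] = L_{aα} β - i_{aβ} dα - ∑ d(α(ρ eᵢ)) β(ρ eⁱ)` (`formBracket`). This gives uniqueness at once;
existence means that this pair is a Lie algebroid with the right differential in every degree.

Two properties of the anchor carry the argument. It is isotropic: `π♯` is skew, so the symmetric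
part of `a` is half the image under `ρ` of the Casimir tensor `∑ eᵢ ⊗ eⁱ`. It is equivariant,
because `π` and the Casimir tensor are invariant. Isotropy makes the bracket skew. Together the two
properties compute the pairing of `[α, β]` with the fields `ρ(ξ)` (`formBracket_comoment`): up to
derivative terms, the bracket there is the bracket of `𝔤`.

Compatibility of `a` with brackets is proved before the Jacobi identity. Its defect is
function-linear in both forms, hence can be tested on exact forms (`anchor_formBracket`). There
`a(df)` splits into a Hamiltonian part `X_f` and half of the Casimir field `Y_f`. The quasi-Poisson
axiom says that the Jacobiator of the `X`-part is a quarter of the Cartan trivector, and the `Y`-`Y`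
terms cancel precisely this multiple (`anchor_formBracket_exactForm`). Jacobi for forms then follows
from Cartan calculus: the remaining terms are Cartan sums that cancel by total antisymmetry
(`formBracket_jacobi`).

The algebroid differential is tensorial, so it produces multivector fields, which may be compared on
exact forms. There `[df, dg]` differs from `d{f, g}` by an antisymmetrized term, and summing over
pairs of arguments turns this term into `½ ∑ ρ(eⁱ) ∧ [ρ(eᵢ), ·]`
(`bracketDifferential_differential`). The same summation over pairs, applied to
`formBracket_comoment`, shows that `μ_ρ` is a morphism.

The algebra takes place over an abstract Lie–Rinehart algebra. The geometric input is that smooth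
1-forms and vector fields are dual modules over the smooth functions, and that differentials of
functions fill every cotangent space. -/

/-- The tensor `∑ eᵢ ⊗ eᵢ'` of a Lie algebra is symmetric and ad-invariant. -/
structure IsInvariantSymmetric {𝔤 ι : Type*} [Fintype ι] [LieRing 𝔤] [LieAlgebra ℝ 𝔤]
    (e e' : ι → 𝔤) : Prop where
  symm : ∑ i, e i ⊗ₜ[ℝ] e' i = ∑ i, e' i ⊗ₜ[ℝ] e i
  invariant : ∀ ξ : 𝔤, ∑ i, (⁅ξ, e i⁆ ⊗ₜ[ℝ] e' i + e i ⊗ₜ[ℝ] ⁅ξ, e' i⁆) = 0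

namespace IsInvariantSymmetric

variable {𝔤 ι A : Type*} [Fintype ι] [LieRing 𝔤] [LieAlgebra ℝ 𝔤] [CommRing A] [Algebra ℝ A]
  {e e' : ι → 𝔤}

/-- Stating symmetry and invariance in `𝔤 ⊗ 𝔤` lets any two linear maps into an algebra be
substituted: apply `p ⊗ q`, then multiply. -/
lemma sum_mul_swap (h : IsInvariantSymmetric e e') (p q : 𝔤 →ₗ[ℝ] A) :
    ∑ i, p (e i) * q (e' i) = ∑ i, p (e' i) * q (e i) := by
  simpa using congrArg (LinearMap.mul' ℝ A ∘ₗ TensorProduct.map p q) h.symm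

lemma sum_mul_comm (h : IsInvariantSymmetric e e') (p q : 𝔤 →ₗ[ℝ] A) :
    ∑ i, p (e i) * q (e' i) = ∑ i, q (e i) * p (e' i) := by
  rw [h.sum_mul_swap]
  exact Finset.sum_congr rfl fun i _ => mul_comm _ _

lemma sum_lie_mul (h : IsInvariantSymmetric e e') (p q : 𝔤 →ₗ[ℝ] A) (ξ : 𝔤) :
    ∑ i, p ⁅ξ, e i⁆ * q (e' i) + ∑ i, p (e i) * q ⁅ξ, e' i⁆ = 0 := by
  simpa [Finset.sum_add_distrib] using
    congrArg (LinearMap.mul' ℝ A ∘ₗ TensorProduct.map p q) (h.invariant ξ)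

end IsInvariantSymmetric

variable {𝔤 ι A : Type*} [Fintype ι] [LieRing 𝔤] [LieAlgebra ℝ 𝔤] [CommRing A] [Algebra ℝ A]

/-- The trilinear form `∑ p [eⱼ, eᵢ] q(eⱼ') r(eᵢ')`. -/
def cartanSum (e e' : ι → 𝔤) (p q r : 𝔤 →ₗ[ℝ] A) : A :=
  ∑ i, ∑ j, p ⁅e j, e i⁆ * q (e' j) * r (e' i)

variable {e e' : ι → 𝔤}

/-- Invariance moves `ad eᵢ` from the argument of `p` to that of `q`, and symmetry exchanges the two
dual families in the inner sum. -/
lemma cartanSum_eq (h : IsInvariantSymmetric e e') (p q r : 𝔤 →ₗ[ℝ] A) :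
    cartanSum e e' p q r = ∑ i, ∑ j, p (e' j) * q ⁅e i, e j⁆ * r (e' i) := by
  refine Finset.sum_congr rfl fun i _ => ?_
  rw [← Finset.sum_mul, ← Finset.sum_mul]
  congr 1
  have h1 := h.sum_lie_mul p q (e i)
  have h2 := h.sum_mul_swap p (q ∘ₗ (LieModule.toEnd ℝ 𝔤 𝔤 (e i)))
  simp only [LinearMap.comp_apply, LieModule.toEnd_apply_apply] at h2
  have h3 : ∑ j, p ⁅e j, e i⁆ * q (e' j) = - ∑ j, p ⁅e i, e j⁆ * q (e' j) := by
    rw [← Finset.sum_neg_distrib]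
    refine Finset.sum_congr rfl fun j _ => ?_
    rw [← lie_skew, map_neg, neg_mul]
  rw [h3, ← h2]
  linear_combination -h1

/-- With `cartanSum_rotate`, this makes the Cartan form totally antisymmetric, as needed for all
later cancellations. -/
lemma cartanSum_swap (h : IsInvariantSymmetric e e') (p q r : 𝔤 →ₗ[ℝ] A) :
    cartanSum e e' q p r = - cartanSum e e' p q r := by
  rw [cartanSum_eq h p q r, cartanSum, ← Finset.sum_neg_distrib]
  refine Finset.sum_congr rfl fun i _ => ?_
  rw [← Finset.sum_neg_distrib]
  refine Finset.sum_congr rfl fun j _ => ?_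
  rw [← lie_skew, map_neg]
  ring

lemma cartanSum_rotate (h : IsInvariantSymmetric e e') (p q r : 𝔤 →ₗ[ℝ] A) :
    cartanSum e e' p q r = cartanSum e e' q r p := by
  rw [cartanSum_eq h p q r, cartanSum, Finset.sum_comm]
  refine Finset.sum_congr rfl fun i _ => Finset.sum_congr rfl fun j _ => ?_
  ring

end InvariantTensor

/-! ### Forms on a Lie–Rinehart algebra -/

section LieRinehart

open Module

variable {A L : Type*} [CommRing A] [Algebra ℝ A] [LieRing L] [LieAlgebra ℝ L] [Module A L]
  [LieRingModule L A] [LieRinehartRing A L] [LieRinehartAlgebra ℝ A L]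

/-- The exact form `df`. -/
def exactForm (L : Type*) [LieRing L] [Module A L] [LieRingModule L A] [LieRinehartRing A L]
    (f : A) : Dual A L where
  toFun X := ⁅X, f⁆
  map_add' X Y := add_lie X Y f
  map_smul' g X := by simp

@[simp] lemma exactForm_apply (f : A) (X : L) : exactForm L f X = ⁅X, f⁆ := rfl

lemma LieRinehartAlgebra.smul_lie_left (f : A) (X Y : L) :
    ⁅f • X, Y⁆ = f • ⁅X, Y⁆ - ⁅Y, f⁆ • X := by
  rw [← lie_skew, LieRinehartRing.leibniz_smul_right, ← lie_skew X Y]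
  module

/-- The Lie derivative `L_X α` of a form `α` along `X`. -/
def lieDerivForm (X : L) : Dual A L →ₗ[ℝ] Dual A L where
  toFun α :=
    { toFun := fun Y => ⁅X, α Y⁆ - α ⁅X, Y⁆
      map_add' := fun Y Z => by simp only [map_add, lie_add]; ring
      map_smul' := fun f Y => by simp; ring }
  map_add' α β := by ext Y; simp; ring
  map_smul' c α := by ext Y; simp [smul_sub]

@[simp] lemma lieDerivForm_apply (X : L) (α : Dual A L) (Y : L) :
    lieDerivForm X α Y = ⁅X, α Y⁆ - α ⁅X, Y⁆ := rfl

lemma lieDerivForm_exactForm (X : L) (f : A) :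
    lieDerivForm X (exactForm L f) = exactForm L ⁅X, f⁆ := by
  ext Y; simp

variable {𝔤 ι : Type*} [Fintype ι] [LieRing 𝔤] [LieAlgebra ℝ 𝔤]

/-- `ξ ↦ α(ρ ξ)`. -/
def comoment (ρ : 𝔤 →ₗ⁅ℝ⁆ L) (α : Dual A L) : 𝔤 →ₗ[ℝ] A :=
  haveI : IsScalarTower ℝ A L := LieRinehartAlgebra.toIsScalarTower
  α.restrictScalars ℝ ∘ₗ ρ.toLinearMap

@[simp] lemma comoment_apply (ρ : 𝔤 →ₗ⁅ℝ⁆ L) (α : Dual A L) (ξ : 𝔤) :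
    comoment ρ α ξ = α (ρ ξ) := rfl

/-- The bracket of forms determined by an anchor `a` and an action `ρ`:
`[α, β] = L_{aα} β - i_{aβ} dα - ∑ d(α(ρ eᵢ)) β(ρ eᵢ')`. -/
def formBracket (a : Dual A L →ₗ[A] L) (ρ : 𝔤 → L) (e e' : ι → 𝔤) (α β : Dual A L) :
    Dual A L where
  toFun X := ⁅a α, β X⁆ - β ⁅a α, X⁆ - ⁅a β, α X⁆ + ⁅X, α (a β)⁆ + α ⁅a β, X⁆
    - ∑ i, ⁅X, α (ρ (e i))⁆ * β (ρ (e' i))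
  map_add' X Y := by
    simp only [map_add, lie_add, add_lie, add_mul, Finset.sum_add_distrib]; ring
  map_smul' f X := by
    simp only [map_add, map_smul, smul_eq_mul, LieRinehartRing.lie_smul_eq_mul,
      LieRinehartRing.leibniz_mul_right, LieRinehartRing.leibniz_smul_right, RingHom.id_apply,
      mul_assoc, ← Finset.mul_sum]
    ring

variable {a : Dual A L →ₗ[A] L} {ρ : 𝔤 →ₗ⁅ℝ⁆ L} {e e' : ι → 𝔤}

lemma formBracket_apply (ρ : 𝔤 → L) (α β : Dual A L) (X : L) :
    formBracket a ρ e e' α β X = ⁅a α, β X⁆ - β ⁅a α, X⁆ - ⁅a β, α X⁆ + ⁅X, α (a β)⁆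
      + α ⁅a β, X⁆ - ∑ i, ⁅X, α (ρ (e i))⁆ * β (ρ (e' i)) := rfl

lemma formBracket_add_left (α α' β : Dual A L) :
    formBracket a ρ e e' (α + α') β = formBracket a ρ e e' α β + formBracket a ρ e e' α' β := by
  ext X
  simp only [formBracket_apply, LinearMap.add_apply, map_add, lie_add, add_lie, add_mul,
    Finset.sum_add_distrib]
  ring

lemma formBracket_add_right (α β β' : Dual A L) :
    formBracket a ρ e e' α (β + β') = formBracket a ρ e e' α β + formBracket a ρ e e' α β' := by
  ext X
  simp only [formBracket_apply, LinearMap.add_apply, map_add, lie_add, add_lie, mul_add,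
    Finset.sum_add_distrib]
  ring

/-- The correction sum is function-linear in `β`, so the only derivative of `f` is the one along `a
α`. -/
lemma formBracket_smul_right (α β : Dual A L) (f : A) :
    formBracket a ρ e e' α (f • β) = f • formBracket a ρ e e' α β + ⁅a α, f⁆ • β := by
  ext X
  have h : ∑ i, ⁅X, α (ρ (e i))⁆ * (f * β (ρ (e' i)))
      = f * ∑ i, ⁅X, α (ρ (e i))⁆ * β (ρ (e' i)) := by
    rw [Finset.mul_sum]; exact Finset.sum_congr rfl fun i _ => by ring
  simp only [formBracket_apply, LinearMap.add_apply, LinearMap.smul_apply, map_smul,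
    LieRinehartAlgebra.smul_lie_left, LieRinehartRing.lie_smul_eq_mul, smul_eq_mul, map_sub,
    LieRinehartRing.leibniz_mul_right, h]
  ring

/-- The anchor `a` is isotropic for the split pairing: `α(aβ) + β(aα) = ∑ α(ρ eᵢ) β(ρ eᵢ')`. -/
def IsIsotropic (a : Dual A L →ₗ[A] L) (ρ : 𝔤 → L) (e e' : ι → 𝔤) : Prop :=
  ∀ α β : Dual A L, α (a β) + β (a α) = ∑ i, α (ρ (e i)) * β (ρ (e' i))

/-- The anchor `a` is equivariant for the action `ρ`. -/
def IsEquivariant (a : Dual A L →ₗ[A] L) (ρ : 𝔤 → L) : Prop :=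
  ∀ (ξ : 𝔤) (α : Dual A L), a (lieDerivForm (ρ ξ) α) = ⁅ρ ξ, a α⁆

lemma lie_sum' {κ : Type*} (s : Finset κ) (X : L) (f : κ → A) :
    ⁅X, ∑ i ∈ s, f i⁆ = ∑ i ∈ s, ⁅X, f i⁆ :=
  map_sum (LieModule.toEnd ℝ L A X) f s

lemma sum_lie_mul_comm (hC : IsInvariantSymmetric e e') (X : L) (α β : Dual A L) :
    ∑ i, ⁅X, α (ρ (e i))⁆ * β (ρ (e' i)) = ∑ i, β (ρ (e i)) * ⁅X, α (ρ (e' i))⁆ :=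
  hC.sum_mul_comm (LieModule.toEnd ℝ L A X ∘ₗ comoment ρ α) (comoment ρ β)

/-- All that survives of `[α, α]` is `d(α(aα))` minus the correction sum. Isotropy gives `α(aα) = ½
∑ α(ρ eᵢ) α(ρ eᵢ')`, whose differential is that same sum, by symmetry of the tensor. -/
lemma formBracket_self (hC : IsInvariantSymmetric e e') (ha : IsIsotropic a ρ e e')
    (α : Dual A L) : formBracket a ρ e e' α α = 0 := by
  ext X
  have h1 := congrArg (fun f : A => (1 / 2 : ℝ) • ⁅X, f⁆) (ha α α)
  have h2 := sum_lie_mul_comm (ρ := ρ) hC X α α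
  simp only [lie_add, lie_sum', LieRinehartRing.leibniz_mul_right, Finset.sum_add_distrib,
    smul_eq_mul, ← h2] at h1
  simp only [formBracket_apply, LinearMap.zero_apply]
  linear_combination (norm := module) h1

lemma IsEquivariant.lie_pairing (he : IsEquivariant a ρ) (ξ : 𝔤) (α β : Dual A L) :
    ⁅ρ ξ, α (a β)⁆ = lieDerivForm (ρ ξ) α (a β) + α (a (lieDerivForm (ρ ξ) β)) := by
  rw [he ξ β, lieDerivForm_apply]; ring

/-- The transpose of the action intertwines the bracket of forms with the bracket of `𝔤`. -/
lemma formBracket_comoment (ha : IsIsotropic a ρ e e')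
    (he : IsEquivariant a ρ) (α β : Dual A L) (ξ : 𝔤) :
    formBracket a ρ e e' α β (ρ ξ) = ⁅a α, β (ρ ξ)⁆ - ⁅a β, α (ρ ξ)⁆
      + ∑ j, α (ρ ⁅e j, ξ⁆) * β (ρ (e' j)) := by
  have h1 := ha (lieDerivForm (ρ ξ) α) β
  have h2 := he.lie_pairing ξ α β
  rw [he ξ α] at h1
  -- Expanding the Lie derivative in the isotropy relation reproduces the correction sum of the
  -- bracket, plus the structural term that remains in the result.
  have h3 : ∑ i, lieDerivForm (ρ ξ) α (ρ (e i)) * β (ρ (e' i))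
      = ∑ i, ⁅ρ ξ, α (ρ (e i))⁆ * β (ρ (e' i)) + ∑ j, α (ρ ⁅e j, ξ⁆) * β (ρ (e' j)) := by
    rw [← Finset.sum_add_distrib]
    refine Finset.sum_congr rfl fun i _ => ?_
    rw [lieDerivForm_apply, ← LieHom.map_lie, ← lie_skew ξ (e i), map_neg, map_neg]
    ring
  rw [h3] at h1
  rw [he ξ β] at h2
  rw [formBracket_apply, ← lie_skew (a α) (ρ ξ), ← lie_skew (a β) (ρ ξ), map_neg, map_neg]
  linear_combination h2 + h1

/-- Lie derivatives along the action are derivations of the bracket of forms. -/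
lemma lieDerivForm_formBracket (hC : IsInvariantSymmetric e e') (he : IsEquivariant a ρ)
    (ξ : 𝔤) (α β : Dual A L) :
    lieDerivForm (ρ ξ) (formBracket a ρ e e' α β)
      = formBracket a ρ e e' (lieDerivForm (ρ ξ) α) β
        + formBracket a ρ e e' α (lieDerivForm (ρ ξ) β) := by
  ext X
  have h := hC.sum_lie_mul (LieModule.toEnd ℝ L A X ∘ₗ comoment ρ α) (comoment ρ β) ξ
  simp only [LinearMap.comp_apply, LieModule.toEnd_apply_apply, comoment_apply,
    LieHom.map_lie] at h
  simp only [lieDerivForm_apply, formBracket_apply, LinearMap.add_apply, he ξ, lie_sub, lie_add,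
    map_sub, lie_lie, lie_sum', LieRinehartRing.leibniz_mul_right, smul_eq_mul,
    sub_mul, mul_sub, Finset.sum_add_distrib, Finset.sum_sub_distrib]
  linear_combination -h

/-- These are the Cartan sums left in the Jacobi identity, where `p'` and `q'` are derivatives of
`p` and `q`. They cancel in pairs by total antisymmetry. -/
lemma cartanSum_cyclic (hC : IsInvariantSymmetric e e') (p q r p' q' : 𝔤 →ₗ[ℝ] A) :
    cartanSum e e' p' q r + cartanSum e e' p q' r - cartanSum e e' q r p'
      + cartanSum e e' p r q' = 0 := by
  rw [cartanSum_rotate hC p' q r, cartanSum_swap hC q' p r, cartanSum_rotate hC q' p r]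
  ring

/-- The Jacobi identity for forms follows from the compatibility of the bracket with the anchor
and with the action. -/
lemma formBracket_jacobi (hC : IsInvariantSymmetric e e') (ha : IsIsotropic a ρ e e')
    (he : IsEquivariant a ρ)
    (hanchor : ∀ α β : Dual A L, a (formBracket a ρ e e' α β) = ⁅a α, a β⁆)
    (α β γ : Dual A L) :
    formBracket a ρ e e' α (formBracket a ρ e e' β γ)
      = formBracket a ρ e e' (formBracket a ρ e e' α β) γ
        + formBracket a ρ e e' β (formBracket a ρ e e' α γ) := by
  ext X
  let D : Dual A L → 𝔤 →ₗ[ℝ] A := fun α => LieModule.toEnd ℝ L A X ∘ₗ comoment ρ α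
  have hc := cartanSum_cyclic hC (comoment ρ α) (comoment ρ β) (comoment ρ γ) (D α) (D β)
  have h1 := hC.sum_mul_comm (LieModule.toEnd ℝ L A (a γ) ∘ₗ comoment ρ α) (D β)
  simp only [D, LinearMap.comp_apply, LieModule.toEnd_apply_apply, comoment_apply] at h1
  have h2 : ∑ i, ⁅X, α (ρ (e i))⁆ * (∑ j, β (ρ ⁅e j, e' i⁆) * γ (ρ (e' j)))
    = cartanSum e e' (comoment ρ β) (comoment ρ γ) (D α) := by
    -- Exchanging `eᵢ` and `eᵢ'` places `eᵢ` inside the Lie bracket, as in the definition of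
    -- `cartanSum`.
    have h := hC.sum_mul_swap (D α) (∑ j, (comoment ρ γ (e' j)) •
      (comoment ρ β ∘ₗ LieModule.toEnd ℝ 𝔤 𝔤 (e j)))
    simp only [LinearMap.sum_apply, LinearMap.smul_apply, LinearMap.comp_apply,
      LieModule.toEnd_apply_apply, comoment_apply, smul_eq_mul] at h
    simp only [mul_comm (γ _)] at h
    refine h.trans ?_
    rw [cartanSum]
    refine Finset.sum_congr rfl fun i _ => ?_
    simp only [Finset.mul_sum, LinearMap.comp_apply, LieModule.toEnd_apply_apply,
      comoment_apply, D]
    exact Finset.sum_congr rfl fun j _ => by ring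
  have h3 : ∑ i, ⁅X, β (ρ (e i))⁆ * (∑ j, α (ρ ⁅e j, e' i⁆) * γ (ρ (e' j)))
    = cartanSum e e' (comoment ρ α) (comoment ρ γ) (D β) := by
    have h := hC.sum_mul_swap (D β) (∑ j, (comoment ρ γ (e' j)) •
      (comoment ρ α ∘ₗ LieModule.toEnd ℝ 𝔤 𝔤 (e j)))
    simp only [LinearMap.sum_apply, LinearMap.smul_apply, LinearMap.comp_apply,
      LieModule.toEnd_apply_apply, comoment_apply, smul_eq_mul] at h
    simp only [mul_comm (γ _)] at h
    refine h.trans ?_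
    rw [cartanSum]
    refine Finset.sum_congr rfl fun i _ => ?_
    simp only [Finset.mul_sum, LinearMap.comp_apply, LieModule.toEnd_apply_apply,
      comoment_apply, D]
    exact Finset.sum_congr rfl fun j _ => by ring
  have h4 : ∑ i, ⁅X, ∑ j, α (ρ ⁅e j, e i⁆) * β (ρ (e' j))⁆ * γ (ρ (e' i))
    = cartanSum e e' (D α) (comoment ρ β) (comoment ρ γ)
      + cartanSum e e' (comoment ρ α) (D β) (comoment ρ γ) := by
    simp only [cartanSum, ← Finset.sum_add_distrib, lie_sum', Finset.sum_mul]
    refine Finset.sum_congr rfl fun i _ => Finset.sum_congr rfl fun j _ => ?_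
    simp [D]
    ring
  rw [LinearMap.add_apply, formBracket_apply, formBracket_apply _ (formBracket _ _ _ _ _ _),
    formBracket_apply _ β (formBracket _ _ _ _ _ _)]
  -- These two rules eliminate every inner bracket that is fed to the anchor or evaluated on the
  -- action; the other inner brackets are simply expanded. What Cartan calculus does not cancel is
  -- `hc` together with `h1`, a product of two derivatives.
  simp only [formBracket_comoment ha he, hanchor]
  simp only [mul_add, lie_add, add_mul, Finset.sum_add_distrib, h2, h3, h4]
  simp only [formBracket_apply, lie_sub, lie_add,
    map_sub, lie_lie, lie_sum', LieRinehartRing.leibniz_mul_right, smul_eq_mul,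
    sub_mul, mul_sub, Finset.sum_add_distrib, Finset.sum_sub_distrib]
  linear_combination hc + h1

/-! ### Exact forms: Hamiltonian and Casimir parts of the anchor -/

lemma formBracket_exactForm (f g : A) :
    formBracket a ρ e e' (exactForm L f) (exactForm L g) = exactForm L ⁅a (exactForm L f), g⁆
      - ∑ i, ⁅ρ (e' i), g⁆ • exactForm L ⁅ρ (e i), f⁆ := by
  ext X
  simp only [formBracket_apply, exactForm_apply, lie_lie, LinearMap.sub_apply,
    LinearMap.sum_apply, LinearMap.smul_apply, smul_eq_mul, mul_comm ⁅ρ (e' _), g⁆]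
  ring

/-- The element `∑ (ρ(eᵢ) f) ρ(eᵢ')`. -/
def casimirField (ρ : 𝔤 → L) (e e' : ι → 𝔤) (f : A) : L := ∑ i, ⁅ρ (e i), f⁆ • ρ (e' i)

lemma sum_lie_left {κ : Type*} (s : Finset κ) (X : κ → L) (f : A) :
    ⁅∑ i ∈ s, X i, f⁆ = ∑ i ∈ s, ⁅X i, f⁆ :=
  map_sum (exactForm L f) X s

lemma casimirField_lie (f g : A) :
    ⁅casimirField ρ e e' f, g⁆ = ∑ i, ⁅ρ (e i), f⁆ * ⁅ρ (e' i), g⁆ := by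
  simp [casimirField, sum_lie_left]

lemma casimirField_lie_comm (hC : IsInvariantSymmetric e e') (f g : A) :
    ⁅casimirField ρ e e' f, g⁆ = ⁅casimirField ρ e e' g, f⁆ := by
  rw [casimirField_lie, casimirField_lie]
  exact hC.sum_mul_comm (comoment ρ (exactForm L f)) (comoment ρ (exactForm L g))

/-- `a(df) = X_f + ½ ∑ (ρ(eᵢ) f) ρ(eᵢ')`, where `X_f` is the skew part. -/
def hamiltonianField (a : Dual A L →ₗ[A] L) (ρ : 𝔤 → L) (e e' : ι → 𝔤) (f : A) : L :=
  a (exactForm L f) - (1 / 2 : ℝ) • casimirField ρ e e' f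

lemma anchor_exactForm (f : A) : a (exactForm L f)
    = hamiltonianField a ρ e e' f + (1 / 2 : ℝ) • casimirField ρ e e' f := by
  rw [hamiltonianField]; abel

lemma hamiltonianField_lie (f g : A) : ⁅hamiltonianField a ρ e e' f, g⁆
    = ⁅a (exactForm L f), g⁆ - (1 / 2 : ℝ) • ⁅casimirField ρ e e' f, g⁆ := by
  rw [hamiltonianField, sub_lie, smul_lie]

/-- Isotropy on `df` and `dg` says that the symmetric part of the anchor is half the Casimir field,
which is what `hamiltonianField` subtracts. -/
lemma hamiltonianField_skew (hC : IsInvariantSymmetric e e') (ha : IsIsotropic a ρ e e')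
    (f g : A) : ⁅hamiltonianField a ρ e e' f, g⁆ = - ⁅hamiltonianField a ρ e e' g, f⁆ := by
  have h := ha (exactForm L g) (exactForm L f)
  simp only [exactForm_apply] at h
  rw [← casimirField_lie] at h
  rw [hamiltonianField_lie, hamiltonianField_lie, casimirField_lie_comm hC f g]
  linear_combination (norm := module) h

/-- `∑ Z(ρ(eᵢ) f) ρ(eᵢ') g`. -/
def casimirContraction (ρ : 𝔤 → L) (e e' : ι → 𝔤) (Z : L) (f g : A) : A :=
  ∑ i, ⁅Z, ⁅ρ (e i), f⁆⁆ * ⁅ρ (e' i), g⁆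

lemma lie_casimirField_lie (hC : IsInvariantSymmetric e e') (Z : L) (f g : A) :
    ⁅Z, ⁅casimirField ρ e e' f, g⁆⁆
      = casimirContraction ρ e e' Z f g + casimirContraction ρ e e' Z g f := by
  have h := hC.sum_mul_comm (LieModule.toEnd ℝ L A Z ∘ₗ comoment ρ (exactForm L g))
    (comoment ρ (exactForm L f))
  simp only [LinearMap.comp_apply, LieModule.toEnd_apply_apply, comoment_apply,
    exactForm_apply] at h
  rw [casimirField_lie, lie_sum', casimirContraction, casimirContraction, h]
  simp only [LieRinehartRing.leibniz_mul_right, smul_eq_mul, Finset.sum_add_distrib]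
  ring

/-- The anchor is equivariant by hypothesis and the Casimir field by invariance of the tensor; hence
so is their difference. -/
lemma lie_hamiltonianField_lie (hC : IsInvariantSymmetric e e') (he : IsEquivariant a ρ)
    (ξ : 𝔤) (f g : A) :
    ⁅ρ ξ, ⁅hamiltonianField a ρ e e' f, g⁆⁆
      = ⁅hamiltonianField a ρ e e' ⁅ρ ξ, f⁆, g⁆ + ⁅hamiltonianField a ρ e e' f, ⁅ρ ξ, g⁆⁆ := by
  have h1 := he ξ (exactForm L f)
  rw [lieDerivForm_exactForm] at h1
  have h2 := hC.sum_lie_mul (comoment ρ (exactForm L f)) (comoment ρ (exactForm L g)) ξ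
  simp only [comoment_apply, exactForm_apply, LieHom.map_lie, lie_lie, sub_mul, mul_sub,
    Finset.sum_sub_distrib] at h2
  have h3 : ⁅ρ ξ, ⁅casimirField ρ e e' f, g⁆⁆
      = ⁅casimirField ρ e e' ⁅ρ ξ, f⁆, g⁆ + ⁅casimirField ρ e e' f, ⁅ρ ξ, g⁆⁆ := by
    simp only [casimirField_lie, lie_sum', LieRinehartRing.leibniz_mul_right, smul_eq_mul,
      Finset.sum_add_distrib]
    linear_combination h2
  have h4 : ⁅⁅ρ ξ, a (exactForm L f)⁆, g⁆
      = ⁅ρ ξ, ⁅a (exactForm L f), g⁆⁆ - ⁅a (exactForm L f), ⁅ρ ξ, g⁆⁆ := lie_lie _ _ _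
  simp only [hamiltonianField_lie, h1, h4, lie_sub, lie_smul, h3]
  module

/-- Both contractions are sums of second derivatives of `g` along the action, multiplied by first
derivatives of `f` and `h`, but with the two action fields applied in opposite order. Their
difference is a commutator, that is, the action of a Lie bracket in `𝔤`. -/
lemma casimirContraction_sub_swap (hC : IsInvariantSymmetric e e') (f g h : A) :
    casimirContraction ρ e e' (casimirField ρ e e' f) g h
      - casimirContraction ρ e e' (casimirField ρ e e' h) g f
      = cartanSum e e' (comoment ρ (exactForm L g)) (comoment ρ (exactForm L f))
        (comoment ρ (exactForm L h)) := by
  have hT : casimirContraction ρ e e' (casimirField ρ e e' h) g f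
      = ∑ i, ∑ j, ⁅ρ (e j), f⁆ * ⁅ρ (e i), ⁅ρ (e' j), g⁆⁆ * ⁅ρ (e' i), h⁆ := by
    have h1 : ∀ u, ⁅casimirField ρ e e' h, u⁆ = ∑ j, ⁅ρ (e' j), h⁆ * ⁅ρ (e j), u⁆ := fun u => by
      rw [casimirField_lie]
      exact hC.sum_mul_swap (comoment ρ (exactForm L h)) (comoment ρ (exactForm L u))
    simp only [casimirContraction, h1, Finset.sum_mul]
    rw [Finset.sum_comm]
    refine Finset.sum_congr rfl fun i _ => ?_
    have h2 := hC.sum_mul_swap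
      (LieModule.toEnd ℝ L A (ρ (e i)) ∘ₗ comoment ρ (exactForm L g)) (comoment ρ (exactForm L f))
    simp only [LinearMap.comp_apply, LieModule.toEnd_apply_apply, comoment_apply,
      exactForm_apply] at h2
    simp only [mul_assoc, ← Finset.mul_sum, h2]
    rw [Finset.mul_sum]
    exact Finset.sum_congr rfl fun j _ => by ring
  rw [hT, casimirContraction, cartanSum, ← Finset.sum_sub_distrib]
  refine Finset.sum_congr rfl fun i _ => ?_
  have h3 := hC.sum_mul_swap (comoment ρ (exactForm L f))
    (comoment ρ (exactForm L g) ∘ₗ LieModule.toEnd ℝ 𝔤 𝔤 (e i))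
  simp only [LinearMap.comp_apply, LieModule.toEnd_apply_apply, comoment_apply,
      exactForm_apply, LieHom.map_lie, lie_lie, mul_sub, Finset.sum_sub_distrib] at h3
  simp only [← Finset.sum_mul, comoment_apply, exactForm_apply, LieHom.map_lie, lie_lie,
    casimirField_lie]
  rw [← sub_mul]
  congr 1
  simp only [sub_mul, Finset.sum_sub_distrib]
  simp only [mul_comm _ ⁅ρ (e' _), f⁆]
  linear_combination -h3

/-- On exact forms, the anchor is compatible with brackets as soon as the Jacobiator of the skew
part of the anchor is a quarter of the Cartan trivector. -/
lemma anchor_formBracket_exactForm (hC : IsInvariantSymmetric e e')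
    (ha : IsIsotropic a ρ e e') (he : IsEquivariant a ρ)
    (hJ : ∀ f g h : A, ⁅hamiltonianField a ρ e e' f, ⁅hamiltonianField a ρ e e' g, h⁆⁆
      + ⁅hamiltonianField a ρ e e' g, ⁅hamiltonianField a ρ e e' h, f⁆⁆
      + ⁅hamiltonianField a ρ e e' h, ⁅hamiltonianField a ρ e e' f, g⁆⁆
      = (1 / 4 : ℝ) • cartanSum e e' (comoment ρ (exactForm L f)) (comoment ρ (exactForm L g))
        (comoment ρ (exactForm L h))) (f g h : A) :
    ⁅a (formBracket a ρ e e' (exactForm L f) (exactForm L g)), h⁆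
      = ⁅⁅a (exactForm L f), a (exactForm L g)⁆, h⁆ := by
  set X := hamiltonianField a ρ e e' with hX
  set Y := casimirField ρ e e' (A := A) with hY
  set T := casimirContraction ρ e e' (A := A) with hT
  have hA : ∀ f, a (exactForm L f) = X f + (1 / 2 : ℝ) • Y f := fun f => anchor_exactForm f
  have hXs : ∀ f g, ⁅X f, g⁆ = - ⁅X g, f⁆ := hamiltonianField_skew hC ha
  have hYs : ∀ f g, ⁅Y f, g⁆ = ⁅Y g, f⁆ := casimirField_lie_comm hC
  -- Invariance of the Hamiltonian bracket differentiates `X_f g` along the action one factor at a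
  -- time; skewness makes both terms contractions along a Hamiltonian field.
  have hYX : ∀ f g h, ⁅Y ⁅X f, g⁆, h⁆ = T (X f) g h - T (X g) f h := fun f g h => by
    simp only [hT, hY, hX, casimirContraction, casimirField_lie, ← Finset.sum_sub_distrib]
    refine Finset.sum_congr rfl fun i _ => ?_
    rw [lie_hamiltonianField_lie hC he, hamiltonianField_skew hC ha _ g]
    ring
  have h1 : ∑ i, ⁅ρ (e' i), g⁆ * ⁅X ⁅ρ (e i), f⁆, h⁆ = - T (X h) f g := by
    rw [hT, casimirContraction, ← Finset.sum_neg_distrib]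
    refine Finset.sum_congr rfl fun i _ => ?_
    rw [hXs]
    ring
  have h2 : ∑ i, ⁅ρ (e' i), g⁆ * ⁅Y ⁅ρ (e i), f⁆, h⁆ = T (Y h) f g := by
    rw [hT, casimirContraction]
    refine Finset.sum_congr rfl fun i _ => ?_
    rw [hYs, mul_comm]
  have hlhs : ⁅a (formBracket a ρ e e' (exactForm L f) (exactForm L g)), h⁆
      = - ⁅X h, ⁅X f, g⁆⁆ - (1 / 2 : ℝ) • ⁅X h, ⁅Y f, g⁆⁆ + (1 / 2 : ℝ) • ⁅Y ⁅X f, g⁆, h⁆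
        + (1 / 4 : ℝ) • ⁅Y h, ⁅Y f, g⁆⁆ + T (X h) f g - (1 / 2 : ℝ) • T (Y h) f g := by
    rw [formBracket_exactForm, map_sub, map_sum, sub_lie, sum_lie_left]
    simp only [map_smul, LieRinehartRing.lie_smul_eq_mul, hA]
    simp only [add_lie, smul_lie, mul_add, mul_smul_comm, Finset.sum_add_distrib,
      ← Finset.smul_sum, h1, h2]
    rw [hXs _ h, hYs _ h, hYs ⁅X f, g⁆ h]
    simp only [lie_add, lie_smul]
    module
  have hrhs : ∀ f g, ⁅a (exactForm L f), ⁅a (exactForm L g), h⁆⁆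
      = ⁅X f, ⁅X g, h⁆⁆ + (1 / 2 : ℝ) • ⁅X f, ⁅Y g, h⁆⁆ + (1 / 2 : ℝ) • ⁅Y ⁅X g, h⁆, f⁆
        + (1 / 4 : ℝ) • ⁅Y f, ⁅Y g, h⁆⁆ := fun f g => by
    simp only [hA, add_lie, smul_lie, lie_add, lie_smul]
    rw [hYs ⁅X g, h⁆]
    module
  have hTY : ∀ f g h, T (Y f) g h - T (Y h) g f = _ := casimirContraction_sub_swap hC
  rw [lie_lie, hrhs, hrhs, hlhs]
  have hZ : ∀ Z f g, ⁅Z, ⁅Y f, g⁆⁆ = T Z f g + T Z g f := lie_casimirField_lie hC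
  simp only [hYX, hZ]
  have e1 := hJ f g h
  have e2 := hTY f g h
  have e3 := hTY f h g
  have e4 := hTY g f h
  rw [cartanSum_swap hC] at e2
  rw [cartanSum_rotate hC] at e3
  have e5 : ⁅X g, ⁅X h, f⁆⁆ = - ⁅X g, ⁅X f, h⁆⁆ := by rw [hXs h, lie_neg]
  -- Contractions along `X`-fields cancel among themselves. The three differences of contractions
  -- along `Y`-fields are Cartan sums whose signed quarters offset the Jacobiator; this fixes its
  -- coefficient at `1/4`.
  linear_combination (norm := module) -e1 + e5 - (1 / 4 : ℝ) • e2 - (1 / 4 : ℝ) • e3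
    + (1 / 4 : ℝ) • e4

end LieRinehart

/-! ### Anchors determined on exact forms -/

section ExactReduction

open Module

variable {A L : Type*} [CommRing A] [Algebra ℝ A] [LieRing L] [LieAlgebra ℝ L] [Module A L]
  [LieRingModule L A] [LieRinehartRing A L] [LieRinehartAlgebra ℝ A L]
  {𝔤 ι : Type*} [Fintype ι] [LieRing 𝔤] [LieAlgebra ℝ 𝔤]
  {a : Dual A L →ₗ[A] L} {ρ : 𝔤 →ₗ⁅ℝ⁆ L} {e e' : ι → 𝔤}

/-- Linear functionals on forms are determined by exact forms, and elements of `L` by their action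
on functions. -/
structure HasEnoughFunctions (A L : Type*) [CommRing A] [LieRing L] [Module A L]
    [LieRingModule L A] [LieRinehartRing A L] : Prop where
  dual : ∀ T : Dual A L →ₗ[A] A, (∀ f, T (exactForm L f) = 0) → T = 0
  faithful : ∀ X : L, (∀ f : A, ⁅X, f⁆ = 0) → X = 0

lemma HasEnoughFunctions.ext (h : HasEnoughFunctions A L) {X Y : L}
    (hXY : ∀ f : A, ⁅X, f⁆ = ⁅Y, f⁆) : X = Y :=
  sub_eq_zero.1 (h.faithful _ fun f => by rw [sub_lie, hXY, sub_self])

/-- Composing with `dg` reduces equality of anchors to scalar functionals on forms, where `dual`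
applies; `faithful` then returns to elements of `L`. -/
lemma HasEnoughFunctions.linear_ext (h : HasEnoughFunctions A L) {a b : Dual A L →ₗ[A] L}
    (hab : ∀ f g : A, ⁅a (exactForm L f), g⁆ = ⁅b (exactForm L f), g⁆) (α : Dual A L) :
    a α = b α :=
  h.ext fun g => by
    let T : (Dual A L →ₗ[A] L) → Dual A L →ₗ[A] A := fun a => exactForm L g ∘ₗ a
    have := h.dual (T a - T b) fun f => by simp [T, hab]
    exact sub_eq_zero.1 (LinearMap.congr_fun this α)

/-- Although neither side is function-linear in `α`, their difference is: both acquire the same term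
`(ρ(ξ) f) a(α)`. Hence exact forms suffice. -/
lemma isEquivariant_of_exactForm (h : HasEnoughFunctions A L)
    (he : ∀ (ξ : 𝔤) (f g : A), ⁅ρ ξ, ⁅a (exactForm L f), g⁆⁆
      = ⁅a (exactForm L ⁅ρ ξ, f⁆), g⁆ + ⁅a (exactForm L f), ⁅ρ ξ, g⁆⁆) :
    IsEquivariant a ρ := by
  intro ξ α
  let T : Dual A L →ₗ[A] L :=
    { toFun := fun α => a (lieDerivForm (ρ ξ) α) - ⁅ρ ξ, a α⁆
      map_add' := fun α β => by simp only [map_add, lie_add]; abel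
      map_smul' := fun f α => by
        have : lieDerivForm (ρ ξ) (f • α) = f • lieDerivForm (ρ ξ) α + ⁅ρ ξ, f⁆ • α := by
          ext Y; simp; ring
        simp only [this, map_add, map_smul, LieRinehartRing.leibniz_smul_right, RingHom.id_apply]
        module }
  have hT := h.linear_ext (a := T) (b := 0) (fun f g => by
    simp only [T, LinearMap.coe_mk, AddHom.coe_mk, lieDerivForm_exactForm, sub_lie, lie_lie, he,
      LinearMap.zero_apply, zero_lie]
    abel) α
  exact sub_eq_zero.1 hT

lemma formBracket_skew (hC : IsInvariantSymmetric e e') (ha : IsIsotropic a ρ e e')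
    (α β : Dual A L) : formBracket a ρ e e' α β = - formBracket a ρ e e' β α := by
  have h := formBracket_self hC ha (α + β)
  rw [formBracket_add_left, formBracket_add_right, formBracket_add_right, formBracket_self hC ha,
    formBracket_self hC ha] at h
  rw [← add_eq_zero_iff_eq_neg]
  simpa using h

lemma formBracket_smul_left (hC : IsInvariantSymmetric e e') (ha : IsIsotropic a ρ e e')
    (α β : Dual A L) (f : A) :
    formBracket a ρ e e' (f • α) β = f • formBracket a ρ e e' α β - ⁅a β, f⁆ • α := by
  rw [formBracket_skew hC ha, formBracket_smul_right, formBracket_skew hC ha β α]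
  module

/-- The defect is function-linear in `β` because the Leibniz terms agree, and it is skew, so it is
determined in each argument by exact forms. -/
lemma anchor_formBracket (h : HasEnoughFunctions A L) (hC : IsInvariantSymmetric e e')
    (ha : IsIsotropic a ρ e e') (he : IsEquivariant a ρ)
    (hJ : ∀ f g h : A, ⁅hamiltonianField a ρ e e' f, ⁅hamiltonianField a ρ e e' g, h⁆⁆
      + ⁅hamiltonianField a ρ e e' g, ⁅hamiltonianField a ρ e e' h, f⁆⁆
      + ⁅hamiltonianField a ρ e e' h, ⁅hamiltonianField a ρ e e' f, g⁆⁆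
      = (1 / 4 : ℝ) • cartanSum e e' (comoment ρ (exactForm L f)) (comoment ρ (exactForm L g))
        (comoment ρ (exactForm L h))) (α β : Dual A L) :
    a (formBracket a ρ e e' α β) = ⁅a α, a β⁆ := by
  let T : Dual A L → Dual A L →ₗ[A] L := fun α =>
    { toFun := fun β => a (formBracket a ρ e e' α β) - ⁅a α, a β⁆
      map_add' := fun β γ => by
        simp only [formBracket_add_right, map_add, lie_add]; abel
      map_smul' := fun f β => by
        simp only [formBracket_smul_right, map_add, map_smul, LieRinehartRing.leibniz_smul_right,
          RingHom.id_apply]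
        module }
  have hT : ∀ α β, T α β = - T β α := fun α β => by
    simp only [T, LinearMap.coe_mk, AddHom.coe_mk, formBracket_skew hC ha α β, map_neg]
    rw [← lie_skew (a α)]
    abel
  have h1 : ∀ f α, T (exactForm L f) α = 0 := fun f =>
    h.linear_ext (b := 0) fun g u => by
      simp [T, sub_lie, anchor_formBracket_exactForm hC ha he hJ]
  have h2 := h.linear_ext (a := T α) (b := 0) (fun f g => by rw [hT, h1]; simp) β
  exact sub_eq_zero.1 h2

end ExactReduction

/-! ### Alternating maps -/

section Alternating

variable {R M N : Type*} [CommRing R] [AddCommGroup M] [Module R M] [AddCommGroup N] [Module R N]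

/-- Put `w` in both slots `i` and `j`: the two ways of deleting one copy differ by the sign of a
permutation. -/
lemma AlternatingMap.neg_one_pow_smul_map_removeNth_update {k : ℕ} (θ : M [⋀^Fin k]→ₗ[R] N)
    (v : Fin (k + 1) → M) {i j : Fin (k + 1)} (hij : i ≠ j) (w : M) :
    (-1 : R) ^ (i : ℕ) • θ (i.removeNth (Function.update v j w))
      = - (-1 : R) ^ (j : ℕ) • θ (j.removeNth (Function.update v i w)) := by
  have h := AlternatingMap.neg_one_pow_smul_map_removeNth_add_eq_zero_of_eq θ
    (v := Function.update (Function.update v i w) j w) (i := i) (j := j) (by simp [hij]) hij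
  rw [Function.update_comm hij] at h
  have e1 : i.removeNth (Function.update (Function.update v j w) i w)
      = i.removeNth (Function.update v j w) := by
    ext l; simp [Fin.removeNth]
  have e2 : j.removeNth (Function.update (Function.update v j w) i w)
      = j.removeNth (Function.update v i w) := by
    rw [Function.update_comm hij.symm]
    ext l; simp [Fin.removeNth]
  rw [e1, e2] at h
  have hz : ∀ (n : ℕ) (x : N), (-1 : R) ^ n • x = (-1 : ℤ) ^ n • x := fun n x => by
    rw [← Int.cast_smul_eq_zsmul R]; push_cast; rfl
  rw [neg_smul, hz, hz]
  exact eq_neg_of_add_eq_zero_left h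

/-- Antisymmetrization of a double sum over pairs of removed and replaced entries. -/
lemma AlternatingMap.sum_map_update_removeNth {k : ℕ} (θ : M [⋀^Fin k]→ₗ[R] N)
    (v : Fin (k + 1) → M) (W : Fin (k + 1) → Fin (k + 1) → M) :
    ∑ j : Fin (k + 1), (-1 : R) ^ (j : ℕ) •
        ∑ l, θ (Function.update (j.removeNth v) l (W j (j.succAbove l)))
      = ∑ j : Fin (k + 1), ∑ i ∈ Finset.Iio j, (-1 : R) ^ (j : ℕ) •
        θ (j.removeNth (Function.update v i (W j i - W i j))) := by
  have hsub : ∀ j i : Fin (k + 1), i ≠ j → ∀ x y : M,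
      θ (j.removeNth (Function.update v i (x - y))) = θ (j.removeNth (Function.update v i x))
        - θ (j.removeNth (Function.update v i y)) := by
    intro j i hij x y
    obtain ⟨l, rfl⟩ := Fin.exists_succAbove_eq hij
    simp only [Fin.removeNth_update_succAbove, AlternatingMap.map_update_sub]
  let F : Fin (k + 1) → Fin (k + 1) → N := fun j i =>
    (-1 : R) ^ (j : ℕ) • θ (j.removeNth (Function.update v i (W j i)))
  have hl : ∀ j : Fin (k + 1), (-1 : R) ^ (j : ℕ) •
      ∑ l, θ (Function.update (j.removeNth v) l (W j (j.succAbove l)))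
      = ∑ i ∈ Finset.Iio j, F j i + ∑ i ∈ Finset.Ioi j, F j i := by
    intro j
    have h1 : ∑ l, F j (j.succAbove l) = ∑ i ∈ Finset.univ.erase j, F j i := by
      rw [← Finset.compl_singleton, ← Fin.image_succAbove_univ, Finset.sum_image]
      exact fun _ _ _ _ h => Fin.succAbove_right_injective h
    have h2 : Finset.univ.erase j = Finset.Iio j ∪ Finset.Ioi j := by
      ext i; simp [lt_or_lt_iff_ne]
    rw [← Finset.sum_union (Finset.disjoint_left.2 fun i => by
      simpa using fun h => le_of_lt h), ← h2, ← h1, Finset.smul_sum]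
    exact Finset.sum_congr rfl fun l _ => by simp only [F, Fin.removeNth_update_succAbove]
  -- Pairs with `i > j` are relabelled so that only `i < j` occurs; exchanging the deleted and the
  -- replaced slot then supplies the minus sign in `W j i - W i j`.
  have hswap : ∑ j, ∑ i ∈ Finset.Ioi j, F j i = ∑ i, ∑ j ∈ Finset.Iio i, F j i :=
    Finset.sum_comm' (by simp)
  rw [Finset.sum_congr rfl fun j _ => hl j, Finset.sum_add_distrib, hswap,
    ← Finset.sum_add_distrib]
  refine Finset.sum_congr rfl fun j _ => ?_
  rw [← Finset.sum_add_distrib]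
  refine Finset.sum_congr rfl fun i hi => ?_
  have hij : i ≠ j := (Finset.mem_Iio.1 hi).ne
  rw [hsub j i hij, smul_sub, sub_eq_add_neg]
  simp only [F]
  rw [AlternatingMap.neg_one_pow_smul_map_removeNth_update θ v hij, neg_smul]

/-- A linear endomorphism acting on an alternating map as a derivation. -/
def AlternatingMap.derive {κ : Type*} [Fintype κ] [DecidableEq κ] (θ : M [⋀^κ]→ₗ[R] N)
    (D : M →ₗ[R] M) : M [⋀^κ]→ₗ[R] N where
  toMultilinearMap := ∑ l, θ.toMultilinearMap.compLinearMap
    (Function.update (fun _ => LinearMap.id) l D)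
  map_eq_zero_of_eq' v p q hv hpq := by
    have key : ∀ l, θ.toMultilinearMap.compLinearMap
        (Function.update (fun _ => LinearMap.id) l D) v = θ (Function.update v l (D (v l))) := by
      intro l
      rw [MultilinearMap.compLinearMap_apply]
      change θ _ = _
      congr 1
      ext i
      rcases eq_or_ne i l with rfl | h <;> simp [*]
    have key' : ∑ l, θ (Function.update v l (D (v l))) = 0 := by
      rw [Fintype.sum_eq_add p q hpq]
      · have : Function.update v q (D (v q)) = Function.update v p (D (v p)) ∘ Equiv.swap p q := by
          ext i
          rcases eq_or_ne i p with rfl | hp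
          · simp [hpq, hpq.symm, hv]
          rcases eq_or_ne i q with rfl | hq
          · simp [hv]
          · simp [Equiv.swap_apply_of_ne_of_ne, hp, hq]
        rw [this, θ.map_swap _ hpq, add_neg_cancel]
      · rintro l ⟨hp, hq⟩
        exact θ.map_eq_zero_of_eq _ (i := p) (j := q) (by simp [hp.symm, hq.symm, hv]) hpq
    simpa [key] using key'

lemma AlternatingMap.derive_apply {κ : Type*} [Fintype κ] [DecidableEq κ] (θ : M [⋀^κ]→ₗ[R] N)
    (D : M →ₗ[R] M) (v : κ → M) :
    θ.derive D v = ∑ l, θ (Function.update v l (D (v l))) := by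
  change (∑ l, θ.toMultilinearMap.compLinearMap
    (Function.update (fun _ => LinearMap.id) l D)) v = _
  rw [sum_apply]
  refine Finset.sum_congr rfl fun l _ => ?_
  rw [MultilinearMap.compLinearMap_apply]
  change θ _ = _
  congr 1
  ext i
  rcases eq_or_ne i l with rfl | h <;> simp [*]

end Alternating

/-! ### The differential of a bracket with anchor -/

section Differential

variable {A Γ : Type*} [CommRing A] [Algebra ℝ A] [AddCommGroup Γ] [Module A Γ] [Module ℝ Γ]
  [IsScalarTower ℝ A Γ] {k : ℕ}

/-- The differential of an alternating form `θ`, for an anchor `an` and a bracket `br`. -/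
def bracketDifferential (an : Γ →ₗ[A] Derivation ℝ A A) (br : Γ →ₗ[ℝ] Γ →ₗ[ℝ] Γ)
    (θ : (Fin k → Γ) → A) (s : Fin (k + 1) → Γ) : A :=
  (∑ i : Fin (k + 1), (-1 : ℝ) ^ (i : ℕ) • an (s i) (θ (i.removeNth s)))
  + ∑ j : Fin (k + 1), ∑ i ∈ Finset.Iio j, (-1 : ℝ) ^ (j : ℕ) •
      θ (j.removeNth (Function.update s i (br (s i) (s j))))

variable (an : Γ →ₗ[A] Derivation ℝ A A) (br : Γ →ₗ[ℝ] Γ →ₗ[ℝ] Γ) (θ : Γ [⋀^Fin k]→ₗ[A] A)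

/-- Restriction of scalars to `ℝ` of an alternating map. -/
def AlternatingMap.restrictReal {κ : Type*} (θ : Γ [⋀^κ]→ₗ[A] A) : Γ [⋀^κ]→ₗ[ℝ] A where
  toMultilinearMap := θ.toMultilinearMap.restrictScalars ℝ
  map_eq_zero_of_eq' := θ.map_eq_zero_of_eq'

@[simp] lemma AlternatingMap.restrictReal_apply {κ : Type*} (θ : Γ [⋀^κ]→ₗ[A] A) (v : κ → Γ) :
    θ.restrictReal v = θ v := rfl

/-- The differential as an alternating map over `ℝ`. -/
def bracketDifferentialAux : Γ [⋀^Fin (k + 1)]→ₗ[ℝ] A :=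
  AlternatingMap.alternatizeUncurryFin
    -- Alternatization meets each pair of arguments in both orders, hence the factor one half in
    -- front of the bracket term.
    { toFun := fun s => ((an s).toLinearMap.compAlternatingMap θ.restrictReal
        - (1 / 2 : ℝ) • θ.restrictReal.derive (br s))
      map_add' := fun s t => by
        ext v
        simp [AlternatingMap.derive_apply, Finset.sum_add_distrib]
        module
      map_smul' := fun c s => by
        have h1 : an (c • s) = c • an s := by
          rw [← algebraMap_smul A c s, map_smul, algebraMap_smul]
        ext v
        simp [AlternatingMap.derive_apply, ← Finset.smul_sum, h1]
        module }

lemma bracketDifferentialAux_apply (s : Fin (k + 1) → Γ) :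
    bracketDifferentialAux an br θ s = ∑ j : Fin (k + 1), (-1 : ℝ) ^ (j : ℕ) •
      (an (s j) (θ (j.removeNth s)) - (1 / 2 : ℝ) •
        ∑ l, θ (Function.update (j.removeNth s) l (br (s j) (s (j.succAbove l))))) := by
  have hz : ∀ (n : ℕ) (x : A), (-1 : ℝ) ^ n • x = (-1 : ℤ) ^ n • x := fun n x => by
    rw [← Int.cast_smul_eq_zsmul ℝ]; push_cast; rfl
  simp only [bracketDifferentialAux, AlternatingMap.alternatizeUncurryFin_apply, hz]
  refine Finset.sum_congr rfl fun j _ => ?_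
  simp [AlternatingMap.derive_apply, Fin.removeNth]

/-- Antisymmetrization with `W j i = -½ [sⱼ, sᵢ]` restores the full bracket, since skewness makes
the two halves add. -/
lemma bracketDifferentialAux_eq (hbr : ∀ s t, br s t = - br t s) (s : Fin (k + 1) → Γ) :
    bracketDifferentialAux an br θ s = bracketDifferential an br θ s := by
  have h := AlternatingMap.sum_map_update_removeNth θ.restrictReal s
    (fun j i => - (1 / 2 : ℝ) • br (s j) (s i))
  have h1 : ∀ i j, -(1 / 2 : ℝ) • br (s j) (s i) - -(1 / 2 : ℝ) • br (s i) (s j)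
      = br (s i) (s j) := fun i j => by rw [hbr (s j)]; module
  have h2 : ∀ (v : Fin k → Γ) l x, θ (Function.update v l (-(1 / 2 : ℝ) • x))
      = -(1 / 2 : ℝ) • θ (Function.update v l x) := fun v l x =>
    θ.restrictReal.map_update_smul v l _ x
  simp only [h1, AlternatingMap.restrictReal_apply, h2, ← Finset.smul_sum] at h
  rw [bracketDifferentialAux_apply, bracketDifferential]
  simp only [← Finset.smul_sum]
  rw [← h, ← Finset.sum_add_distrib]
  exact Finset.sum_congr rfl fun j _ => by module

/-- Tensoriality of the differential: derivatives of `f` come from the anchor and from the Leibniz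
rules of the bracket in both slots, and they cancel. Only the first slot is needed, the form being
alternating. -/
lemma bracketDifferentialAux_smul
    (hl : ∀ (s t : Γ) (f : A), br s (f • t) = f • br s t + an s f • t)
    (hr : ∀ (s t : Γ) (f : A), br (f • s) t = f • br s t - an t f • s)
    (f : A) (x : Γ) (t : Fin k → Γ) :
    bracketDifferentialAux an br θ (Fin.cons (f • x) t)
      = f * bracketDifferentialAux an br θ (Fin.cons x t) := by
  have hsub : ∀ (v : Fin k → Γ) l x y, θ (Function.update v l (x - y))
    = θ (Function.update v l x) - θ (Function.update v l y) := fun v l => θ.map_update_sub v l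
  have h0 : ∀ x : Γ, (0 : Fin (k + 1)).removeNth (Fin.cons x t : Fin (k + 1) → Γ) = t :=
    fun x => by ext l; simp [Fin.removeNth]
  simp only [bracketDifferentialAux_apply, Fin.sum_univ_succ (n := k), h0, Fin.cons_zero,
    Fin.cons_succ, hr, hsub, θ.map_update_smul, map_smul, Derivation.smul_apply]
  rcases k with _ | k
  · simp
  have hs : ∀ (x : Γ) (m : Fin (k + 1)), m.succ.removeNth (Fin.cons x t : Fin (k + 2) → Γ)
      = Fin.cons x (m.removeNth t) := fun x m => by
    ext l
    cases l using Fin.cases <;> simp [Fin.removeNth]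
  have hc : ∀ (f : A) (x : Γ) (u : Fin k → Γ), θ (Fin.cons (f • x) u) = f * θ (Fin.cons x u) :=
    fun f x u => θ.toMultilinearMap.cons_smul u f x
  have hca : ∀ (x y : Γ) (u : Fin k → Γ),
      θ (Fin.cons (x + y) u) = θ (Fin.cons x u) + θ (Fin.cons y u) :=
    fun x y u => θ.toMultilinearMap.cons_add u x y
  -- The sign of deleting slot `m` is exactly the sign of moving `x` from the front into slot `m`.
  have hm : ∀ m : Fin (k + 1), (-1 : ℝ) ^ (m : ℕ) • θ (Fin.cons x (m.removeNth t))
      = θ (Function.update t m x) := fun m => by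
    have h := θ.neg_one_pow_smul_map_insertNth m x (m.removeNth t)
    rw [Fin.insertNth_removeNth] at h
    have h2 : θ (Matrix.vecCons x (m.removeNth t)) = θ (Fin.cons x (m.removeNth t)) := rfl
    rw [← h2, ← h, ← Int.cast_smul_eq_zsmul ℝ, smul_smul]
    push_cast
    rw [← mul_pow]
    simp
  have hterm : ∀ m : Fin (k + 1), ∀ x : Γ,
      an (t m) (θ (m.succ.removeNth (Fin.cons x t : Fin (k + 2) → Γ))) - (1 / 2 : ℝ) •
        ∑ l, θ (Function.update (m.succ.removeNth (Fin.cons x t : Fin (k + 2) → Γ)) l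
          (br (t m) ((Fin.cons x t : Fin (k + 2) → Γ) (m.succ.succAbove l))))
      = an (t m) (θ (Fin.cons x (m.removeNth t)))
        - (1 / 2 : ℝ) • (θ (Fin.cons (br (t m) x) (m.removeNth t))
        + ∑ l : Fin k, θ (Fin.cons x (Function.update (m.removeNth t) l
            (br (t m) (t (m.succAbove l)))))) := fun m x => by
    simp only [hs, Fin.sum_univ_succ (n := k), Fin.update_cons_zero, ← Fin.cons_update,
      Fin.succ_succAbove_succ, Fin.succ_succAbove_zero, Fin.cons_zero, Fin.cons_succ]
  simp only [hterm, hl, hc, hca, Derivation.leibniz, ← Finset.mul_sum, Finset.sum_sub_distrib,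
    smul_eq_mul]
  have h3 : ∑ m : Fin (k + 1), an (t m) f * θ (Function.update t m x)
      = ∑ m : Fin (k + 1), (-1 : ℝ) ^ (m : ℕ) • (an (t m) f * θ (Fin.cons x (m.removeNth t))) := by
    refine Finset.sum_congr rfl fun m _ => ?_
    rw [← hm, mul_smul_comm]
  -- For a later slot the anchor yields a full derivative of `f` and the bracket takes away half.
  -- The remaining half, with its sign, is opposite to the contribution of slot zero rewritten by
  -- `h3`.
  have h4 : ∀ (c : ℝ) (p q r u d : A),
      (c * -1) • (f * p + q * d - (1 / 2 : ℝ) • (f * r + d * q + f * u))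
        = f * ((c * -1) • (p - (1 / 2 : ℝ) • (r + u))) - (1 / 2 : ℝ) • c • (d * q) := by
    intro c p q r u d
    have h2 : 2 * algebraMap ℝ A (1 / 2) = 1 := by
      rw [← map_ofNat (algebraMap ℝ A) 2, ← map_mul]
      norm_num
    simp only [Algebra.smul_def, map_mul, map_neg, map_one]
    linear_combination algebraMap ℝ A c * q * d * h2
  simp only [Fin.zero_succAbove, Fin.cons_succ, h3, Fin.val_succ, pow_succ, h4, Fin.val_zero,
    pow_zero, one_smul, Finset.sum_sub_distrib, ← Finset.mul_sum, ← Finset.smul_sum]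
  rw [mul_add, mul_sub, mul_smul_comm]
  module

end Differential

/-! ### Sections of vector bundles as modules over smooth functions -/

section SectionModule

variable {E : Type*} [NormedAddCommGroup E] [NormedSpace ℝ E]
  {M : Type*} [TopologicalSpace M] [ChartedSpace E M]
  {F : Type*} [NormedAddCommGroup F] [NormedSpace ℝ F]
  {A : M → Type*} [TopologicalSpace (Bundle.TotalSpace F A)] [∀ x, TopologicalSpace (A x)]
  [∀ x, AddCommGroup (A x)] [∀ x, Module ℝ (A x)] [FiberBundle F A] [VectorBundle ℝ F A]

instance Sections.instSMulSmoothFun : SMul (SmoothFun E M) (Sections E F A) where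
  smul f s := ⟨fun x => f x • s x, f.contMDiff.smul_section s.contMDiff⟩

@[simp] lemma Sections.smulFun_apply (f : SmoothFun E M) (s : Sections E F A) (x : M) :
    (f • s) x = f x • s x := rfl

instance Sections.instModuleSmoothFun : Module (SmoothFun E M) (Sections E F A) where
  one_smul s := by ext x; simp
  mul_smul f g s := by ext x; simp [mul_smul]
  smul_zero f := by ext x; simp
  smul_add f s t := by ext x; simp
  add_smul f g s := by ext x; simp [add_smul]
  zero_smul s := by ext x; simp

instance : IsScalarTower ℝ (SmoothFun E M) (Sections E F A) where
  smul_assoc c f s := by ext x; simp [mul_smul]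

/-- Evaluation of smooth functions at a point. -/
def SmoothFun.evalAt (x : M) : SmoothFun E M →ₗ[ℝ] ℝ where
  toFun f := f x
  map_add' _ _ := rfl
  map_smul' _ _ := rfl

/-- Evaluation of sections at a point. -/
def Sections.evalAt (x : M) : Sections E F A →ₗ[ℝ] A x where
  toFun s := s x
  map_add' _ _ := rfl
  map_smul' _ _ := rfl

lemma Sections.add_apply (s t : Sections E F A) (x : M) : (s + t) x = s x + t x := rfl

@[simp] lemma SmoothFun.sum_apply {κ : Type*} (t : Finset κ) (f : κ → SmoothFun E M) (x : M) :
    (∑ i ∈ t, f i) x = ∑ i ∈ t, f i x := map_sum (SmoothFun.evalAt x) f t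

@[simp] lemma Sections.sum_apply {κ : Type*} (t : Finset κ) (s : κ → Sections E F A) (x : M) :
    (∑ i ∈ t, s i) x = ∑ i ∈ t, s i x := map_sum (Sections.evalAt x) s t

variable [FiniteDimensional ℝ E] [T2Space M] [IsManifold 𝓘(ℝ, E) ∞ M]
  [FiniteDimensional ℝ F] [ContMDiffVectorBundle ∞ F A 𝓘(ℝ, E)]

/-- Cut-off local frames: near a point, the module of sections is generated by finitely many
global sections. -/
lemma Sections.exists_cutoff_frame (x : M) :
    ∃ (n : ℕ) (χ : SmoothFun E M) (t : Fin n → Sections E F A)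
      (c : Fin n → Sections E F A →ₗ[SmoothFun E M] SmoothFun E M)
      (cx : ∀ y, Fin n → A y →ₗ[ℝ] ℝ),
      (∀ᶠ y in 𝓝 x, χ y = 1) ∧ (∀ y v, (χ y * χ y) • v = ∑ i, cx y i v • t i y) ∧
      (∀ i s y, c i s y = cx y i (s y)) ∧
      (∀ (s : ∀ y, A y), (∀ i, ContMDiff 𝓘(ℝ, E) 𝓘(ℝ, ℝ) ∞ (fun y => cx y i (s y))) →
        ContMDiffAt 𝓘(ℝ, E) (𝓘(ℝ, E).prod 𝓘(ℝ, F)) ∞ (fun y => Bundle.TotalSpace.mk' F y (s y)) x)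
      := by
  classical
  have : ContMDiffVectorBundle 1 F A 𝓘(ℝ, E) := ContMDiffVectorBundle.of_le (n := ∞) (by simp)
  let e := trivializationAt F A x
  have hx : x ∈ e.baseSet := FiberBundle.mem_baseSet_trivializationAt F A x
  let b := Module.finBasis ℝ F
  obtain ⟨χ, -, hχ⟩ : ∃ χ : SmoothBumpFunction 𝓘(ℝ, E) x, True ∧ tsupport χ ⊆ e.baseSet :=
    (SmoothBumpFunction.nhds_basis_tsupport (I := 𝓘(ℝ, E)) x).mem_iff.1
      (e.open_baseSet.mem_nhds hx)
  have hsmooth : ∀ {g : M → ℝ}, ContMDiffOn 𝓘(ℝ, E) 𝓘(ℝ, ℝ) ∞ g e.baseSet →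
      ContMDiff 𝓘(ℝ, E) 𝓘(ℝ, ℝ) ∞ (fun y => χ y * g y) := by
    intro g hg
    refine contMDiff_of_tsupport fun y hy => ?_
    have hy' : y ∈ e.baseSet := hχ (closure_mono (Function.support_mul_subset_left _ _) hy)
    exact (χ.contMDiff y).mul (hg.contMDiffAt (e.open_baseSet.mem_nhds hy'))
  -- Frame and coefficients are each multiplied by the bump function so that both are global;
  -- reconstruction therefore carries its square.
  let cx : ∀ y, Fin _ → A y →ₗ[ℝ] ℝ := fun y i => χ y • e.localFrameCoeff 𝓘(ℝ, E) b i y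
  refine ⟨_, ⟨χ, χ.contMDiff⟩, fun i => ⟨fun y => χ y • e.localFrame b i y,
      ContMDiffOn.smul_section_of_tsupport (ψ := χ) χ.contMDiff.contMDiffOn e.open_baseSet hχ
        (e.contMDiffOn_localFrame_baseSet (I := 𝓘(ℝ, E)) ∞ b i)⟩,
    fun i => ⟨⟨fun s => ⟨fun y => cx y i (s y), hsmooth
      (contMDiffOn_baseSet_localFrameCoeff b s.contMDiff.contMDiffOn i)⟩, ?_⟩, ?_⟩, cx, ?_, ?_, ?_, ?_⟩
  · intro s t; ext y; exact (cx y i).map_add _ _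
  · intro f s; ext y; exact (cx y i).map_smul _ _
  · exact χ.eventuallyEq_one
  · intro y v
    change (χ y * χ y) • v = ∑ i, (χ y • e.localFrameCoeff 𝓘(ℝ, E) b i y v) •
      χ y • e.localFrame b i y
    obtain ⟨s, rfl⟩ : ∃ s : ∀ y, A y, s y = v := ⟨Function.update 0 y v, by simp⟩
    by_cases hy : y ∈ e.baseSet
    · conv_lhs => rw [e.eq_sum_localFrameCoeff_smul (I := 𝓘(ℝ, E)) (b := b) (s := s) hy]
      rw [Finset.smul_sum]
      refine Finset.sum_congr rfl fun i _ => ?_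
      simp only [smul_smul, smul_eq_mul]
      congr 1; ring
    · have : χ y = 0 := by
        by_contra h
        exact hy (hχ (subset_tsupport _ h))
      simp [this]
  · intros; rfl
  · intro s hs
    rw [contMDiffAt_iff_localFrameCoeff b hx]
    intro i
    refine (hs i x).congr_of_eventuallyEq ?_
    filter_upwards [χ.eventuallyEq_one] with y hy
    have hy' : χ y = 1 := hy
    change _ = χ y * _
    rw [hy', one_mul]
    rfl

/-- Sections vanishing at `x` are combinations of sections with coefficients vanishing at `x`. -/
lemma Sections.mem_smul_top_of_apply_eq_zero (x : M) (s : Sections E F A) (hs : s x = 0) :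
    s ∈ Ideal.span {f : SmoothFun E M | f x = 0} •
      (⊤ : Submodule (SmoothFun E M) (Sections E F A)) := by
  obtain ⟨n, χ, t, c, cx, hχ, hχs, hc, -⟩ :=
    Sections.exists_cutoff_frame (E := E) (F := F) (A := A) x
  -- Every coefficient here vanishes at `x`: the first because `χ x = 1`, the others because `s x =
  -- 0`.
  have h : s = (1 - χ * χ) • s + ∑ i, c i s • t i := by
    ext y
    rw [Sections.add_apply, Sections.smulFun_apply, Sections.sum_apply]
    simp only [Sections.smulFun_apply, hc, ← hχs]
    change s y = (1 - χ y * χ y) • s y + _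
    module
  rw [h]
  refine add_mem (Submodule.smul_mem_smul (Ideal.subset_span ?_) trivial)
    (sum_mem fun i _ => Submodule.smul_mem_smul (Ideal.subset_span ?_) trivial)
  · have := hχ.self_of_nhds
    change 1 - χ x * χ x = 0
    simp [this]
  · change c i s x = 0
    rw [hc, hs, map_zero]

lemma Sections.linearMap_apply_eq_zero (T : Sections E F A →ₗ[SmoothFun E M] SmoothFun E M)
    {x : M} {s : Sections E F A} (hs : s x = 0) : T s x = 0 := by
  refine Submodule.smul_induction_on (p := fun s => T s x = 0)
    (Sections.mem_smul_top_of_apply_eq_zero x s hs) ?_ ?_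
  · intro f hf t _
    have hf' : f x = 0 := by
      induction hf using Submodule.span_induction with
      | mem f h => exact h
      | zero => rfl
      | add f g _ _ hf hg =>
        change f x + g x = 0
        rw [hf, hg, add_zero]
      | smul a f _ hf =>
        change a x * f x = 0
        rw [hf, mul_zero]
    rw [map_smul]
    change f x * T t x = 0
    rw [hf', zero_mul]
  · intro s t hs ht
    rw [map_add]
    change T s x + T t x = 0
    rw [hs, ht, add_zero]

/-- Every vector in a fibre extends to a global section, linearly in the vector. -/
lemma Sections.exists_extension (x : M) :
    ∃ ε : A x →ₗ[ℝ] Sections E F A, ∀ v, ε v x = v := by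
  obtain ⟨n, χ, t, c, cx, hχ, hχs, hc, -⟩ :=
    Sections.exists_cutoff_frame (E := E) (F := F) (A := A) x
  refine ⟨∑ i, (cx x i).smulRight (t i), fun v => ?_⟩
  have h := hχs x v
  rw [hχ.self_of_nhds, mul_one, one_smul] at h
  rw [LinearMap.sum_apply, Sections.sum_apply]
  exact h.symm

variable (E F A) in
/-- A linear extension of vectors in a fibre to global sections. -/
def Sections.extension (x : M) : A x →ₗ[ℝ] Sections E F A :=
  (Sections.exists_extension (E := E) (F := F) (A := A) x).choose

@[simp] lemma Sections.extension_apply (x : M) (v : A x) :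
    Sections.extension E F A x v x = v :=
  (Sections.exists_extension (E := E) (F := F) (A := A) x).choose_spec v

/-- Replace the arguments one at a time; each replacement changes the value by a function-linear
functional of a section vanishing at `x`. -/
lemma Sections.alternatingMap_congr {k : ℕ}
    (Θ : Sections E F A [⋀^Fin k]→ₗ[SmoothFun E M] SmoothFun E M)
    {x : M} {s t : Fin k → Sections E F A} (hst : ∀ i, s i x = t i x) : Θ s x = Θ t x := by
  classical
  have h : ∀ P : Finset (Fin k), Θ (P.piecewise t s) x = Θ s x := by
    intro P
    induction P using Finset.induction_on with
    | empty => simp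
    | insert j P hj ih =>
      rw [Finset.piecewise_insert, ← ih, ← sub_eq_zero]
      have h1 := Θ.map_update_sub (P.piecewise t s) j (t j) (s j)
      have h2 : Function.update (P.piecewise t s) j (s j) = P.piecewise t s := by
        rw [Function.update_eq_self_iff, Finset.piecewise_eq_of_notMem _ _ _ hj]
      rw [h2] at h1
      have h3 := Sections.linearMap_apply_eq_zero
        (Θ.toMultilinearMap.toLinearMap (P.piecewise t s) j) (x := x) (s := t j - s j)
        (by change t j x - s j x = 0; rw [hst, sub_self])
      have h4 := DFunLike.congr_fun h1 x
      exact h4.symm.trans h3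
  rw [← h Finset.univ, Finset.piecewise_univ]

lemma BundleForm.ofAlternating_aux {k : ℕ}
    (Θ : Sections E F A [⋀^Fin k]→ₗ[SmoothFun E M] SmoothFun E M) (s : Fin k → Sections E F A)
    (x : M) : ((SmoothFun.evalAt x).compAlternatingMap Θ.restrictReal).compLinearMap
      (Sections.extension E F A x) (fun i => s i x) = Θ s x :=
  Sections.alternatingMap_congr Θ (s := fun i => Sections.extension E F A x (s i x))
    (t := s) (x := x) fun i => Sections.extension_apply x (s i x)

/-- An alternating form on sections, linear over functions, comes from a form on the bundle. -/
def BundleForm.ofAlternating {k : ℕ}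
    (Θ : Sections E F A [⋀^Fin k]→ₗ[SmoothFun E M] SmoothFun E M) : BundleForm E F A k where
  toFun x := ((SmoothFun.evalAt x).compAlternatingMap Θ.restrictReal).compLinearMap
    (Sections.extension E F A x)
  smooth' s := by
    simp only [BundleForm.ofAlternating_aux]
    exact (Θ s).contMDiff

lemma BundleForm.ofAlternating_apply {k : ℕ}
    (Θ : Sections E F A [⋀^Fin k]→ₗ[SmoothFun E M] SmoothFun E M) (s : Fin k → Sections E F A)
    (x : M) : (BundleForm.ofAlternating Θ).toFun x (fun i => s i x) = Θ s x :=
  BundleForm.ofAlternating_aux Θ s x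

lemma Sections.update_apply {k : ℕ} (s : Fin k → Sections E F A) (i : Fin k)
    (t : Sections E F A) (x : M) :
    (fun l => Function.update s i t l x) = Function.update (fun l => s l x) i (t x) := by
  ext l
  rcases eq_or_ne l i with rfl | h <;> simp [*]

/-- A form on a bundle as an alternating form on sections. -/
def BundleForm.toAlternating {k : ℕ} (θ : BundleForm E F A k) :
    Sections E F A [⋀^Fin k]→ₗ[SmoothFun E M] SmoothFun E M where
  toFun s := ⟨fun x => θ.toFun x (fun i => s i x), θ.smooth' s⟩
  map_update_add' {inst} s i u v := by
    obtain rfl : inst = instDecidableEqFin k := Subsingleton.elim _ _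
    ext x
    change θ.toFun x _ = θ.toFun x _ + θ.toFun x _
    simp only [Sections.update_apply, Sections.add_apply, AlternatingMap.map_update_add]
  map_update_smul' {inst} s i f v := by
    obtain rfl : inst = instDecidableEqFin k := Subsingleton.elim _ _
    ext x
    change θ.toFun x _ = f x * θ.toFun x _
    simp only [Sections.update_apply, Sections.smulFun_apply, AlternatingMap.map_update_smul,
      smul_eq_mul]
  map_eq_zero_of_eq' s i j h hij := by
    ext x
    exact (θ.toFun x).map_eq_zero_of_eq _ (by simp [h]) hij

@[simp] lemma BundleForm.toAlternating_apply {k : ℕ} (θ : BundleForm E F A k)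
    (s : Fin k → Sections E F A) (x : M) :
    θ.toAlternating s x = θ.toFun x (fun i => s i x) := rfl

end SectionModule

/-! ### Directional derivatives -/

section DirDeriv

variable {E : Type*} [NormedAddCommGroup E] [NormedSpace ℝ E]
  {M : Type*} [TopologicalSpace M] [ChartedSpace E M]

lemma dirDeriv_eq_mvfderiv {x : M} (v : TangentSpace 𝓘(ℝ, E) x) (h : M → ℝ) :
    dirDeriv v h = mvfderiv 𝓘(ℝ, E) h x v := rfl

lemma SmoothFun.mdifferentiableAt (f : SmoothFun E M) (x : M) :
    MDifferentiableAt 𝓘(ℝ, E) 𝓘(ℝ, ℝ) f x := f.contMDiff.mdifferentiable (by simp) x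

/-- The derivative at `x` along `v` as a linear functional on smooth functions. -/
def dirDerivLinear {x : M} (v : TangentSpace 𝓘(ℝ, E) x) : SmoothFun E M →ₗ[ℝ] ℝ where
  toFun f := dirDeriv v f
  map_add' f g := by
    simp only [dirDeriv_eq_mvfderiv, ContMDiffMap.coe_add]
    rw [mvfderiv_add (f.mdifferentiableAt x) (g.mdifferentiableAt x)]
    rfl
  map_smul' c f := by
    have h : (⇑(c • f) : M → ℝ) = (fun _ : M => c) • ⇑f := rfl
    simp only [dirDeriv_eq_mvfderiv]
    rw [h, mvfderiv_smul mdifferentiableAt_const (f.mdifferentiableAt x), mvfderiv_const]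
    simp

lemma dirDeriv_mul {x : M} (v : TangentSpace 𝓘(ℝ, E) x) (f g : SmoothFun E M) :
    dirDeriv v (f * g : SmoothFun E M) = f x * dirDeriv v g + g x * dirDeriv v f := by
  simp only [dirDeriv_eq_mvfderiv, ContMDiffMap.coe_mul]
  rw [mvfderiv_mul (f.mdifferentiableAt x) (g.mdifferentiableAt x)]
  rfl

lemma dirDeriv_add_left {x : M} (v w : TangentSpace 𝓘(ℝ, E) x) (h : M → ℝ) :
    dirDeriv (v + w) h = dirDeriv v h + dirDeriv w h := map_add (covectorOf E h x) v w

lemma dirDeriv_smul_left {x : M} (c : ℝ) (v : TangentSpace 𝓘(ℝ, E) x) (h : M → ℝ) :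
    dirDeriv (c • v) h = c * dirDeriv v h := map_smul (covectorOf E h x) c v

variable [IsManifold 𝓘(ℝ, E) ∞ M]

lemma SmoothVectorField.contMDiff_dirDeriv (X : SmoothVectorField E M) (f : SmoothFun E M) :
    ContMDiff 𝓘(ℝ, E) 𝓘(ℝ, ℝ) ∞ (fun x => dirDeriv (X x) f) := by
  have h1 : ContMDiff 𝓘(ℝ, E).tangent 𝓘(ℝ, ℝ).tangent ∞ (tangentMap 𝓘(ℝ, E) 𝓘(ℝ, ℝ) f) :=
    f.contMDiff.contMDiff_tangentMap (m := ∞) (by simp)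
  exact (contMDiff_snd_tangentBundle_modelSpace ℝ 𝓘(ℝ, ℝ)).comp (h1.comp X.contMDiff)

end DirDeriv

/-! ### The Lie–Rinehart algebra of vector fields -/

section VectorFields

variable {E : Type*} [NormedAddCommGroup E] [NormedSpace ℝ E] [FiniteDimensional ℝ E]
  {M : Type*} [TopologicalSpace M] [ChartedSpace E M] [IsManifold 𝓘(ℝ, E) ∞ M]

lemma SmoothVectorField.contMDiffAt_of_le (X : SmoothVectorField E M) (n : ℕ∞) (x : M) :
    ContMDiffAt 𝓘(ℝ, E) (𝓘(ℝ, E).prod 𝓘(ℝ, E)) n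
      (fun y => Bundle.TotalSpace.mk' E (E := (TangentSpace 𝓘(ℝ, E) : M → Type _)) y (X y)) x :=
  (X.contMDiff x).of_le (by exact_mod_cast le_top)

lemma SmoothVectorField.mdifferentiableAt (X : SmoothVectorField E M) (x : M) :
    MDifferentiableAt 𝓘(ℝ, E) (𝓘(ℝ, E).prod 𝓘(ℝ, E))
      (fun y => Bundle.TotalSpace.mk' E (E := (TangentSpace 𝓘(ℝ, E) : M → Type _)) y (X y)) x :=
  (X.contMDiff x).mdifferentiableAt (by simp)

variable (E M) in
lemma isManifold_minSmoothness (n : ℕ) : IsManifold 𝓘(ℝ, E) (minSmoothness ℝ n) M := by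
  rw [minSmoothness_of_isRCLikeNormedField]
  exact IsManifold.of_le (n := ∞) (by exact_mod_cast le_top)

instance : Bracket (SmoothVectorField E M) (SmoothVectorField E M) where
  bracket X Y := ⟨VectorField.mlieBracket 𝓘(ℝ, E) X Y, fun x =>
    have : IsManifold 𝓘(ℝ, E) (((⊤ : ℕ∞) : WithTop ℕ∞) + 1) M := by
      simpa using (inferInstance : IsManifold 𝓘(ℝ, E) ∞ M)
    have : IsManifold 𝓘(ℝ, E) (minSmoothness ℝ 2) M := isManifold_minSmoothness E M 2
    ContMDiffAt.mlieBracket_vectorField (n := ⊤) (m := ⊤) (X.contMDiff x) (Y.contMDiff x)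
      (by simp)⟩

lemma SmoothVectorField.lie_apply (X Y : SmoothVectorField E M) (x : M) :
    ⁅X, Y⁆ x = VectorField.mlieBracket 𝓘(ℝ, E) X Y x := rfl

instance : LieRing (SmoothVectorField E M) where
  add_lie X Y Z := by
    ext x
    have : IsManifold 𝓘(ℝ, E) (minSmoothness ℝ 2) M := isManifold_minSmoothness E M 2
    exact VectorField.mlieBracket_add_left (X.mdifferentiableAt x) (Y.mdifferentiableAt x)
  lie_add X Y Z := by
    ext x
    exact VectorField.mlieBracket_add_right (Y.mdifferentiableAt x) (Z.mdifferentiableAt x)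
  lie_self X := by
    ext x
    simp [SmoothVectorField.lie_apply]
  leibniz_lie X Y Z := by
    ext x
    have : IsManifold 𝓘(ℝ, E) (minSmoothness ℝ 3) M := isManifold_minSmoothness E M 3
    exact VectorField.leibniz_identity_mlieBracket_apply (by simpa using X.contMDiffAt_of_le 2 x)
      (by simpa using Y.contMDiffAt_of_le 2 x) (by simpa using Z.contMDiffAt_of_le 2 x)

instance : LieAlgebra ℝ (SmoothVectorField E M) where
  lie_smul c X Y := by
    ext x
    exact VectorField.mlieBracket_const_smul_right (Y.mdifferentiableAt x)

instance : Bracket (SmoothVectorField E M) (SmoothFun E M) where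
  bracket X f := ⟨fun x => dirDeriv (X x) f, X.contMDiff_dirDeriv f⟩

@[simp] lemma SmoothVectorField.lie_fun_apply (X : SmoothVectorField E M) (f : SmoothFun E M)
    (x : M) : ⁅X, f⁆ x = dirDeriv (X x) f := rfl

lemma SmoothVectorField.lie_smul_fun (X Y : SmoothVectorField E M) (f : SmoothFun E M) :
    ⁅X, f • Y⁆ = f • ⁅X, Y⁆ + ⁅X, f⁆ • Y := by
  ext x
  have h := VectorField.mlieBracket_smul_right (V := X) (f.mdifferentiableAt x)
    (Y.mdifferentiableAt x)
  rw [add_comm]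
  exact h

lemma SmoothVectorField.lie_fun_mul (X : SmoothVectorField E M) (f g : SmoothFun E M) :
    ⁅X, f * g⁆ = f * ⁅X, g⁆ + ⁅X, f⁆ * g := by
  ext x
  refine (dirDeriv_mul (X x) f g).trans ?_
  rw [mul_comm (g x)]
  rfl

lemma SmoothVectorField.lie_fun_add (X : SmoothVectorField E M) (f g : SmoothFun E M) :
    ⁅X, f + g⁆ = ⁅X, f⁆ + ⁅X, g⁆ := by
  ext x
  exact map_add (dirDerivLinear (X x)) f g

variable [T2Space M]

/-- The commutator of derivations is the derivation along the Lie bracket; this follows from the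
Jacobi identity and the Leibniz rule. -/
lemma SmoothVectorField.lie_lie_fun (X Y : SmoothVectorField E M) (f : SmoothFun E M) :
    ⁅⁅X, Y⁆, f⁆ = ⁅X, ⁅Y, f⁆⁆ - ⁅Y, ⁅X, f⁆⁆ := by
  ext x
  -- A field `Z` that is nonzero at `x` allows its coefficients to be compared in the Jacobi
  -- identity for `X`, `Y`, `f • Z`. If the tangent space is zero, all derivatives vanish.
  by_cases hx : ∃ w : TangentSpace 𝓘(ℝ, E) x, w ≠ 0
  · obtain ⟨w, hw⟩ := hx
    let Z : SmoothVectorField E M :=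
      Sections.extension E E (TangentSpace 𝓘(ℝ, E) : M → Type _) x w
    have hZ : Z x = w := Sections.extension_apply x w
    have h := leibniz_lie X Y (f • Z)
    simp only [SmoothVectorField.lie_smul_fun, lie_add] at h
    rw [leibniz_lie X Y Z] at h
    have h2 : ⁅⁅X, Y⁆, f⁆ • Z = (⁅X, ⁅Y, f⁆⁆ - ⁅Y, ⁅X, f⁆⁆) • Z := by
      linear_combination (norm := module) -h
    have h3 := DFunLike.congr_fun h2 x
    simp only [Sections.smulFun_apply, hZ] at h3
    exact smul_left_injective ℝ hw h3
  · push Not at hx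
    have h0 : ∀ (v : TangentSpace 𝓘(ℝ, E) x) (g : SmoothFun E M), dirDeriv v g = 0 := by
      intro v g
      rw [hx v]
      exact map_zero (covectorOf E g x)
    change dirDeriv _ _ = dirDeriv _ _ - dirDeriv _ _
    rw [h0, h0, h0, sub_zero]

instance : LieRingModule (SmoothVectorField E M) (SmoothFun E M) where
  add_lie X Y f := by ext x; exact dirDeriv_add_left (X x) (Y x) f
  lie_add := SmoothVectorField.lie_fun_add
  leibniz_lie X Y f := by rw [SmoothVectorField.lie_lie_fun]; abel

instance : LieRinehartRing (SmoothFun E M) (SmoothVectorField E M) where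
  lie_smul_eq_mul' f g X := by ext x; exact dirDeriv_smul_left (f x) (X x) g
  leibniz_mul_right' := SmoothVectorField.lie_fun_mul
  leibniz_smul_right' := SmoothVectorField.lie_smul_fun

instance : LieRinehartAlgebra ℝ (SmoothFun E M) (SmoothVectorField E M) where
  smul_lie c X f := by ext x; exact dirDeriv_smul_left c (X x) f
  lie_smul c X f := by ext x; exact map_smul (dirDerivLinear (X x)) c f

end VectorFields

/-! ### 1-forms and the dual of the module of vector fields -/

section Cotangent

variable {E : Type*} [NormedAddCommGroup E] [NormedSpace ℝ E] [FiniteDimensional ℝ E]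
  {M : Type*} [TopologicalSpace M] [ChartedSpace E M] [IsManifold 𝓘(ℝ, E) ∞ M]

lemma contMDiffAt_clm_of_basis {κ : Type*} [Fintype κ] (b : Module.Basis κ ℝ E)
    {g : M → E →L[ℝ] ℝ} {x : M}
    (hg : ∀ i, ContMDiffAt 𝓘(ℝ, E) 𝓘(ℝ, ℝ) ∞ (fun y => g y (b i)) x) :
    ContMDiffAt 𝓘(ℝ, E) 𝓘(ℝ, E →L[ℝ] ℝ) ∞ g x := by
  have h : g = fun y => ∑ i, g y (b i) • LinearMap.toContinuousLinearMap (b.coord i) := by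
    ext y v
    conv_lhs => rw [← b.sum_repr v, map_sum]
    simp [mul_comm]
  rw [h]
  refine ContMDiffAt.sum fun i _ => ?_
  exact (hg i).smul contMDiffAt_const

variable [T2Space M]

/-- A family of covectors is smooth if its pairings with smooth vector fields are. -/
lemma contMDiff_covector_of_pairing (σ : ∀ y : M, CotangentSpace E y)
    (hσ : ∀ Y : SmoothVectorField E M,
      ContMDiff 𝓘(ℝ, E) 𝓘(ℝ, ℝ) ∞ (fun y => pairing (σ y) (Y y))) :
    ContMDiff 𝓘(ℝ, E) (𝓘(ℝ, E).prod 𝓘(ℝ, E →L[ℝ] ℝ)) ∞ (fun y =>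
      Bundle.TotalSpace.mk' (E →L[ℝ] ℝ) (E := (CotangentSpace E : M → Type _)) y (σ y)) := by
  intro x
  let e := trivializationAt E (TangentSpace 𝓘(ℝ, E) : M → Type _) x
  have hx : x ∈ e.baseSet := FiberBundle.mem_baseSet_trivializationAt E _ x
  let b := Module.finBasis ℝ E
  obtain ⟨χ, -, hχ⟩ : ∃ χ : SmoothBumpFunction 𝓘(ℝ, E) x, True ∧ tsupport χ ⊆ e.baseSet :=
    (SmoothBumpFunction.nhds_basis_tsupport (I := 𝓘(ℝ, E)) x).mem_iff.1
      (e.open_baseSet.mem_nhds hx)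
  let Y : Fin _ → SmoothVectorField E M := fun i => ⟨fun y => χ y • e.localFrame b i y,
      ContMDiffOn.smul_section_of_tsupport (ψ := χ) χ.contMDiff.contMDiffOn e.open_baseSet hχ
        (e.contMDiffOn_localFrame_baseSet (I := 𝓘(ℝ, E)) ∞ b i)⟩
  refine contMDiffAt_hom_bundle _ |>.2 ⟨contMDiffAt_id, ?_⟩
  refine contMDiffAt_clm_of_basis b fun i => ?_
  refine (hσ (Y i) x).congr_of_eventuallyEq ?_
  filter_upwards [χ.eventuallyEq_one, e.open_baseSet.mem_nhds hx] with y hy hye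
  have hy' : χ y = 1 := hy
  have h1 : Y i y = e.symm y (b i) := by
    change χ y • e.localFrame b i y = _
    rw [hy', one_smul, e.localFrame_apply_of_mem_baseSet b hye]
    simp [Bundle.Trivialization.basisAt]
  rw [h1, ContinuousLinearMap.inCoordinates_eq hye (by trivial)]
  rfl

/-- The cut-off frame coefficients are among the functionals `T`, and near the given point they are
genuine coordinates. -/
lemma Sections.contMDiff_of_dual {F : Type*} [NormedAddCommGroup F] [NormedSpace ℝ F]
    {A : M → Type*} [TopologicalSpace (Bundle.TotalSpace F A)] [∀ x, TopologicalSpace (A x)]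
    [∀ x, AddCommGroup (A x)] [∀ x, Module ℝ (A x)] [FiberBundle F A] [VectorBundle ℝ F A]
    [FiniteDimensional ℝ F] [ContMDiffVectorBundle ∞ F A 𝓘(ℝ, E)] (s : ∀ y, A y)
    (hs : ∀ T : Sections E F A →ₗ[SmoothFun E M] SmoothFun E M, ContMDiff 𝓘(ℝ, E) 𝓘(ℝ, ℝ) ∞
      (fun y => T (Sections.extension E F A y (s y)) y)) :
    ContMDiff 𝓘(ℝ, E) (𝓘(ℝ, E).prod 𝓘(ℝ, F)) ∞ (fun y => Bundle.TotalSpace.mk' F y (s y)) := by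
  intro x
  obtain ⟨n, χ, t, c, cx, -, -, hc, hsm⟩ :=
    Sections.exists_cutoff_frame (E := E) (F := F) (A := A) x
  refine hsm s fun i => ?_
  refine (hs (c i)).congr fun y => ?_
  rw [hc, Sections.extension_apply]

lemma Sections.dual_congr {F : Type*} [NormedAddCommGroup F] [NormedSpace ℝ F]
    {A : M → Type*} [TopologicalSpace (Bundle.TotalSpace F A)] [∀ x, TopologicalSpace (A x)]
    [∀ x, AddCommGroup (A x)] [∀ x, Module ℝ (A x)] [FiberBundle F A] [VectorBundle ℝ F A]
    [FiniteDimensional ℝ F] [ContMDiffVectorBundle ∞ F A 𝓘(ℝ, E)]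
    (T : Sections E F A →ₗ[SmoothFun E M] SmoothFun E M)
    {x : M} {s t : Sections E F A} (hst : s x = t x) : T s x = T t x := by
  have h := Sections.linearMap_apply_eq_zero T (x := x) (s := s - t)
    (by change s x - t x = 0; rw [hst, sub_self])
  rw [map_sub] at h
  exact sub_eq_zero.1 h

lemma covector_ext {x : M} {α β : CotangentSpace E x}
    (h : ∀ Y : SmoothVectorField E M, pairing α (Y x) = pairing β (Y x)) : α = β := by
  refine ContinuousLinearMap.ext fun v => ?_
  have := h (Sections.extension E E (TangentSpace 𝓘(ℝ, E) : M → Type _) x v)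
  rwa [Sections.extension_apply] at this

/-- A smooth 1-form as a function-linear functional on vector fields. -/
def OneForm.toDualAux :
    OneForm E M →ₗ[SmoothFun E M] Module.Dual (SmoothFun E M) (SmoothVectorField E M) where
  toFun α :=
    { toFun := fun Y => ⟨fun x => pairing (α x) (Y x), by
        have h := ContMDiff.clm_bundle_apply (n := ∞) (IM := 𝓘(ℝ, E)) (IB := 𝓘(ℝ, E))
          (F₁ := E) (F₂ := ℝ) (E₁ := (TangentSpace 𝓘(ℝ, E) : M → Type _))
          (E₂ := Bundle.Trivial M ℝ) (b := fun x => x) α.contMDiff Y.contMDiff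
        intro x
        exact ((Bundle.contMDiffAt_section (E := Bundle.Trivial M ℝ) _).1 (h x))⟩
      map_add' := fun Y Z => by ext x; exact map_add (α x) (Y x) (Z x)
      map_smul' := fun f Y => by ext x; exact map_smul (α x) (f x) (Y x) }
  map_add' _ _ := rfl
  map_smul' _ _ := rfl

/-- Smooth 1-forms are the function-linear functionals on vector fields. -/
def OneForm.toDual :
    OneForm E M ≃ₗ[SmoothFun E M] Module.Dual (SmoothFun E M) (SmoothVectorField E M) :=
  LinearEquiv.ofBijective OneForm.toDualAux (by
    constructor
    · intro α β h
      exact ContMDiffSection.ext fun x => covector_ext fun Y =>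
        DFunLike.congr_fun (DFunLike.congr_fun h Y) x
    · intro T
      let σ : ∀ x : M, CotangentSpace E x := fun x =>
        let ℓ : E →ₗ[ℝ] ℝ := SmoothFun.evalAt x ∘ₗ T.restrictScalars ℝ ∘ₗ
          Sections.extension E E (TangentSpace 𝓘(ℝ, E) : M → Type _) x
        let ℓ' : E →L[ℝ] ℝ := LinearMap.toContinuousLinearMap ℓ
        ℓ'
      have hσ : ∀ (Y : SmoothVectorField E M) (x : M), pairing (σ x) (Y x) = T Y x := fun Y x =>
        Sections.dual_congr T (Sections.extension_apply x (Y x))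
      refine ⟨⟨σ, contMDiff_covector_of_pairing σ fun Y => ?_⟩, ?_⟩
      · simpa only [hσ] using (T Y).contMDiff
      · ext Y x
        exact hσ Y x)

@[simp] lemma OneForm.toDual_apply (α : OneForm E M) (Y : SmoothVectorField E M) (x : M) :
    OneForm.toDual α Y x = pairing (α x) (Y x) := rfl

@[simp] lemma OneForm.pairing_toDual_symm
    (T : Module.Dual (SmoothFun E M) (SmoothVectorField E M)) (Y : SmoothVectorField E M) (x : M) :
    pairing (OneForm.toDual.symm T x) (Y x) = T Y x := by
  rw [← OneForm.toDual_apply, LinearEquiv.apply_symm_apply]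

/-- A family of tangent vectors is smooth if its pairings with smooth 1-forms are. -/
lemma contMDiff_vector_of_pairing (V : ∀ y : M, TangentSpace 𝓘(ℝ, E) y)
    (hV : ∀ α : OneForm E M,
      ContMDiff 𝓘(ℝ, E) 𝓘(ℝ, ℝ) ∞ (fun y => pairing (α y) (V y))) :
    ContMDiff 𝓘(ℝ, E) (𝓘(ℝ, E).prod 𝓘(ℝ, E)) ∞ (fun y =>
      Bundle.TotalSpace.mk' E (E := (TangentSpace 𝓘(ℝ, E) : M → Type _)) y (V y)) := by
  refine Sections.contMDiff_of_dual V fun T => (hV (OneForm.toDual.symm T)).congr fun y => ?_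
  rw [← OneForm.pairing_toDual_symm, Sections.extension_apply]

/-- The differential of a smooth function. -/
def SmoothFun.differential (f : SmoothFun E M) : OneForm E M :=
  OneForm.toDual.symm (exactForm (SmoothVectorField E M) f)

@[simp] lemma SmoothFun.differential_apply (f : SmoothFun E M) (x : M) :
    f.differential x = covectorOf E f x :=
  covector_ext fun Y => by
    rw [SmoothFun.differential, OneForm.pairing_toDual_symm]
    rfl

lemma SmoothFun.toDual_differential (f : SmoothFun E M) :
    OneForm.toDual f.differential = exactForm (SmoothVectorField E M) f :=
  LinearEquiv.apply_symm_apply _ _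

/-- Every covector is the differential of a smooth function. -/
lemma exists_covectorOf_eq {x : M} (α : CotangentSpace E x) :
    ∃ f : SmoothFun E M, covectorOf E f x = α := by
  let χ : SmoothBumpFunction 𝓘(ℝ, E) x := Classical.arbitrary _
  obtain ⟨φ, hφ⟩ := isInvertible_mfderiv_extChartAt (I := 𝓘(ℝ, E))
    (mem_extChartAt_source (I := 𝓘(ℝ, E)) x)
  let ψ : E →L[ℝ] TangentSpace 𝓘(ℝ, E) x := φ.symm.toContinuousLinearMap
  -- The function sought is linear in the chart, with slope `α` transported by the inverse of the
  -- derivative of the chart, and cut off by the bump function.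
  let ℓ : E →L[ℝ] ℝ := α.comp ψ
  have hext : ContMDiffOn 𝓘(ℝ, E) 𝓘(ℝ, E) ∞ (extChartAt 𝓘(ℝ, E) x) (chartAt E x).source :=
    contMDiffOn_extChartAt
  let f : SmoothFun E M := ⟨fun y => χ y • ℓ (extChartAt 𝓘(ℝ, E) x y),
    χ.contMDiff_smul (ℓ.contMDiff.comp_contMDiffOn hext)⟩
  refine ⟨f, ?_⟩
  have h1 : (f : M → ℝ) =ᶠ[𝓝 x] ℓ ∘ extChartAt 𝓘(ℝ, E) x := by
    filter_upwards [χ.eventuallyEq_one] with y hy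
    have hy' : χ y = 1 := hy
    change χ y • ℓ _ = _
    rw [hy', one_smul]
    rfl
  have h2 : MDifferentiableAt 𝓘(ℝ, E) 𝓘(ℝ, E) (extChartAt 𝓘(ℝ, E) x) x :=
    mdifferentiableAt_extChartAt (mem_chart_source E x)
  have h3 : mfderiv 𝓘(ℝ, E) 𝓘(ℝ, ℝ) (ℓ ∘ extChartAt 𝓘(ℝ, E) x) x =
      ℓ.comp (mfderiv 𝓘(ℝ, E) 𝓘(ℝ, E) (extChartAt 𝓘(ℝ, E) x) x) := by
    rw [mfderiv_comp x ℓ.mdifferentiableAt h2, ℓ.mfderiv_eq]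
    rfl
  rw [covectorOf, h1.mfderiv_eq, h3, ← hφ]
  refine ContinuousLinearMap.ext fun v => ?_
  exact congrArg α (φ.symm_apply_apply v)

lemma tangent_eq_zero {x : M} {v : TangentSpace 𝓘(ℝ, E) x}
    (h : ∀ f : SmoothFun E M, dirDeriv v f = 0) : v = 0 := by
  have h2 : ∀ g : E →L[ℝ] ℝ, g v = 0 := fun g => by
    obtain ⟨f, hf⟩ := exists_covectorOf_eq (E := E) (M := M) (x := x) g
    rw [← h f, dirDeriv, hf]
    rfl
  have h3 : ∀ w : E, (∀ g : E →L[ℝ] ℝ, g w = 0) → w = 0 := fun w hw => by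
    by_contra hw'
    obtain ⟨g, hg⟩ := SeparatingDual.exists_ne_zero (R := ℝ) hw'
    exact hg (hw g)
  exact h3 v h2

/-- Functionals on 1-forms act pointwise, and at each point every covector is some `df`; separation
of tangent vectors by functions gives faithfulness. -/
lemma hasEnoughFunctions_smoothVectorField :
    HasEnoughFunctions (SmoothFun E M) (SmoothVectorField E M) where
  dual T hT := by
    ext φ x
    obtain ⟨α, rfl⟩ := OneForm.toDual.surjective φ
    obtain ⟨f, hf⟩ := exists_covectorOf_eq (α x)
    have h := Sections.dual_congr (T ∘ₗ OneForm.toDual.toLinearMap) (x := x) (s := α)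
      (t := f.differential) (by rw [SmoothFun.differential_apply, hf])
    have h2 : T (OneForm.toDual α) x = T (OneForm.toDual f.differential) x := h
    rw [h2, SmoothFun.toDual_differential, hT]
    rfl
  faithful X hX := by
    ext x
    exact tangent_eq_zero fun f => DFunLike.congr_fun (hX f) x

end Cotangent

/-! ### Quadratic Lie algebras -/

section Quadratic

open scoped TensorProduct

variable {𝔤 : Type*} [LieRing 𝔤] [LieAlgebra ℝ 𝔤] [FiniteDimensional ℝ 𝔤]
  {B : LinearMap.BilinForm ℝ 𝔤}
  {ι : Type*} [Fintype ι] [DecidableEq ι] {e e' : Module.Basis ι ℝ 𝔤}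


lemma sum_smul_of_dual_left
    (he : ∀ i j, B (e i) (e' j) = if i = j then 1 else 0) (ξ : 𝔤) :
    ∑ i, B ξ (e' i) • e i = ξ := by
  conv_rhs => rw [← e.sum_repr ξ]
  refine Finset.sum_congr rfl fun i _ => ?_
  congr 1
  conv_lhs => rw [← e.sum_repr ξ]
  simp only [map_sum, LinearMap.sum_apply, map_smul, LinearMap.smul_apply, he]
  simp

lemma sum_smul_of_dual_right
    (he : ∀ i j, B (e i) (e' j) = if i = j then 1 else 0) (ξ : 𝔤) :
    ∑ i, B (e i) ξ • e' i = ξ := by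
  conv_rhs => rw [← e'.sum_repr ξ]
  refine Finset.sum_congr rfl fun i _ => ?_
  congr 1
  conv_lhs => rw [← e'.sum_repr ξ]
  simp only [map_sum, map_smul, he]
  simp

/-- In the bases, symmetry of the tensor is symmetry of the Gram matrix of `e'`, and its invariance
is the ad-invariance of `B`. -/
lemma IsQuadratic.isInvariantSymmetric (hB : IsQuadratic B)
    (he : ∀ i j, B (e i) (e' j) = if i = j then 1 else 0) :
    IsInvariantSymmetric (⇑e) (⇑e') where
  symm := by
    have h : ∀ i, e' i = ∑ j, B (e' i) (e' j) • e j := fun i => (sum_smul_of_dual_left he (e' i)).symm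
    calc ∑ i, e i ⊗ₜ[ℝ] e' i = ∑ i, ∑ j, B (e' i) (e' j) • (e i ⊗ₜ[ℝ] e j) := by
          refine Finset.sum_congr rfl fun i _ => ?_
          conv_lhs => rw [h i]
          rw [TensorProduct.tmul_sum]
          simp [TensorProduct.tmul_smul]
      _ = ∑ i, ∑ j, B (e' i) (e' j) • (e j ⊗ₜ[ℝ] e i) := by
          rw [Finset.sum_comm]
          simp only [hB.symm]
      _ = ∑ i, e' i ⊗ₜ[ℝ] e i := by
          refine Finset.sum_congr rfl fun i _ => ?_
          conv_rhs => rw [h i]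
          rw [TensorProduct.sum_tmul]
          simp [TensorProduct.smul_tmul']
  invariant ξ := by
    have h1 : ∑ i, ⁅ξ, e i⁆ ⊗ₜ[ℝ] e' i = ∑ i, ∑ j, B ⁅ξ, e i⁆ (e' j) • (e j ⊗ₜ[ℝ] e' i) := by
      refine Finset.sum_congr rfl fun i _ => ?_
      conv_lhs => rw [← sum_smul_of_dual_left he ⁅ξ, e i⁆]
      rw [TensorProduct.sum_tmul]
      simp [TensorProduct.smul_tmul']
    have h2 : ∑ i, e i ⊗ₜ[ℝ] ⁅ξ, e' i⁆ = ∑ j, ∑ i, B (e i) ⁅ξ, e' j⁆ • (e j ⊗ₜ[ℝ] e' i) := by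
      refine Finset.sum_congr rfl fun i _ => ?_
      conv_lhs => rw [← sum_smul_of_dual_right he ⁅ξ, e' i⁆]
      rw [TensorProduct.tmul_sum]
      simp [TensorProduct.tmul_smul]
    rw [Finset.sum_add_distrib, h1, h2, Finset.sum_comm, ← Finset.sum_add_distrib]
    refine Finset.sum_eq_zero fun j _ => ?_
    rw [← Finset.sum_add_distrib]
    refine Finset.sum_eq_zero fun i _ => ?_
    rw [← add_smul, ← lie_skew, map_neg, LinearMap.neg_apply, hB.invariant, neg_add_cancel,
      zero_smul]

lemma sharp_eq_sum (hB : IsQuadratic B)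
    (he : ∀ i j, B (e i) (e' j) = if i = j then 1 else 0)
    (p : Module.Dual ℝ 𝔤) : sharp B hB p = ∑ i, p (e' i) • e i := by
  have h : ∀ ξ, B (sharp B hB p) ξ = p ξ := fun ξ =>
    LinearMap.BilinForm.apply_toDual_symm_apply (hB := hB.nondegenerate) p ξ
  conv_lhs => rw [← sum_smul_of_dual_left he (sharp B hB p)]
  simp only [h]

lemma cartanTrivector_eq_cartanSum (hB : IsQuadratic B)
    (he : ∀ i j, B (e i) (e' j) = if i = j then 1 else 0)
    (p q r : Module.Dual ℝ 𝔤) :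
    cartanTrivector B hB p q r = (1 / 2 : ℝ) * cartanSum e e' p q r := by
  rw [cartanTrivector, sharp_eq_sum hB he, sharp_eq_sum hB he]
  congr 1
  simp only [sum_lie_sum, smul_lie, lie_smul, map_sum, map_smul, cartanSum, smul_eq_mul]
  rw [Finset.sum_comm]
  exact Finset.sum_congr rfl fun i _ => Finset.sum_congr rfl fun j _ => by ring

end Quadratic

/-! ### Multivector fields evaluated on smooth functions -/

section OnSmooth

variable {E : Type*} [NormedAddCommGroup E] [NormedSpace ℝ E] [FiniteDimensional ℝ E]
  {M : Type*} [TopologicalSpace M] [ChartedSpace E M] [IsManifold 𝓘(ℝ, E) ∞ M] [T2Space M]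

namespace MultivectorField

/-- The smooth function `P(df₁, …, df_k)`. -/
def onSmooth {k : ℕ} (P : MultivectorField E M k) (f : Fin k → SmoothFun E M) : SmoothFun E M :=
  P.toAlternating fun i => (f i).differential

lemma onFun_coe {k : ℕ} (P : MultivectorField E M k) (f : Fin k → SmoothFun E M) :
    P.onFun (fun i => f i) = P.onSmooth f := by
  ext x
  simp [onFun, onSmooth]

/-- The bracket `{f, g} = π(df, dg)` of smooth functions. -/
def poisson (π : MultivectorField E M 2) (f g : SmoothFun E M) : SmoothFun E M :=
  π.onSmooth ![f, g]

lemma onFun_coe_pair (π : MultivectorField E M 2) (f g : SmoothFun E M) :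
    π.onFun ![f, g] = π.poisson f g := by
  rw [poisson, ← onFun_coe]
  congr 1
  ext i : 1
  fin_cases i <;> rfl

end MultivectorField

lemma SmoothFun.coe_update {k : ℕ} (f : Fin k → SmoothFun E M) (i : Fin k) (g : SmoothFun E M) :
    Function.update (fun l => (f l : M → ℝ)) i g = fun l => ⇑(Function.update f i g l) := by
  ext l : 1
  rcases eq_or_ne l i with rfl | h <;> simp [*]

lemma SmoothFun.coe_removeNth {k : ℕ} (f : Fin (k + 1) → SmoothFun E M) (i : Fin (k + 1)) :
    i.removeNth (fun l => (f l : M → ℝ)) = fun l => ⇑(i.removeNth f l) := rfl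

/-- `[X, P]` on smooth functions. -/
def lieMultivector (X : SmoothVectorField E M) {k : ℕ} (P : MultivectorField E M k)
    (f : Fin k → SmoothFun E M) : SmoothFun E M :=
  ⁅X, P.onSmooth f⁆ - ∑ i, P.onSmooth (Function.update f i ⁅X, f i⁆)

lemma schoutenVector_coe (X : SmoothVectorField E M) {k : ℕ} (P : MultivectorField E M k)
    (f : Fin k → SmoothFun E M) : schoutenVector X P (fun i => f i) = lieMultivector X P f := by
  ext x
  have h : ∀ i, P.onFun (Function.update (fun i => (f i : M → ℝ)) i
      (fun y => dirDeriv (X y) (f i))) x = P.onSmooth (Function.update f i ⁅X, f i⁆) x := by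
    intro i
    rw [← P.onFun_coe, ← SmoothFun.coe_update]
    rfl
  simp only [schoutenVector, h, P.onFun_coe, lieMultivector, ContMDiffMap.coe_sub, Pi.sub_apply,
    SmoothFun.sum_apply, SmoothVectorField.lie_fun_apply]

/-- `[π, P]` on smooth functions. -/
def poissonDifferential (π : MultivectorField E M 2) {k : ℕ} (P : MultivectorField E M k)
    (f : Fin (k + 1) → SmoothFun E M) : SmoothFun E M :=
  (∑ i : Fin (k + 1), (-1 : ℝ) ^ (i : ℕ) • π.poisson (f i) (P.onSmooth (i.removeNth f)))
  + ∑ j : Fin (k + 1), ∑ i ∈ Finset.Iio j, (-1 : ℝ) ^ (j : ℕ) •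
      P.onSmooth (j.removeNth (Function.update f i (π.poisson (f i) (f j))))

lemma schoutenBivector_coe (π : MultivectorField E M 2) {k : ℕ} (P : MultivectorField E M k)
    (f : Fin (k + 1) → SmoothFun E M) :
    schoutenBivector π P (fun i => f i) = poissonDifferential π P f := by
  ext x
  simp only [schoutenBivector, SmoothFun.coe_removeNth, P.onFun_coe, π.onFun_coe_pair,
    SmoothFun.coe_update, poissonDifferential, ContMDiffMap.coe_add, Pi.add_apply,
    SmoothFun.sum_apply, ContMDiffMap.coe_smul, Pi.smul_apply, smul_eq_mul]

lemma wedgeVector_coe (V : SmoothVectorField E M) {k : ℕ} {D : (Fin k → M → ℝ) → M → ℝ}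
    {D' : (Fin k → SmoothFun E M) → SmoothFun E M} (hD : ∀ f, D (fun i => f i) = D' f)
    (f : Fin (k + 1) → SmoothFun E M) :
    wedgeVector V D (fun i => f i)
      = (∑ j : Fin (k + 1), (-1 : ℝ) ^ (j : ℕ) • (⁅V, f j⁆ * D' (j.removeNth f)) :
        SmoothFun E M) := by
  ext x
  simp only [wedgeVector, SmoothFun.coe_removeNth, hD, SmoothFun.sum_apply, ContMDiffMap.coe_smul,
    Pi.smul_apply, smul_eq_mul, ContMDiffMap.coe_mul, Pi.mul_apply,
    SmoothVectorField.lie_fun_apply, mul_assoc]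

end OnSmooth

/-! ### The anchor of a quasi-Poisson manifold -/

section Reflexive

open Module

variable {E : Type*} [NormedAddCommGroup E] [NormedSpace ℝ E] [FiniteDimensional ℝ E]
  {M : Type*} [TopologicalSpace M] [ChartedSpace E M] [IsManifold 𝓘(ℝ, E) ∞ M] [T2Space M]

lemma SmoothVectorField.ext_of_dual {X Y : SmoothVectorField E M}
    (h : ∀ φ : Dual (SmoothFun E M) (SmoothVectorField E M), φ X = φ Y) : X = Y :=
  hasEnoughFunctions_smoothVectorField.ext fun f => h (exactForm _ f)

/-- A linear functional on a cotangent space is given by a tangent vector. -/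
lemma exists_pairing_eq {x : M} (Φ : CotangentSpace E x →ₗ[ℝ] ℝ) :
    ∃ v : TangentSpace 𝓘(ℝ, E) x, ∀ α : CotangentSpace E x, pairing α v = Φ α := by
  have key : ∀ Φ : (E →L[ℝ] ℝ) →ₗ[ℝ] ℝ, ∃ v : E, ∀ α : E →L[ℝ] ℝ, α v = Φ α := by
    intro Φ
    let b := Module.finBasis ℝ E
    refine ⟨∑ i, Φ (LinearMap.toContinuousLinearMap (b.coord i)) • b i, fun α => ?_⟩
    have h : α = ∑ i, α (b i) • LinearMap.toContinuousLinearMap (b.coord i) := by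
      ext v
      conv_lhs => rw [← b.sum_repr v, map_sum]
      simp [mul_comm]
    conv_rhs => rw [h, map_sum]
    rw [map_sum]
    simp [mul_comm]
  exact key Φ

/-- Reflexivity: a functional on 1-forms acts fibrewise, is represented by a tangent vector at each
point, and these vectors vary smoothly because their pairings with 1-forms do. -/
lemma SmoothVectorField.exists_dual_eq (T : Dual (SmoothFun E M) (OneForm E M)) :
    ∃ X : SmoothVectorField E M, ∀ α : OneForm E M, OneForm.toDual α X = T α := by
  choose V hV using fun x : M => exists_pairing_eq (SmoothFun.evalAt x ∘ₗ T.restrictScalars ℝ ∘ₗ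
    Sections.extension E (E →L[ℝ] ℝ) (CotangentSpace E : M → Type _) x)
  have hV' : ∀ (α : OneForm E M) x, pairing (α x) (V x) = T α x := fun α x =>
    (hV x (α x)).trans (Sections.dual_congr T (Sections.extension_apply x (α x)))
  refine ⟨⟨V, contMDiff_vector_of_pairing V fun α => ?_⟩, fun α => ?_⟩
  · simpa only [hV'] using (T α).contMDiff
  · ext x
    exact hV' α x

/-- The vector field with prescribed pairings with 1-forms. -/
def SmoothVectorField.ofDual :
    Dual (SmoothFun E M) (OneForm E M) →ₗ[SmoothFun E M] SmoothVectorField E M :=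
  have h := SmoothVectorField.exists_dual_eq (E := E) (M := M)
  { toFun := fun T => (h T).choose
    map_add' := fun S T => SmoothVectorField.ext_of_dual fun φ => by
      obtain ⟨α, rfl⟩ := OneForm.toDual.surjective φ
      rw [map_add, (h _).choose_spec, (h _).choose_spec, (h _).choose_spec, LinearMap.add_apply]
    map_smul' := fun f T => SmoothVectorField.ext_of_dual fun φ => by
      obtain ⟨α, rfl⟩ := OneForm.toDual.surjective φ
      rw [map_smul, (h _).choose_spec, (h _).choose_spec, LinearMap.smul_apply,
        RingHom.id_apply] }

@[simp] lemma SmoothVectorField.toDual_ofDual (T : Dual (SmoothFun E M) (OneForm E M))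
    (α : OneForm E M) : OneForm.toDual α (SmoothVectorField.ofDual T) = T α :=
  (SmoothVectorField.exists_dual_eq T).choose_spec α

lemma SmoothVectorField.dual_ofDual (T : Dual (SmoothFun E M) (OneForm E M))
    (φ : Dual (SmoothFun E M) (SmoothVectorField E M)) :
    φ (SmoothVectorField.ofDual T) = T (OneForm.toDual.symm φ) := by
  rw [← SmoothVectorField.toDual_ofDual, LinearEquiv.apply_symm_apply]

end Reflexive

/-! ### The map `π♯` and the quasi-Poisson anchor -/

section Anchor

open Module

variable {E : Type*} [NormedAddCommGroup E] [NormedSpace ℝ E] [FiniteDimensional ℝ E]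
  {M : Type*} [TopologicalSpace M] [ChartedSpace E M] [IsManifold 𝓘(ℝ, E) ∞ M] [T2Space M]

lemma update_one_vecCons {α : Type*} (a b c : α) : Function.update ![a, b] 1 c = ![a, c] := by
  ext i
  fin_cases i <;> rfl

/-- The bundle map `π♯` on sections, `β(π♯α) = π(α, β)`. -/
def MultivectorField.sharp (π : MultivectorField E M 2) :
    Dual (SmoothFun E M) (SmoothVectorField E M) →ₗ[SmoothFun E M] SmoothVectorField E M :=
  SmoothVectorField.ofDual ∘ₗ (LinearMap.mk₂ (SmoothFun E M)
    (fun α β => π.toAlternating ![α, β])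
    (fun α α' β => π.toAlternating.map_vecCons_add ![β] α α')
    (fun f α β => π.toAlternating.map_vecCons_smul ![β] f α)
    (fun α β β' => by
      simpa only [update_one_vecCons] using π.toAlternating.map_update_add ![α, β] 1 β β')
    (fun f α β => by
      simpa only [update_one_vecCons] using π.toAlternating.map_update_smul ![α, β] 1 f β)) ∘ₗ OneForm.toDual.symm.toLinearMap

lemma MultivectorField.dual_sharp (π : MultivectorField E M 2)
    (φ ψ : Dual (SmoothFun E M) (SmoothVectorField E M)) : ψ (π.sharp φ)
      = π.toAlternating ![OneForm.toDual.symm φ, OneForm.toDual.symm ψ] := by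
  rw [MultivectorField.sharp, LinearMap.comp_apply, SmoothVectorField.dual_ofDual]
  rfl

lemma MultivectorField.dual_sharp_swap (π : MultivectorField E M 2)
    (φ ψ : Dual (SmoothFun E M) (SmoothVectorField E M)) : φ (π.sharp ψ) = - ψ (π.sharp φ) := by
  rw [π.dual_sharp, π.dual_sharp]
  have h := π.toAlternating.map_swap ![OneForm.toDual.symm φ, OneForm.toDual.symm ψ]
    (i := 0) (j := 1) (by decide)
  rw [← h]
  congr 1
  ext i : 1
  fin_cases i <;> rfl

lemma MultivectorField.sharp_exactForm_lie (π : MultivectorField E M 2) (f g : SmoothFun E M) :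
    ⁅π.sharp (exactForm _ f), g⁆ = π.poisson f g := by
  refine (π.dual_sharp (exactForm _ f) (exactForm _ g)).trans ?_
  rw [poisson, onSmooth]
  congr 1
  ext i : 1
  fin_cases i <;> rfl

lemma MultivectorField.poisson_swap (π : MultivectorField E M 2) (f g : SmoothFun E M) :
    π.poisson f g = - π.poisson g f := by
  rw [← π.sharp_exactForm_lie, ← π.sharp_exactForm_lie]
  exact π.dual_sharp_swap (exactForm _ g) (exactForm _ f)

variable {𝔤 ι : Type*} [Fintype ι]

/-- The anchor `π♯α + ½ ∑ᵢ α(ρ(eⁱ)) ρ(eᵢ)`. -/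
def quasiAnchor (e e' : ι → 𝔤) (ρ : 𝔤 → SmoothVectorField E M) (π : MultivectorField E M 2) :
    Dual (SmoothFun E M) (SmoothVectorField E M) →ₗ[SmoothFun E M] SmoothVectorField E M :=
  π.sharp + algebraMap ℝ (SmoothFun E M) (1 / 2) •
    ∑ i, (LinearMap.applyₗ (ρ (e' i))).smulRight (ρ (e i))

variable {e e' : ι → 𝔤}

lemma dual_quasiAnchor (ρ : 𝔤 → SmoothVectorField E M) (π : MultivectorField E M 2)
    (φ ψ : Dual (SmoothFun E M) (SmoothVectorField E M)) : ψ (quasiAnchor e e' ρ π φ)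
      = ψ (π.sharp φ) + (1 / 2 : ℝ) • ∑ i, φ (ρ (e' i)) * ψ (ρ (e i)) := by
  simp [quasiAnchor, Algebra.smul_def]

variable [LieRing 𝔤] [LieAlgebra ℝ 𝔤] {ρ : 𝔤 →ₗ⁅ℝ⁆ SmoothVectorField E M}
  {π : MultivectorField E M 2}

/-- The `π♯` terms cancel by skewness and the two halves of the Casimir term add up by symmetry. -/
lemma isIsotropic_quasiAnchor (hC : IsInvariantSymmetric e e') :
    IsIsotropic (quasiAnchor e e' ρ π) ρ e e' := by
  intro α β
  have h := hC.sum_mul_swap (comoment ρ α) (comoment ρ β)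
  have h2 : ∑ i, β (ρ (e' i)) * α (ρ (e i)) = ∑ i, α (ρ (e i)) * β (ρ (e' i)) :=
    Finset.sum_congr rfl fun i _ => mul_comm _ _
  have h3 : ∑ i, α (ρ (e i)) * β (ρ (e' i)) = ∑ i, α (ρ (e' i)) * β (ρ (e i)) := h
  rw [dual_quasiAnchor, dual_quasiAnchor, π.dual_sharp_swap, h2, ← h3]
  module

lemma quasiAnchor_exactForm_lie (f g : SmoothFun E M) :
    ⁅quasiAnchor e e' ρ π (exactForm _ f), g⁆
      = π.poisson f g + (1 / 2 : ℝ) • ∑ i, ⁅ρ (e' i), f⁆ * ⁅ρ (e i), g⁆ := by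
  rw [← π.sharp_exactForm_lie]
  exact dual_quasiAnchor ρ π (exactForm _ f) (exactForm _ g)

lemma hamiltonianField_quasiAnchor_lie (hC : IsInvariantSymmetric e e') (f g : SmoothFun E M) :
    ⁅hamiltonianField (quasiAnchor e e' ρ π) ρ e e' f, g⁆ = π.poisson f g := by
  have h : ∑ i, ⁅ρ (e i), f⁆ * ⁅ρ (e' i), g⁆ = ∑ i, ⁅ρ (e' i), f⁆ * ⁅ρ (e i), g⁆ :=
    hC.sum_mul_swap (comoment ρ (exactForm _ f)) (comoment ρ (exactForm _ g))
  rw [hamiltonianField_lie, quasiAnchor_exactForm_lie, casimirField_lie, h, add_sub_cancel_right]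

/-- On exact forms this is the derivation property of the bracket of functions plus invariance of
the Casimir tensor. -/
lemma isEquivariant_quasiAnchor (hC : IsInvariantSymmetric e e')
    (hinv : ∀ (ξ : 𝔤) (f g : SmoothFun E M), ⁅ρ ξ, π.poisson f g⁆
      = π.poisson ⁅ρ ξ, f⁆ g + π.poisson f ⁅ρ ξ, g⁆) :
    IsEquivariant (quasiAnchor e e' ρ π) ρ := by
  refine isEquivariant_of_exactForm hasEnoughFunctions_smoothVectorField fun ξ f g => ?_
  have h : ∑ i, ⁅ρ ⁅ξ, e i⁆, g⁆ * ⁅ρ (e' i), f⁆ + ∑ i, ⁅ρ (e i), g⁆ * ⁅ρ ⁅ξ, e' i⁆, f⁆ = 0 :=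
    hC.sum_lie_mul (comoment ρ (exactForm _ g)) (comoment ρ (exactForm _ f)) ξ
  have h2 : ⁅ρ ξ, ∑ i, ⁅ρ (e' i), f⁆ * ⁅ρ (e i), g⁆⁆ = ∑ i, ⁅ρ (e' i), ⁅ρ ξ, f⁆⁆ * ⁅ρ (e i), g⁆
      + ∑ i, ⁅ρ (e' i), f⁆ * ⁅ρ (e i), ⁅ρ ξ, g⁆⁆ := by
    rw [lie_sum', ← add_zero (_ + _), ← h]
    simp only [← Finset.sum_add_distrib]
    refine Finset.sum_congr rfl fun i _ => ?_
    rw [LieRinehartRing.leibniz_mul_right, LieHom.map_lie, LieHom.map_lie, lie_lie, lie_lie]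
    ring
  rw [quasiAnchor_exactForm_lie, quasiAnchor_exactForm_lie, quasiAnchor_exactForm_lie, lie_add,
    lie_smul (1 / 2 : ℝ), hinv, h2]
  module

end Anchor

/-! ### Consequences of the quasi-Poisson axioms -/

section QuasiPoisson

variable {E : Type*} [NormedAddCommGroup E] [NormedSpace ℝ E] [FiniteDimensional ℝ E]
  {M : Type*} [TopologicalSpace M] [ChartedSpace E M] [IsManifold 𝓘(ℝ, E) ∞ M] [T2Space M]
  {𝔤 : Type*} [LieRing 𝔤] [LieAlgebra ℝ 𝔤] [FiniteDimensional ℝ 𝔤]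
  {B : LinearMap.BilinForm ℝ 𝔤} {hB : IsQuadratic B}
  {ρ : 𝔤 →ₗ[ℝ] SmoothVectorField E M} {π : MultivectorField E M 2}

lemma MultivectorField.onSmooth_two (π : MultivectorField E M 2) (f : Fin 2 → SmoothFun E M) :
    π.onSmooth f = π.poisson (f 0) (f 1) := by
  rw [MultivectorField.poisson]
  congr 1
  ext i : 1
  fin_cases i <;> rfl

/-- The action of a quasi-Poisson manifold as a Lie algebra homomorphism. -/
def IsQuasiPoisson.actionHom (h : IsQuasiPoisson B hB ρ π) : 𝔤 →ₗ⁅ℝ⁆ SmoothVectorField E M :=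
  { ρ with map_lie' := fun {ξ η} => by ext x; exact h.action ξ η x }

lemma IsQuasiPoisson.lie_poisson (h : IsQuasiPoisson B hB ρ π) (ξ : 𝔤) (f g : SmoothFun E M) :
    ⁅ρ ξ, π.poisson f g⁆ = π.poisson ⁅ρ ξ, f⁆ g + π.poisson f ⁅ρ ξ, g⁆ := by
  have h1 : lieMultivector (ρ ξ) π ![f, g] = 0 := by
    ext x
    rw [← schoutenVector_coe]
    exact h.invariant ξ ![f, g] x
  rw [lieMultivector, Fin.sum_univ_two] at h1
  simp only [MultivectorField.onSmooth_two, update_one_vecCons] at h1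
  exact sub_eq_zero.1 h1

/-- Each cyclic term appears twice: once with `π` as the outer bracket and once with the same `π` as
the argument. Hence the factor 2. -/
lemma poissonDifferential_self (π : MultivectorField E M 2) (f g h : SmoothFun E M) :
    poissonDifferential π π ![f, g, h] = (2 : ℝ) • (π.poisson f (π.poisson g h)
      + π.poisson g (π.poisson h f) + π.poisson h (π.poisson f g)) := by
  have h0 : Finset.Iio (0 : Fin 3) = ∅ := rfl
  have h1 : Finset.Iio (1 : Fin 3) = {0} := rfl
  have h2 : Finset.Iio (2 : Fin 3) = {0, 1} := rfl
  rw [poissonDifferential, Fin.sum_univ_three, Fin.sum_univ_three, h0, h1, h2,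
    Finset.sum_pair (by decide), Finset.sum_singleton, Finset.sum_empty]
  simp only [MultivectorField.onSmooth_two]
  have key : ∀ p q : SmoothFun E M, π.poisson p q = - π.poisson q p := π.poisson_swap
  have hneg : ∀ p q : SmoothFun E M, π.poisson p (-q) = - π.poisson p q := fun p q => by
    rw [← π.sharp_exactForm_lie, ← π.sharp_exactForm_lie, lie_neg]
  change (-1 : ℝ) ^ 0 • π.poisson f (π.poisson g h) + (-1 : ℝ) ^ 1 • π.poisson g (π.poisson f h)
    + (-1 : ℝ) ^ 2 • π.poisson h (π.poisson f g) + (0 + (-1 : ℝ) ^ 1 • π.poisson (π.poisson f g) h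
      + ((-1 : ℝ) ^ 2 • π.poisson (π.poisson f h) g
        + (-1 : ℝ) ^ 2 • π.poisson f (π.poisson g h))) = _
  rw [key (π.poisson f g) h, key (π.poisson f h) g, key f h, hneg]
  module

/-- Twice the Jacobiator is `[π, π] = ρ(φ)`, and `φ` is half of the Cartan sum, hence the quarter.
-/
lemma IsQuasiPoisson.jacobi {ι : Type*} [Fintype ι] [DecidableEq ι]
    (hqP : IsQuasiPoisson B hB ρ π) {e e' : Module.Basis ι ℝ 𝔤}
    (he : ∀ i j, B (e i) (e' j) = if i = j then 1 else 0) (f g h : SmoothFun E M) :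
    π.poisson f (π.poisson g h) + π.poisson g (π.poisson h f) + π.poisson h (π.poisson f g)
      = (1 / 4 : ℝ) • cartanSum e e' (comoment hqP.actionHom (exactForm _ f))
        (comoment hqP.actionHom (exactForm _ g)) (comoment hqP.actionHom (exactForm _ h)) := by
  have h1 : (2 : ℝ) • (π.poisson f (π.poisson g h) + π.poisson g (π.poisson h f)
      + π.poisson h (π.poisson f g)) = (1 / 2 : ℝ) •
        cartanSum e e' (comoment hqP.actionHom (exactForm _ f))
        (comoment hqP.actionHom (exactForm _ g)) (comoment hqP.actionHom (exactForm _ h)) := by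
    rw [← poissonDifferential_self]
    ext x
    rw [← schoutenBivector_coe]
    refine (hqP.bracket_self ![f, g, h] x).trans ?_
    rw [cartanTrivector_eq_cartanSum hB he]
    simp only [cartanSum, ContMDiffMap.coe_smul, Pi.smul_apply, SmoothFun.sum_apply]
    rfl
  have h2 := congrArg (fun u => (1 / 2 : ℝ) • u) h1
  simp only [smul_smul] at h2
  norm_num at h2
  rw [h2]

end QuasiPoisson

/-! ### The Lie algebroid of an anchor and a bracket of 1-forms -/

section FormAlgebroid

open Module

variable {E : Type*} [NormedAddCommGroup E] [NormedSpace ℝ E] [FiniteDimensional ℝ E]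
  {M : Type*} [TopologicalSpace M] [ChartedSpace E M] [IsManifold 𝓘(ℝ, E) ∞ M] [T2Space M]

lemma tangent_ext {x : M} {v w : TangentSpace 𝓘(ℝ, E) x}
    (h : ∀ f : SmoothFun E M, dirDeriv v f = dirDeriv w f) : v = w := by
  refine sub_eq_zero.1 (tangent_eq_zero fun f => ?_)
  have h1 : dirDeriv (v - w) f = dirDeriv v f - dirDeriv w f := map_sub (covectorOf E f x) v w
  rw [h1, h, sub_self]

variable (a : Dual (SmoothFun E M) (SmoothVectorField E M) →ₗ[SmoothFun E M] SmoothVectorField E M)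

/-- The bundle map `T*M → TM` induced by a function-linear map on sections. -/
def anchorAt (x : M) : CotangentSpace E x →ₗ[ℝ] TangentSpace 𝓘(ℝ, E) x :=
  Sections.evalAt x ∘ₗ (a ∘ₗ OneForm.toDual.toLinearMap).restrictScalars ℝ ∘ₗ
    Sections.extension E (E →L[ℝ] ℝ) (CotangentSpace E : M → Type _) x

@[simp] lemma anchorAt_apply (α : OneForm E M) (x : M) :
    anchorAt a x (α x) = a (OneForm.toDual α) x :=
  tangent_ext fun f => Sections.dual_congr
    (exactForm (SmoothVectorField E M) f ∘ₗ a ∘ₗ OneForm.toDual.toLinearMap)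
    (s := Sections.extension E (E →L[ℝ] ℝ) (CotangentSpace E : M → Type _) x (α x)) (t := α)
    (Sections.extension_apply x (α x))

lemma SmoothVectorField.lie_algebraMap (X : SmoothVectorField E M) (c : ℝ) :
    ⁅X, algebraMap ℝ (SmoothFun E M) c⁆ = 0 := by
  have h : ⁅X, (1 : SmoothFun E M)⁆ = 0 := by
    have h1 := X.lie_fun_mul 1 1
    rwa [mul_one, one_mul, mul_one, left_eq_add] at h1
  rw [Algebra.algebraMap_eq_smul_one, lie_smul, h, smul_zero]

variable {a} {𝔤 ι : Type*} [Fintype ι] [LieRing 𝔤] [LieAlgebra ℝ 𝔤]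
  {ρ : 𝔤 →ₗ⁅ℝ⁆ SmoothVectorField E M} {e e' : ι → 𝔤}

/-- The bracket of 1-forms. -/
def oneFormBracket (hC : IsInvariantSymmetric e e') (ha : IsIsotropic a ρ e e') :
    OneForm E M →ₗ[ℝ] OneForm E M →ₗ[ℝ] OneForm E M :=
  LinearMap.mk₂ ℝ
    (fun α β => OneForm.toDual.symm
      (formBracket a ρ e e' (OneForm.toDual α) (OneForm.toDual β)))
    (fun α α' β => by rw [map_add, formBracket_add_left, map_add])
    (fun c α β => by
      rw [← algebraMap_smul (SmoothFun E M) c α, map_smul, formBracket_smul_left hC ha,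
        SmoothVectorField.lie_algebraMap, zero_smul, sub_zero, map_smul]
      rfl)
    (fun α β β' => by rw [map_add, formBracket_add_right, map_add])
    (fun c α β => by
      rw [← algebraMap_smul (SmoothFun E M) c β, map_smul, formBracket_smul_right,
        SmoothVectorField.lie_algebraMap, zero_smul, add_zero, map_smul]
      rfl)

variable (hC : IsInvariantSymmetric e e') (ha : IsIsotropic a ρ e e')

@[simp] lemma toDual_oneFormBracket (α β : OneForm E M) :
    OneForm.toDual (oneFormBracket hC ha α β)
      = formBracket a ρ e e' (OneForm.toDual α) (OneForm.toDual β) :=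
  LinearEquiv.apply_symm_apply _ _

lemma oneFormBracket_smul_right (α β : OneForm E M) (f : SmoothFun E M) :
    oneFormBracket hC ha α (f • β)
      = f • oneFormBracket hC ha α β + ⁅a (OneForm.toDual α), f⁆ • β :=
  OneForm.toDual.injective (by simp [formBracket_smul_right])

lemma oneFormBracket_smul_left (α β : OneForm E M) (f : SmoothFun E M) :
    oneFormBracket hC ha (f • α) β
      = f • oneFormBracket hC ha α β - ⁅a (OneForm.toDual β), f⁆ • α :=
  OneForm.toDual.injective (by simp [formBracket_smul_left hC ha])

lemma oneFormBracket_skew (α β : OneForm E M) :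
    oneFormBracket hC ha α β = - oneFormBracket hC ha β α :=
  OneForm.toDual.injective (by
    rw [map_neg, toDual_oneFormBracket, toDual_oneFormBracket]
    exact formBracket_skew hC ha _ _)

/-- The Lie algebroid structure on the cotangent bundle with given anchor and the bracket of
1-forms. -/
def cotangentAlgebroid (he : IsEquivariant a ρ)
    (hanchor : ∀ α β, a (formBracket a ρ e e' α β) = ⁅a α, a β⁆) :
    LieAlgebroid E (E →L[ℝ] ℝ) (CotangentSpace E : M → Type _) where
  anchor := anchorAt a
  bracket := oneFormBracket hC ha
  anchor_smooth s := by
    simp only [anchorAt_apply]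
    exact (a (OneForm.toDual s)).contMDiff
  bracket_self s := OneForm.toDual.injective (by
    rw [toDual_oneFormBracket, formBracket_self hC ha, map_zero])
  jacobi r s t := OneForm.toDual.injective (by
    simpa only [toDual_oneFormBracket, map_add] using formBracket_jacobi hC ha he hanchor _ _ _)
  leibniz s t ft f hft x := by
    have h : ft = f • t := ContMDiffSection.ext hft
    rw [h, oneFormBracket_smul_right, anchorAt_apply]
    rfl
  anchor_bracket s t x := by
    simp only [anchorAt_apply, toDual_oneFormBracket, hanchor]
    rfl

/-- The anchor on 1-forms with values in derivations. -/
def anchorDerivation (a : Dual (SmoothFun E M) (SmoothVectorField E M) →ₗ[SmoothFun E M]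
    SmoothVectorField E M) :
    OneForm E M →ₗ[SmoothFun E M] Derivation ℝ (SmoothFun E M) (SmoothFun E M) where
  toFun α := Derivation.mk'
    (LieModule.toEnd ℝ (SmoothVectorField E M) (SmoothFun E M) (a (OneForm.toDual α)))
    (fun f g => by
      change ⁅a (OneForm.toDual α), f * g⁆ =
        f • ⁅a (OneForm.toDual α), g⁆ + g • ⁅a (OneForm.toDual α), f⁆
      rw [SmoothVectorField.lie_fun_mul, smul_eq_mul, smul_eq_mul, mul_comm g])
  map_add' α β := by
    ext f : 1
    change ⁅a (OneForm.toDual (α + β)), f⁆ = ⁅a (OneForm.toDual α), f⁆ + ⁅a (OneForm.toDual β), f⁆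
    rw [map_add, map_add, add_lie]
  map_smul' g α := by
    ext f : 1
    change ⁅a (OneForm.toDual (g • α)), f⁆ = g * ⁅a (OneForm.toDual α), f⁆
    rw [map_smul, map_smul, LieRinehartRing.lie_smul_eq_mul]

@[simp] lemma anchorDerivation_apply (α : OneForm E M) (f : SmoothFun E M) :
    anchorDerivation a α f = ⁅a (OneForm.toDual α), f⁆ := rfl

lemma cotangentAlgebroid_differential (he : IsEquivariant a ρ)
    (hanchor : ∀ α β, a (formBracket a ρ e e' α β) = ⁅a α, a β⁆) {k : ℕ}
    (P : MultivectorField E M k) (s : Fin (k + 1) → OneForm E M) (x : M) :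
    (cotangentAlgebroid hC ha he hanchor).differential P.toFun s x
      = bracketDifferential (anchorDerivation a) (oneFormBracket hC ha) P.toAlternating s x := by
  simp only [bracketDifferential, ContMDiffMap.coe_add, Pi.add_apply, SmoothFun.sum_apply,
    ContMDiffMap.coe_smul, Pi.smul_apply, smul_eq_mul, LieAlgebroid.differential,
    cotangentAlgebroid, anchorAt_apply]
  rfl

end FormAlgebroid

/-! ### The differential on multivector fields -/

section Upgrade

variable {A Γ : Type*} [CommRing A] [Algebra ℝ A] [AddCommGroup Γ] [Module A Γ] [Module ℝ Γ]

/-- A real alternating map which is homogeneous over `A` in the first argument is `A`-linear. -/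
def AlternatingMap.ofConsSmul {k : ℕ} (Ψ : Γ [⋀^Fin (k + 1)]→ₗ[ℝ] A)
    (h : ∀ (f : A) (x : Γ) (t : Fin k → Γ), Ψ (Fin.cons (f • x) t) = f * Ψ (Fin.cons x t)) :
    Γ [⋀^Fin (k + 1)]→ₗ[A] A where
  toFun := Ψ
  map_update_add' := Ψ.map_update_add'
  map_update_smul' {inst} s i f x := by
    obtain rfl : inst = instDecidableEqFin (k + 1) := Subsingleton.elim _ _
    -- A transposition brings slot `i` to the front; its sign does not depend on `y`, so homogeneity
    -- carries over from the first slot.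
    have key : ∀ y, Ψ (Function.update s i y) = Equiv.Perm.sign (Equiv.swap 0 i) •
        Ψ (Fin.cons y (Fin.tail (s ∘ Equiv.swap 0 i))) := by
      intro y
      have h1 : (Fin.cons y (Fin.tail (s ∘ Equiv.swap 0 i)) : Fin (k + 1) → Γ)
          = Function.update s i y ∘ Equiv.swap 0 i := by
        rw [Function.update_comp_equiv, Equiv.symm_swap, Equiv.swap_apply_right,
          ← Fin.cons_self_tail (s ∘ Equiv.swap 0 i), Fin.update_cons_zero, Fin.tail_cons]
      rw [h1, Ψ.map_perm, smul_smul, Int.units_mul_self, one_smul]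
    change Ψ _ = f * Ψ _
    rw [key, key, h, mul_smul_comm]
  map_eq_zero_of_eq' := Ψ.map_eq_zero_of_eq'

end Upgrade

/-! ### The algebroid differential on exact forms -/

section Differential

open Module

variable {E : Type*} [NormedAddCommGroup E] [NormedSpace ℝ E] [FiniteDimensional ℝ E]
  {M : Type*} [TopologicalSpace M] [ChartedSpace E M] [IsManifold 𝓘(ℝ, E) ∞ M] [T2Space M]

lemma SmoothFun.differential_add (f g : SmoothFun E M) :
    (f + g).differential = f.differential + g.differential :=
  OneForm.toDual.injective (by
    ext X : 1
    simp only [map_add, SmoothFun.toDual_differential, LinearMap.add_apply]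
    exact lie_add X f g)

lemma SmoothFun.differential_mul (f g : SmoothFun E M) :
    (f * g).differential = f • g.differential + g • f.differential :=
  OneForm.toDual.injective (by
    ext X : 1
    simp only [map_add, map_smul, SmoothFun.toDual_differential, LinearMap.add_apply,
      LinearMap.smul_apply, exactForm_apply, smul_eq_mul]
    rw [X.lie_fun_mul, mul_comm g])

/-- The differential of smooth functions as a linear map. -/
def SmoothFun.differentialLinear : SmoothFun E M →ₗ[ℝ] OneForm E M where
  toFun := SmoothFun.differential
  map_add' := SmoothFun.differential_add
  map_smul' c f := OneForm.toDual.injective (by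
    ext X : 1
    have h : c • f.differential = algebraMap ℝ (SmoothFun E M) c • f.differential := rfl
    rw [RingHom.id_apply, h, map_smul, SmoothFun.toDual_differential,
      SmoothFun.toDual_differential, LinearMap.smul_apply, exactForm_apply, exactForm_apply,
      lie_smul, smul_eq_mul, Algebra.smul_def])

lemma SmoothFun.differential_sum {κ : Type*} (t : Finset κ) (f : κ → SmoothFun E M) :
    (∑ i ∈ t, f i).differential = ∑ i ∈ t, (f i).differential :=
  map_sum SmoothFun.differentialLinear f t

lemma SmoothFun.differential_smul (c : ℝ) (f : SmoothFun E M) :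
    (c • f).differential = c • f.differential :=
  map_smul SmoothFun.differentialLinear c f

variable {𝔤 ι : Type*} [Fintype ι] [LieRing 𝔤] [LieAlgebra ℝ 𝔤]
  {ρ : 𝔤 →ₗ⁅ℝ⁆ SmoothVectorField E M} {e e' : ι → 𝔤} {π : MultivectorField E M 2}

/-- Differentiating the Casimir part of `a(df) g` gives half of each product term. Subtracting the
full correction leaves coefficients `½` and `-½`, an expression antisymmetric in `f` and `g`. -/
lemma oneFormBracket_differential (hC : IsInvariantSymmetric e e') (f g : SmoothFun E M) :
    oneFormBracket hC (isIsotropic_quasiAnchor (ρ := ρ) (π := π) hC) f.differential g.differential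
      = (π.poisson f g).differential
        + ((-(1 / 2 : ℝ)) • ∑ i, ⁅ρ (e' i), g⁆ • (⁅ρ (e i), f⁆ : SmoothFun E M).differential
          - (-(1 / 2 : ℝ)) • ∑ i, ⁅ρ (e' i), f⁆ • (⁅ρ (e i), g⁆ : SmoothFun E M).differential) := by
  have h1 : oneFormBracket hC (isIsotropic_quasiAnchor (ρ := ρ) (π := π) hC) f.differential
      g.differential = (⁅quasiAnchor e e' ρ π (exactForm _ f), g⁆ : SmoothFun E M).differential
        - ∑ i, ⁅ρ (e' i), g⁆ • (⁅ρ (e i), f⁆ : SmoothFun E M).differential :=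
    OneForm.toDual.injective (by
      simp only [toDual_oneFormBracket, map_sub, map_sum, map_smul,
        SmoothFun.toDual_differential, formBracket_exactForm])
  have h2 : ∑ i, ⁅ρ (e i), g⁆ • (⁅ρ (e' i), f⁆ : SmoothFun E M).differential
      = ∑ i, ⁅ρ (e' i), g⁆ • (⁅ρ (e i), f⁆ : SmoothFun E M).differential :=
    OneForm.toDual.injective (by
      ext X : 1
      have h := sum_lie_mul_comm (ρ := ρ) hC X (exactForm _ f) (exactForm _ g)
      simp only [map_sum, map_smul, SmoothFun.toDual_differential, LinearMap.sum_apply,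
        LinearMap.smul_apply, exactForm_apply, smul_eq_mul] at h ⊢
      rw [← h]
      exact Finset.sum_congr rfl fun i _ => mul_comm _ _)
  rw [h1, quasiAnchor_exactForm_lie, SmoothFun.differential_add, SmoothFun.differential_smul,
    SmoothFun.differential_sum]
  simp only [SmoothFun.differential_mul, Finset.sum_add_distrib]
  rw [h2]
  module

/-- The Casimir part of the anchor supplies the derivative term of `[ρ(eᵢ), P]`, and the
antisymmetric part of the bracket supplies the terms where `ρ(eᵢ)` hits an argument. -/
lemma bracketDifferential_differential (hC : IsInvariantSymmetric e e') {k : ℕ}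
    (P : MultivectorField E M k) (f : Fin (k + 1) → SmoothFun E M) :
    bracketDifferential (anchorDerivation (quasiAnchor e e' ρ π))
      (oneFormBracket hC (isIsotropic_quasiAnchor (ρ := ρ) (π := π) hC)) P.toAlternating
      (fun i => (f i).differential)
    = poissonDifferential π P f + (1 / 2 : ℝ) • ∑ i, ∑ j : Fin (k + 1), (-1 : ℝ) ^ (j : ℕ) •
        (⁅ρ (e' i), f j⁆ * lieMultivector (ρ (e i)) P (j.removeNth f)) := by
  let df : Fin (k + 1) → OneForm E M := fun i => (f i).differential
  -- Chosen so that `[dfᵢ, dfⱼ] = d{fᵢ, fⱼ} + W j i - W i j`, the shape produced by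
  -- `AlternatingMap.sum_map_update_removeNth`.
  let W : Fin (k + 1) → Fin (k + 1) → OneForm E M := fun j i =>
    (-(1 / 2 : ℝ)) • ∑ a, ⁅ρ (e' a), f j⁆ • (⁅ρ (e a), f i⁆ : SmoothFun E M).differential
  have hW := AlternatingMap.sum_map_update_removeNth P.toAlternating.restrictReal df W
  have hup : ∀ (n : ℕ) (Q : MultivectorField E M n) (g : Fin n → SmoothFun E M) l h,
      Q.toAlternating (Function.update (fun i => (g i).differential) l h.differential)
        = Q.onSmooth (Function.update g l h) := by
    intro n Q g l h
    rw [MultivectorField.onSmooth]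
    congr 1
    ext m : 1
    rcases eq_or_ne m l with rfl | hm <;> simp [*]
  have hrem : ∀ (j i : Fin (k + 1)) (h : SmoothFun E M),
      P.toAlternating (j.removeNth (Function.update df i h.differential))
        = P.onSmooth (j.removeNth (Function.update f i h)) := by
    intro j i h
    rw [MultivectorField.onSmooth]
    congr 1
    ext m : 1
    simp only [Fin.removeNth, df]
    rcases eq_or_ne (j.succAbove m) i with hm | hm <;> simp [*]
  have hWl : ∀ (j : Fin (k + 1)) (l : Fin k),
      P.toAlternating (Function.update (j.removeNth df) l (W j (j.succAbove l)))
      = (-(1 / 2 : ℝ)) • ∑ a, ⁅ρ (e' a), f j⁆ *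
          P.onSmooth (Function.update (j.removeNth f) l ⁅ρ (e a), j.removeNth f l⁆) := by
    intro j l
    have h1 : ∀ x, P.toAlternating (Function.update (j.removeNth df) l ((-(1 / 2 : ℝ)) • x))
        = (-(1 / 2 : ℝ)) • P.toAlternating (Function.update (j.removeNth df) l x) :=
      P.toAlternating.restrictReal.map_update_smul _ _ _
    simp only [W, h1, AlternatingMap.map_update_sum, AlternatingMap.map_update_smul, smul_eq_mul,
      ← hup]
    rfl
  have hbr : ∀ i j, oneFormBracket hC (isIsotropic_quasiAnchor (ρ := ρ) (π := π) hC) (df i) (df j)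
      = (π.poisson (f i) (f j)).differential + (W j i - W i j) := fun i j =>
    oneFormBracket_differential hC (f i) (f j)
  have hadd : ∀ (j i : Fin (k + 1)) (x y : OneForm E M), i ≠ j →
      P.toAlternating (j.removeNth (Function.update df i (x + y)))
        = P.toAlternating (j.removeNth (Function.update df i x))
          + P.toAlternating (j.removeNth (Function.update df i y)) := by
    intro j i x y hij
    obtain ⟨l, rfl⟩ := Fin.exists_succAbove_eq hij
    simp only [Fin.removeNth_update_succAbove, AlternatingMap.map_update_add]
  have hfirst : ∀ j, anchorDerivation (quasiAnchor e e' ρ π) (df j)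
      (P.toAlternating (j.removeNth df))
      = π.poisson (f j) (P.onSmooth (j.removeNth f))
        + (1 / 2 : ℝ) • ∑ a, ⁅ρ (e' a), f j⁆ * ⁅ρ (e a), P.onSmooth (j.removeNth f)⁆ := by
    intro j
    rw [anchorDerivation_apply, SmoothFun.toDual_differential, quasiAnchor_exactForm_lie]
    rfl
  simp only [AlternatingMap.restrictReal_apply, hWl] at hW
  change bracketDifferential _ _ _ df = _
  rw [bracketDifferential, poissonDifferential]
  have hsecond : ∑ j : Fin (k + 1), ∑ i ∈ Finset.Iio j, (-1 : ℝ) ^ (j : ℕ) •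
        P.toAlternating (j.removeNth (Function.update df i
          (oneFormBracket hC (isIsotropic_quasiAnchor (ρ := ρ) (π := π) hC) (df i) (df j))))
      = ∑ j : Fin (k + 1), ∑ i ∈ Finset.Iio j, (-1 : ℝ) ^ (j : ℕ) •
          P.onSmooth (j.removeNth (Function.update f i (π.poisson (f i) (f j))))
        + ∑ j : Fin (k + 1), ∑ i ∈ Finset.Iio j, (-1 : ℝ) ^ (j : ℕ) •
          P.toAlternating (j.removeNth (Function.update df i (W j i - W i j))) := by
    simp only [← Finset.sum_add_distrib]
    refine Finset.sum_congr rfl fun j _ => Finset.sum_congr rfl fun i hi => ?_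
    rw [hbr, hadd _ _ _ _ (Finset.mem_Iio.1 hi).ne, hrem, smul_add]
  have hlast : ∀ j : Fin (k + 1),
      (1 / 2 : ℝ) • ∑ a, ⁅ρ (e' a), f j⁆ * ⁅ρ (e a), P.onSmooth (j.removeNth f)⁆
        + ∑ l, (-(1 / 2 : ℝ)) • ∑ a, ⁅ρ (e' a), f j⁆ *
          P.onSmooth (Function.update (j.removeNth f) l ⁅ρ (e a), j.removeNth f l⁆)
      = (1 / 2 : ℝ) • ∑ a, ⁅ρ (e' a), f j⁆ * lieMultivector (ρ (e a)) P (j.removeNth f) := by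
    intro j
    simp only [lieMultivector, mul_sub, Finset.sum_sub_distrib, Finset.mul_sum,
      ← Finset.smul_sum]
    rw [Finset.sum_comm]
    module
  have hwedge : (1 / 2 : ℝ) • ∑ a, ∑ j : Fin (k + 1), (-1 : ℝ) ^ (j : ℕ) •
        (⁅ρ (e' a), f j⁆ * lieMultivector (ρ (e a)) P (j.removeNth f))
      = ∑ j : Fin (k + 1), (-1 : ℝ) ^ (j : ℕ) • ((1 / 2 : ℝ) •
        ∑ a, ⁅ρ (e' a), f j⁆ * lieMultivector (ρ (e a)) P (j.removeNth f)) := by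
    rw [Finset.sum_comm, Finset.smul_sum]
    refine Finset.sum_congr rfl fun j _ => ?_
    rw [← Finset.smul_sum, smul_comm]
  rw [hsecond, ← hW, hwedge]
  simp only [hfirst, ← hlast, smul_add, Finset.sum_add_distrib]
  abel

end Differential

/-! ### The quasi-Poisson Lie algebroid: differential and invariance -/

section QuasiDifferential

open Module

variable {E : Type*} [NormedAddCommGroup E] [NormedSpace ℝ E] [FiniteDimensional ℝ E]
  {M : Type*} [TopologicalSpace M] [ChartedSpace E M] [IsManifold 𝓘(ℝ, E) ∞ M] [T2Space M]
  {𝔤 ι : Type*} [Fintype ι] [LieRing 𝔤] [LieAlgebra ℝ 𝔤]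
  {ρ : 𝔤 →ₗ⁅ℝ⁆ SmoothVectorField E M} {e e' : ι → 𝔤} {π : MultivectorField E M 2}

lemma bracketDifferentialAux_oneFormBracket
    {a : Dual (SmoothFun E M) (SmoothVectorField E M) →ₗ[SmoothFun E M] SmoothVectorField E M}
    (hC : IsInvariantSymmetric e e') (ha : IsIsotropic a ρ e e') {k : ℕ}
    (P : MultivectorField E M k) (s : Fin (k + 1) → OneForm E M) :
    bracketDifferentialAux (anchorDerivation a) (oneFormBracket hC ha) P.toAlternating s
      = bracketDifferential (anchorDerivation a) (oneFormBracket hC ha) P.toAlternating s :=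
  bracketDifferentialAux_eq _ _ _ (oneFormBracket_skew hC ha) s

/-- The Lie algebroid differential of a multivector field, as a multivector field. -/
def multivectorDifferential
    {a : Dual (SmoothFun E M) (SmoothVectorField E M) →ₗ[SmoothFun E M] SmoothVectorField E M}
    (hC : IsInvariantSymmetric e e') (ha : IsIsotropic a ρ e e') {k : ℕ}
    (P : MultivectorField E M k) : MultivectorField E M (k + 1) :=
  BundleForm.ofAlternating (AlternatingMap.ofConsSmul
    (bracketDifferentialAux (anchorDerivation a) (oneFormBracket hC ha) P.toAlternating)
    (bracketDifferentialAux_smul _ _ _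
      (fun s t f => oneFormBracket_smul_right hC ha s t f)
      (fun s t f => oneFormBracket_smul_left hC ha s t f)))

lemma multivectorDifferential_apply
    {a : Dual (SmoothFun E M) (SmoothVectorField E M) →ₗ[SmoothFun E M] SmoothVectorField E M}
    (hC : IsInvariantSymmetric e e') (ha : IsIsotropic a ρ e e') {k : ℕ}
    (P : MultivectorField E M k) (s : Fin (k + 1) → OneForm E M) (x : M) :
    (multivectorDifferential hC ha P).toFun x (fun i => s i x)
      = bracketDifferential (anchorDerivation a) (oneFormBracket hC ha) P.toAlternating s x := by
  rw [multivectorDifferential, BundleForm.ofAlternating_apply,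
    ← bracketDifferentialAux_oneFormBracket]
  rfl

lemma isQuasiPoissonDifferential_iff {ρ : 𝔤 →ₗ[ℝ] SmoothVectorField E M} {k : ℕ}
    {P : MultivectorField E M k} {R : MultivectorField E M (k + 1)} :
    IsQuasiPoissonDifferential e e' ρ π P R ↔ ∀ f : Fin (k + 1) → SmoothFun E M,
      R.onSmooth f = poissonDifferential π P f + (1 / 2 : ℝ) • ∑ i, ∑ j : Fin (k + 1),
        (-1 : ℝ) ^ (j : ℕ) • (⁅ρ (e' i), f j⁆ * lieMultivector (ρ (e i)) P (j.removeNth f)) := by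
  refine forall_congr' fun f => ?_
  have h : ∀ i, wedgeVector (ρ (e' i)) (schoutenVector (ρ (e i)) P) (fun l => f l)
      = _ := fun i => wedgeVector_coe (ρ (e' i)) (schoutenVector_coe (ρ (e i)) P) f
  simp only [R.onFun_coe, schoutenBivector_coe, h]
  rw [ContMDiffMap.ext_iff]
  refine forall_congr' fun x => ?_
  simp only [ContMDiffMap.coe_add, Pi.add_apply, ContMDiffMap.coe_smul, Pi.smul_apply,
    SmoothFun.sum_apply, smul_eq_mul]

variable (hC : IsInvariantSymmetric e e')
  (he : IsEquivariant (quasiAnchor e e' ρ π) ρ)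
  (hanchor : ∀ α β, quasiAnchor e e' ρ π (formBracket (quasiAnchor e e' ρ π) ρ e e' α β)
    = ⁅quasiAnchor e e' ρ π α, quasiAnchor e e' ρ π β⁆)

/-- The Lie algebroid structure on the cotangent bundle of a quasi-Poisson manifold. -/
abbrev quasiPoissonAlgebroid : LieAlgebroid E (E →L[ℝ] ℝ) (CotangentSpace E : M → Type _) :=
  cotangentAlgebroid hC (isIsotropic_quasiAnchor hC) he hanchor

lemma hasQuasiPoissonDifferential_quasiPoissonAlgebroid :
    HasQuasiPoissonDifferential e e' ρ.toLinearMap π (quasiPoissonAlgebroid hC he hanchor) := by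
  intro k P
  refine ⟨multivectorDifferential hC (isIsotropic_quasiAnchor (ρ := ρ) (π := π) hC) P, ?_, ?_⟩
  · rw [isQuasiPoissonDifferential_iff]
    intro f
    rw [LieHom.coe_toLinearMap, ← bracketDifferential_differential hC]
    ext x
    exact multivectorDifferential_apply hC _ P (fun i => (f i).differential) x
  · intro s x
    rw [multivectorDifferential_apply, cotangentAlgebroid_differential]

lemma actionPreserves_quasiPoissonAlgebroid :
    ActionPreserves ρ.toLinearMap (quasiPoissonAlgebroid hC he hanchor) := by
  intro ξ
  refine ⟨LinearMap.mk (AddHom.mk (fun α => OneForm.toDual.symm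
    (lieDerivForm (ρ ξ) (OneForm.toDual α))) fun α β => ?_) fun c α => ?_, ?_, ?_, ?_⟩
  · simp only [map_add]
  · refine OneForm.toDual.injective ?_
    change OneForm.toDual (OneForm.toDual.symm (lieDerivForm (ρ ξ)
      (OneForm.toDual (algebraMap ℝ (SmoothFun E M) c • α)))) = OneForm.toDual
      (algebraMap ℝ (SmoothFun E M) c • OneForm.toDual.symm (lieDerivForm (ρ ξ) (OneForm.toDual α)))
    rw [LinearEquiv.apply_symm_apply, LinearEquiv.map_smul, LinearEquiv.map_smul,
      LinearEquiv.apply_symm_apply, algebraMap_smul, algebraMap_smul, map_smul]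
  · intro α Y x
    exact OneForm.pairing_toDual_symm _ Y x
  · intro α β
    refine OneForm.toDual.injective ?_
    change OneForm.toDual (OneForm.toDual.symm (lieDerivForm (ρ ξ)
      (OneForm.toDual (oneFormBracket hC (isIsotropic_quasiAnchor hC) α β)))) = OneForm.toDual
      (oneFormBracket hC (isIsotropic_quasiAnchor hC) (OneForm.toDual.symm (lieDerivForm (ρ ξ) (OneForm.toDual α))) β
        + oneFormBracket hC (isIsotropic_quasiAnchor hC) α (OneForm.toDual.symm (lieDerivForm (ρ ξ) (OneForm.toDual β))))
    simp only [map_add, toDual_oneFormBracket, LinearEquiv.apply_symm_apply]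
    exact lieDerivForm_formBracket hC he ξ _ _
  · intro α x
    refine (anchorAt_apply _ (OneForm.toDual.symm (lieDerivForm (ρ ξ) (OneForm.toDual α))) x).trans
      ?_
    rw [LinearEquiv.apply_symm_apply, he]
    simp only [cotangentAlgebroid, anchorAt_apply]
    rfl

end QuasiDifferential

/-! ### Uniqueness -/

section Uniqueness

variable {E : Type*} [NormedAddCommGroup E] [NormedSpace ℝ E] [FiniteDimensional ℝ E]
  {M : Type*} [TopologicalSpace M] [ChartedSpace E M] [IsManifold 𝓘(ℝ, E) ∞ M] [T2Space M]

/-- Multivector fields are determined by their values on differentials of smooth functions. -/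
lemma MultivectorField.toFun_eq_of_onSmooth {k : ℕ} {P Q : MultivectorField E M k}
    (h : ∀ f : Fin k → SmoothFun E M, P.onSmooth f = Q.onSmooth f) (x : M) :
    P.toFun x = Q.toFun x := by
  ext α
  choose f hf using fun i => exists_covectorOf_eq (α i)
  have h1 : α = fun i => (f i).differential x := by
    ext i : 1
    rw [SmoothFun.differential_apply, hf]
  rw [h1]
  exact DFunLike.congr_fun (h f) x

/-- A smooth function as a multivector field of degree zero. -/
def SmoothFun.toMultivector (g : SmoothFun E M) : MultivectorField E M 0 where
  toFun x := AlternatingMap.constOfIsEmpty ℝ _ (Fin 0) (g x)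
  smooth' _ := g.contMDiff

variable {𝔤 ι : Type*} [Fintype ι] [LieRing 𝔤] [LieAlgebra ℝ 𝔤]
  {ρ : 𝔤 →ₗ[ℝ] SmoothVectorField E M} {e e' : ι → 𝔤} {π : MultivectorField E M 2}
  {L L' : LieAlgebroid E (E →L[ℝ] ℝ) (CotangentSpace E : M → Type _)}

lemma HasQuasiPoissonDifferential.differential_eq (hL : HasQuasiPoissonDifferential e e' ρ π L)
    (hL' : HasQuasiPoissonDifferential e e' ρ π L') {k : ℕ} (P : MultivectorField E M k)
    (s : Fin (k + 1) → OneForm E M) (x : M) :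
    L.differential P.toFun s x = L'.differential P.toFun s x := by
  obtain ⟨R, hR, hRd⟩ := hL k P
  obtain ⟨R', hR', hRd'⟩ := hL' k P
  rw [isQuasiPoissonDifferential_iff] at hR hR'
  rw [← hRd, ← hRd', MultivectorField.toFun_eq_of_onSmooth fun f => (hR f).trans (hR' f).symm]

/-- The differential of a function `g` on a 1-form `α` is `a(α) g`, so degree zero determines the
anchor. -/
lemma HasQuasiPoissonDifferential.anchor_eq (hL : HasQuasiPoissonDifferential e e' ρ π L)
    (hL' : HasQuasiPoissonDifferential e e' ρ π L') : L.anchor = L'.anchor := by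
  funext x
  ext α : 1
  refine tangent_ext fun g => ?_
  have h := hL.differential_eq hL' g.toMultivector (fun _ =>
    Sections.extension E (E →L[ℝ] ℝ) (CotangentSpace E : M → Type _) x α) x
  have h0 : Finset.Iio (0 : Fin 1) = ∅ := rfl
  simp only [LieAlgebroid.differential, Fin.sum_univ_succ (n := 0), Finset.univ_eq_empty,
    Finset.sum_empty, h0, add_zero, Fin.val_zero, pow_zero, one_mul,
    Sections.extension_apply] at h
  exact h

/-- Once the anchors agree, the differential of a vector field `X` on two 1-forms leaves only the
pairing of their bracket with `X`. Anchor and bracket are all the data of the structure. -/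
lemma HasQuasiPoissonDifferential.unique (hL : HasQuasiPoissonDifferential e e' ρ π L)
    (hL' : HasQuasiPoissonDifferential e e' ρ π L') : L = L' := by
  have ha := hL.anchor_eq hL'
  have hb : L.bracket = L'.bracket := by
    ext s t x : 3
    refine covector_ext fun X => ?_
    have h := hL.differential_eq hL' (SmoothVectorField.toMultivector X) ![s, t] x
    have h0 : Finset.Iio (0 : Fin 2) = ∅ := rfl
    have h1 : Finset.Iio (1 : Fin 2) = {0} := rfl
    simp only [LieAlgebroid.differential, ha, Fin.sum_univ_two (f := fun j : Fin 2 =>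
      ∑ i ∈ Finset.Iio j, _), h0, h1, Finset.sum_empty, Finset.sum_singleton, zero_add,
      add_right_inj] at h
    have h2 : (-1 : ℝ) ^ 1 * pairing (L.bracket s t x) (X x)
      = (-1 : ℝ) ^ 1 * pairing (L'.bracket s t x) (X x) := h
    linarith
  cases L
  cases L'
  simp only at ha hb
  subst ha hb
  rfl

end Uniqueness

/-! ### The moment map -/

section Moment

open Module

lemma Derivation.map_prod_eq_sum_update {A : Type*} [CommRing A] [Algebra ℝ A]
    (D : Derivation ℝ A A) {k : ℕ} (g : Fin k → A) :
    D (∏ m, g m) = ∑ l, ∏ m, Function.update g l (D (g l)) m := by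
  induction k with
  | zero => simp
  | succ k ih =>
    have h0 : ∏ m, Function.update g 0 (D (g 0)) m = (∏ m : Fin k, g m.succ) * D (g 0) := by
      rw [Fin.prod_univ_succ, mul_comm]
      simp
    have hs : ∀ l : Fin k, ∏ m, Function.update g l.succ (D (g l.succ)) m
        = g 0 * ∏ m, Function.update (fun m => g m.succ) l (D (g l.succ)) m := by
      intro l
      rw [Fin.prod_univ_succ]
      congr 1
      refine Finset.prod_congr rfl fun m _ => ?_
      rcases eq_or_ne m l with rfl | hm
      · simp
      · simp [hm]
    rw [Fin.prod_univ_succ, D.leibniz, ih, Fin.sum_univ_succ, add_comm, h0]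
    simp only [hs, Finset.mul_sum, smul_eq_mul]

variable {E : Type*} [NormedAddCommGroup E] [NormedSpace ℝ E] [FiniteDimensional ℝ E]
  {M : Type*} [TopologicalSpace M] [ChartedSpace E M] [IsManifold 𝓘(ℝ, E) ∞ M] [T2Space M]

/-- The chain rule for an alternating form evaluated on vector-valued functions. -/
lemma AlternatingMap.dirDeriv_comp {𝔥 ι : Type*} [AddCommGroup 𝔥] [Module ℝ 𝔥] [Fintype ι]
    {k : ℕ} (θ : 𝔥 [⋀^Fin k]→ₗ[ℝ] ℝ) (e : ι → 𝔥) (c : Fin k → ι → SmoothFun E M)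
    (X : SmoothVectorField E M) (x : M) :
    dirDeriv (X x) (fun y => θ fun l => ∑ a, c l a y • e a)
      = ∑ l, θ (Function.update (fun l => ∑ a, c l a x • e a) l
          (∑ a, (⁅X, c l a⁆ : SmoothFun E M) x • e a)) := by
  classical
  have h : ∀ (c : Fin k → ι → SmoothFun E M) y, θ (fun l => ∑ a, c l a y • e a)
      = (∑ r : Fin k → ι, θ (fun l => e (r l)) • ∏ l, c l (r l) : SmoothFun E M) y := by
    intro c y
    have h1 : ∀ r : Fin k → ι, (∏ l, c l (r l)) y = ∏ l, c l (r l) y := fun r =>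
      map_prod (ContMDiffMap.evalRingHom y) _ _
    rw [SmoothFun.sum_apply]
    refine (θ.toMultilinearMap.map_sum _).trans (Finset.sum_congr rfl fun r _ => ?_)
    refine (θ.toMultilinearMap.map_smul_univ _ _).trans ?_
    rw [ContMDiffMap.coe_smul, Pi.smul_apply, h1, smul_eq_mul, smul_eq_mul, mul_comm]
    rfl
  have h2 : ∀ l, Function.update (fun l => ∑ a, c l a x • e a) l
        (∑ a, (⁅X, c l a⁆ : SmoothFun E M) x • e a)
      = fun m => ∑ a, Function.update c l (fun a => ⁅X, c l a⁆) m a x • e a := by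
    intro l
    ext m
    rcases eq_or_ne m l with rfl | hm <;> simp [*]
  have h3 : ∀ (r : Fin k → ι) l m, Function.update c l (fun a => ⁅X, c l a⁆) m (r m)
      = Function.update (fun m => c m (r m)) l ⁅X, c l (r l)⁆ m := by
    intro r l m
    rcases eq_or_ne m l with rfl | hm <;> simp [*]
  have h4 : ∀ r : Fin k → ι, ⁅X, ∏ l, c l (r l)⁆
      = ∑ l, ∏ m, Function.update (fun m => c m (r m)) l ⁅X, c l (r l)⁆ m := fun r =>
    (LieRinehartAlgebra.anchor ℝ (SmoothFun E M) _ X).map_prod_eq_sum_update fun m => c m (r m)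
  simp only [h2, h, h3]
  rw [← SmoothFun.sum_apply, Finset.sum_comm]
  simp only [← Finset.smul_sum, ← h4, ← lie_smul, ← lie_sum']
  rfl

end Moment

/-! ### The moment map as a Lie algebroid morphism -/

section MomentMorphism

open Module

variable {E : Type*} [NormedAddCommGroup E] [NormedSpace ℝ E] [FiniteDimensional ℝ E]
  {M : Type*} [TopologicalSpace M] [ChartedSpace E M] [IsManifold 𝓘(ℝ, E) ∞ M] [T2Space M]
  {𝔤 ι : Type*} [Fintype ι] [DecidableEq ι] [LieRing 𝔤] [LieAlgebra ℝ 𝔤] [FiniteDimensional ℝ 𝔤]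
  {B : LinearMap.BilinForm ℝ 𝔤} {hB : IsQuadratic B}
  {ρ : 𝔤 →ₗ⁅ℝ⁆ SmoothVectorField E M} {e e' : Basis ι ℝ 𝔤}

lemma momentMap_apply (he : ∀ i j, B (e i) (e' j) = if i = j then 1 else 0)
    (α : OneForm E M) (x : M) : momentMap B hB ρ.toLinearMap x (α x)
      = ∑ i, OneForm.toDual α (ρ (e' i)) x • e i :=
  sharp_eq_sum hB he _

/-- The bracket in a quadratic Lie algebra in terms of dual bases. -/
lemma sum_smul_sum_lie_dual (hB : IsQuadratic B)
    (he : ∀ i j, B (e i) (e' j) = if i = j then 1 else 0) (p q : Dual ℝ 𝔤) :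
    ∑ i, (∑ j, p ⁅e j, e' i⁆ * q (e' j)) • e i = ⁅sharp B hB p, sharp B hB q⁆ := by
  have h : ∀ ξ, B (sharp B hB p) ξ = p ξ := fun ξ =>
    LinearMap.BilinForm.apply_toDual_symm_apply (hB := hB.nondegenerate) p ξ
  rw [← sum_smul_of_dual_left he ⁅sharp B hB p, sharp B hB q⁆]
  refine Finset.sum_congr rfl fun i _ => ?_
  rw [hB.invariant, h, sharp_eq_sum hB he q]
  simp only [sum_lie, smul_lie, map_sum, map_smul, smul_eq_mul, mul_comm]

variable {a : Dual (SmoothFun E M) (SmoothVectorField E M) →ₗ[SmoothFun E M] SmoothVectorField E M}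
  (hC : IsInvariantSymmetric e e') (ha : IsIsotropic a ρ e e') (hequiv : IsEquivariant a ρ)
  (hanchor : ∀ α β, a (formBracket a ρ e e' α β) = ⁅a α, a β⁆)

/-- This is `formBracket_comoment` in coordinates, a Maurer–Cartan type equation: `μ` preserves
brackets up to derivatives of its components along the anchor. -/
lemma momentMap_oneFormBracket (he : ∀ i j, B (e i) (e' j) = if i = j then 1 else 0)
    (hequiv : IsEquivariant a ρ) (α β : OneForm E M) (x : M) :
    ∑ i, (⁅a (OneForm.toDual β), OneForm.toDual α (ρ (e' i))⁆ : SmoothFun E M) x • e i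
      - ∑ i, (⁅a (OneForm.toDual α), OneForm.toDual β (ρ (e' i))⁆ : SmoothFun E M) x • e i
      + momentMap B hB ρ.toLinearMap x (oneFormBracket hC ha α β x)
    = ⁅momentMap B hB ρ.toLinearMap x (α x), momentMap B hB ρ.toLinearMap x (β x)⁆ := by
  have h : ∀ i, OneForm.toDual (oneFormBracket hC ha α β) (ρ (e' i)) x
      = (⁅a (OneForm.toDual α), OneForm.toDual β (ρ (e' i))⁆ : SmoothFun E M) x
        - (⁅a (OneForm.toDual β), OneForm.toDual α (ρ (e' i))⁆ : SmoothFun E M) x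
        + ∑ j, transposeAt ρ.toLinearMap x (α x) ⁅e j, e' i⁆
          * transposeAt ρ.toLinearMap x (β x) (e' j) := by
    intro i
    rw [toDual_oneFormBracket, formBracket_comoment ha hequiv]
    simp only [ContMDiffMap.coe_add, ContMDiffMap.coe_sub, Pi.add_apply, Pi.sub_apply,
      SmoothFun.sum_apply]
    rfl
  have h2 := sum_smul_sum_lie_dual hB he (transposeAt ρ.toLinearMap x (α x))
    (transposeAt ρ.toLinearMap x (β x))
  rw [momentMap_apply he]
  simp only [h, add_smul, sub_smul, Finset.sum_add_distrib, Finset.sum_sub_distrib]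
  rw [h2]
  simp only [momentMap, LinearMap.comp_apply]
  abel

lemma isMorphismToLieAlgebra_momentMap (he : ∀ i j, B (e i) (e' j) = if i = j then 1 else 0) :
    (cotangentAlgebroid hC ha hequiv hanchor).IsMorphismToLieAlgebra
      (momentMap B hB ρ.toLinearMap) where
  smooth ℓ s := by
    have h : ∀ x, ℓ (momentMap B hB ρ.toLinearMap x (s x))
        = (∑ i, ℓ (e i) • OneForm.toDual s (ρ (e' i)) : SmoothFun E M) x := by
      intro x
      rw [momentMap_apply he, map_sum, SmoothFun.sum_apply]
      refine Finset.sum_congr rfl fun i _ => ?_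
      rw [map_smul, smul_eq_mul, mul_comm]
      rfl
    simp only [h]
    exact ContMDiffMap.contMDiff _
  pullback_differential k θ s x := by
    let μ : Fin (k + 1) → 𝔤 := fun i => momentMap B hB ρ.toLinearMap x (s i x)
    -- `W j i` is the derivative of `μ(sᵢ)` along `a(sⱼ)` at `x`. By the chain rule these
    -- derivatives make up the anchor part of the differential, and antisymmetrizing them cancels
    -- the derivative terms in `μ([sᵢ, sⱼ])`.
    let W : Fin (k + 1) → Fin (k + 1) → 𝔤 := fun j i =>
      ∑ b, (⁅a (OneForm.toDual (s j)), OneForm.toDual (s i) (ρ (e' b))⁆ : SmoothFun E M) x • e b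
    have hW := AlternatingMap.sum_map_update_removeNth θ μ W
    have hfirst : ∀ j : Fin (k + 1), dirDeriv (anchorAt a x (s j x)) (fun y =>
          θ fun l => momentMap B hB ρ.toLinearMap y (j.removeNth s l y))
        = ∑ l, θ (Function.update (j.removeNth μ) l (W j (j.succAbove l))) := by
      intro j
      simp only [momentMap_apply he, anchorAt_apply]
      rw [θ.dirDeriv_comp e (fun l b => OneForm.toDual (j.removeNth s l) (ρ (e' b)))]
      simp only [← momentMap_apply (hB := hB) he]
      rfl
    have hsecond : ∀ i j : Fin (k + 1), i ≠ j →
        θ (fun l => momentMap B hB ρ.toLinearMap x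
          (j.removeNth (Function.update s i (oneFormBracket hC ha (s i) (s j))) l x))
        = θ (j.removeNth (Function.update μ i ⁅μ i, μ j⁆))
          - θ (j.removeNth (Function.update μ i (W j i - W i j))) := by
      intro i j hij
      have h1 : (fun l => momentMap B hB ρ.toLinearMap x
          (j.removeNth (Function.update s i (oneFormBracket hC ha (s i) (s j))) l x))
          = j.removeNth (Function.update μ i (momentMap B hB ρ.toLinearMap x
            (oneFormBracket hC ha (s i) (s j) x))) := by
        ext l
        simp only [Fin.removeNth]
        rcases eq_or_ne (j.succAbove l) i with hl | hl <;> simp [hl, μ]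
      have h2 : momentMap B hB ρ.toLinearMap x (oneFormBracket hC ha (s i) (s j) x)
          = ⁅μ i, μ j⁆ - (W j i - W i j) := by
        rw [eq_sub_iff_add_eq, ← momentMap_oneFormBracket hC ha he hequiv, add_comm]
      obtain ⟨l, rfl⟩ := Fin.exists_succAbove_eq hij
      rw [h1, h2]
      simp only [Fin.removeNth_update_succAbove, AlternatingMap.map_update_sub]
    rw [LieAlgebroid.differential, chevalleyEilenberg]
    simp only [AlternatingMap.compLinearMap_apply, smul_eq_mul] at hW ⊢
    have h3 : ∑ j : Fin (k + 1), ∑ i ∈ Finset.Iio j, (-1 : ℝ) ^ (j : ℕ) *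
          θ (fun l => momentMap B hB ρ.toLinearMap x
            (j.removeNth (Function.update s i (oneFormBracket hC ha (s i) (s j))) l x))
        = ∑ j : Fin (k + 1), ∑ i ∈ Finset.Iio j, (-1 : ℝ) ^ (j : ℕ) *
            θ (j.removeNth (Function.update μ i ⁅μ i, μ j⁆))
          - ∑ j : Fin (k + 1), ∑ i ∈ Finset.Iio j, (-1 : ℝ) ^ (j : ℕ) *
            θ (j.removeNth (Function.update μ i (W j i - W i j))) := by
      simp only [← Finset.sum_sub_distrib, ← mul_sub]
      refine Finset.sum_congr rfl fun j _ => Finset.sum_congr rfl fun i hi => ?_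
      rw [hsecond i j (Finset.mem_Iio.1 hi).ne]
    simp only [cotangentAlgebroid, hfirst]
    rw [h3, hW, add_sub_cancel]

end MomentMorphism

theorem theorem1p4
    {E : Type*} [NormedAddCommGroup E] [NormedSpace ℝ E] [FiniteDimensional ℝ E]
    {M : Type*} [TopologicalSpace M] [ChartedSpace E M] [IsManifold 𝓘(ℝ, E) ∞ M]
    [T2Space M] [SecondCountableTopology M]
    {𝔤 : Type*} [LieRing 𝔤] [LieAlgebra ℝ 𝔤] [FiniteDimensional ℝ 𝔤]
    (B : LinearMap.BilinForm ℝ 𝔤) (hB : IsQuadratic B)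
    (ρ : 𝔤 →ₗ[ℝ] SmoothVectorField E M) (π : MultivectorField E M 2)
    (hqP : IsQuasiPoisson B hB ρ π)
    {ι : Type*} [Fintype ι] [DecidableEq ι] (e e' : Module.Basis ι ℝ 𝔤)
    (he : ∀ i j, B (e i) (e' j) = if i = j then 1 else 0) :
    ∃ L : LieAlgebroid E (E →L[ℝ] ℝ) (CotangentSpace E : M → Type _),
      HasQuasiPoissonDifferential e e' ρ π L ∧
      (∀ L' : LieAlgebroid E (E →L[ℝ] ℝ) (CotangentSpace E : M → Type _),
        HasQuasiPoissonDifferential e e' ρ π L' → L' = L) ∧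
      ActionPreserves ρ L ∧
      L.IsMorphismToLieAlgebra (momentMap B hB ρ) := by
  have hC := hB.isInvariantSymmetric he
  have hequiv : IsEquivariant (quasiAnchor e e' hqP.actionHom π) hqP.actionHom :=
    isEquivariant_quasiAnchor hC hqP.lie_poisson
  have hanchor := anchor_formBracket hasEnoughFunctions_smoothVectorField hC
    (isIsotropic_quasiAnchor hC) hequiv fun f g h => by
      simpa only [hamiltonianField_quasiAnchor_lie hC] using hqP.jacobi he f g h
  have hd := hasQuasiPoissonDifferential_quasiPoissonAlgebroid hC hequiv hanchor
  exact ⟨quasiPoissonAlgebroid hC hequiv hanchor, hd, fun L' hL' => hL'.unique hd,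
    actionPreserves_quasiPoissonAlgebroid hC hequiv hanchor,
    isMorphismToLieAlgebra_momentMap hC (isIsotropic_quasiAnchor hC) hequiv hanchor he⟩

end
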